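/- **Setting.** Let $M$ be a complex manifold of dimension $n+d$ and $C\subset M$ a compact complex submanifold of dimension $n$ such that $T_CM=TM|_C$ splits holomorphically as $TC\oplus N_C$ and the normal bundle $N_C$ is unitary. Accordingly, fix numbers $0<r_*<r^*$ and a finite family of holomorphic charts $\Phi_j=(z_j,w_j)\in\mathbf C^n\times\mathbf C^d$ of $M$ in which $C$ is given by $w_j=0$, whose images contain $\{|z|_\infty\le r^*\}\times\{0\}$, such that the sets $U_j^{r}=\{p\in C: |z_j(p)|_\infty<r\}$ cover $C$ for $r=r_*$, and such that on $U_k^{r^*}\cap U_j^{r^*}$ one has $\partial z_k/\partial w_j=0$ (the charts respect the splitting) and the transition matrix $t_{kj}=\partial w_k/\partial w_j$ of $N_C$ is unitary. Let $\Phi_{kj}=\Phi_k\Phi_j^{-1}$, let $\varphi_{kj}=z_k\circ z_j^{-1}$ be the transition functions of $C$, and let $\mathcal U^r=\{U_j^r\}$, $\hat U_j=z_j(U_j^{r^*})$, $\hat U_{kj}=z_j(U_k^{r^*}\cap U_j^{r^*})$. **Small divisors.** Write a holomorphic $0$-cochain $u=\{u_j\}$ of $\mathcal U^r$ with values in $N_C\otimes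 S^m(N_C^*)$ as $u_j(z,v)=\sum_{|Q|=m}u_{j,Q}(z)v^Q\in\mathbf C^d$; its coboundary is $$(\delta u)_{kj}(z,v)=t_{kj}(z)u_j(z,v)-u_k(\varphi_{kj}(z),t_{kj}(z)v).$$ Measure polynomials in $v$ by the modified Fischer norm $|\sum_Q a_Qv^Q|^2=\sum_Q\frac{Q!}{|Q|!}|a_Q|^2$ (summed over the $d$ components), and let $\|\cdot\|_{\mathcal U^r}$ be the maximum over the sets $U_j^r$ (for $0$-cochains), or $U_k^r\cap U_j^r$ (for $1$-cochains), of the resulting $L^2$ norms in the coordinate $z_j$. Put $$K_*(N_C\otimes S^mN_C^*)=\sup_{u_1}\inf_{u_0}\|u_0\|_{\mathcal U^{r_*}},$$ where $u_1$ runs over the $0$-cochains of $\mathcal U^{r^*}$ with $\|\delta u_1\|_{\mathcal U^{r^*}}=1$, and $u_0$ over the $0$-cochains of $\mathcal U^{r_*}$ with $\delta u_0=\delta u_1$ on $\mathcal U^{r_*}$, and $$K(N_C\otimes S^mN_C^*)=|\{t_{kj}\}|+K_*(N_C\otimes S^mN_C^*)\,|\{t_{kj}\}|\,|\{t_{kj}(S^mN_C^*)\}|,$$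 where $|\{\cdot\}|$ is the supremum over all $U_k^{r^*}\cap U_j^{r^*}$ of the operator norms of the transition matrices of $N_C$, respectively of $S^mN_C^*$ (for the modified Fischer norm). Let $\eta_0=\eta_1=1$ and, for $m\ge2$, $$\eta_m=K(N_C\otimes S^mN_C^*)\max_{m_1+\cdots+m_p+s=m}\eta_{m_1}\cdots\eta_{m_p},\qquad 1\le m_i<m,\ s\in\mathbf N.$$ **Vertical linearizations.** A neighborhood of $C$ is *holomorphically vertically linearizable* if there are maps $F_j(h,v)=(h,v)+O(|v|^2)$, holomorphic near $\hat U_j\times\{0\}$, such that near $\hat U_{kj}\times\{0\}$ $$F_k^{-1}\Phi_{kj}F_j(h,v)=\bigl(\varphi_{kj}(h)+O(|v|^2),\ t_{kj}(h)v\bigr).$$ It is *formally vertically linearizable by a formal mapping tangent to the identity and preserving the splitting* if there are formal power series $F_j(h,v)=(h,v)+\sum_{|Q|\ge2}F_{j,Q}(h)v^Q$ with $F_{j,Q}$ holomorphic on $\hat U_j$ satisfying these identities as formal power series in $v$, whose coefficients are holomorphic functions of $h\in\hat U_{kj}$. **Theorem.** In this setting, assume that 1. there are constants $L_0,L>0$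 with $\eta_m\le L_0L^m$ for all $m\ge1$; 2. $H^0(C,N_C\otimes S^\ell N_C^*)=0$ for all $\ell>1$; 3. either $H^1(\mathcal U^{r^*},N_C\otimes S^\ell N_C^*)=0$ for all $\ell>1$, or a neighborhood of $C$ is formally vertically linearizable by a formal mapping that is tangent to the identity and preserves the splitting. Then a neighborhood of $C$ is holomorphically vertically linearizable. -/

import Mathlib

open scoped ContDiff Manifold ENNReal Topology

noncomputable section

namespace VertLin

/-- The model space `ℂⁿ × ℂᵈ`, with coordinates `(z, w)`: `z` is horizontal (along `C`) and `w` is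
vertical (normal to `C`). The norm of `Fin n → ℂ` is the maximum norm, so its balls are polydiscs. -/
abbrev Model (n d : ℕ) : Type := (Fin n → ℂ) × (Fin d → ℂ)

/-- A finite family of holomorphic charts `Φ_j = (z_j, w_j)` of the complex manifold `M` in which `C`
is the submanifold `w_j = 0`, each of whose images contains the closed polydisc
`{|z| ≤ r^*} × {0}`, and such that the open polydiscs of radius `r_* < r^*` in `C` cover `C`. -/
structure AdaptedAtlas (n d : ℕ) (M : Type*) [TopologicalSpace M] [ChartedSpace (Model n d) M]
    [IsManifold 𝓘(ℂ, Model n d) ω M] (C : Set M) (ι : Type*) where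
  /-- the charts `Φ_j` -/
  chart : ι → OpenPartialHomeomorph M (Model n d)
  chart_mem : ∀ j, chart j ∈ IsManifold.maximalAtlas 𝓘(ℂ, Model n d) ω M
  mem_iff : ∀ j, ∀ q ∈ (chart j).source, (q ∈ C ↔ (chart j q).2 = 0)
  /-- the inner radius `r_*` -/
  rIn : ℝ
  /-- the outer radius `r^*` -/
  rOut : ℝ
  rIn_pos : 0 < rIn
  rIn_lt : rIn < rOut
  polydisc_subset : ∀ j, Metric.closedBall (0 : Fin n → ℂ) rOut ×ˢ {(0 : Fin d → ℂ)} ⊆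
    (chart j).target
  covers : ∀ p ∈ C, ∃ j, p ∈ (chart j).source ∧ (chart j p).1 ∈ Metric.ball (0 : Fin n → ℂ) rIn

/-- Vector valued polynomials in `v = (v_1, …, v_d)`: the fibre of `N_C ⊗ S^m N_C^*` in the frames of a
chart consists of those that are homogeneous of degree `m`, the polynomial
`∑ a_{λ,Q} v^Q e_λ` standing for `∑ a_{λ,Q} e_λ ⊗ (w^*)^Q`. -/
abbrev Poly (d : ℕ) : Type := Fin d → MvPolynomial (Fin d) ℂ

/-- The linear substitution `v ↦ P (T v)` in a polynomial. -/
def subst {d : ℕ} (T : Matrix (Fin d) (Fin d) ℂ) (P : MvPolynomial (Fin d) ℂ) :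
    MvPolynomial (Fin d) ℂ :=
  MvPolynomial.bind₁ (fun i => ∑ l, MvPolynomial.C (T i l) * MvPolynomial.X l) P

/-- The action `P ↦ T P` of a matrix on the values of a vector valued polynomial. -/
def act {d : ℕ} (T : Matrix (Fin d) (Fin d) ℂ) (P : Poly d) : Poly d :=
  fun l => ∑ μ, MvPolynomial.C (T l μ) * P μ

/-- The square of the modified Fischer norm of a polynomial,
`∑_Q (Q! / |Q|!) |a_Q|²`. -/
def fischerSq {d : ℕ} (P : MvPolynomial (Fin d) ℂ) : ℝ :=
  ∑ Q ∈ P.support, ((∏ i, (Q i).factorial : ℕ) : ℝ) / ((∑ i, Q i).factorial : ℝ) *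
    ‖MvPolynomial.coeff Q P‖ ^ 2

/-- The square of the modified Fischer norm of a vector valued polynomial. -/
def fischerSqVec {d : ℕ} (P : Poly d) : ℝ := ∑ l, fischerSq (P l)

/-- The truncation at degree `N` in `w` of a formal power series
`∑_{|Q| ≥ 2} f_Q(z) w^Q` whose coefficients are functions of `z`. -/
def truncSeries {n d : ℕ} {X : Type*} [AddCommGroup X] [Module ℂ X]
    (f : (Fin d → ℕ) → (Fin n → ℂ) → X) (N : ℕ) (x : Model n d) : X :=
  ∑ m ∈ Finset.Icc 2 N, ∑ Q ∈ Finset.piAntidiag (Finset.univ : Finset (Fin d)) m,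
    (∏ i, x.2 i ^ Q i) • f Q x.1

/-- The sequence `η_m` built from a sequence `K_m`: `η_1 = 1` (and `η_0 = 1`), and for `m ≥ 2`
`η_m = K_m · max η_{m_1} ⋯ η_{m_p}` over all `p`, `1 ≤ m_i < m` and `s ≥ 0` with
`m_1 + ⋯ + m_p + s = m`. -/
def eta (K : ℕ → ℝ≥0∞) (m : ℕ) : ℝ≥0∞ :=
  if m ≤ 1 then 1
  else K m * ⨆ (p : ℕ) (s : ℕ) (c : Fin p → {i : ℕ // 1 ≤ i ∧ i < m})
    (_ : (∑ i, (c i : ℕ)) + s = m), ∏ i, eta K (c i)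
termination_by m
decreasing_by exact (c _).2.2

namespace AdaptedAtlas

variable {n d : ℕ} {M : Type*} [TopologicalSpace M] [ChartedSpace (Model n d) M]
  [IsManifold 𝓘(ℂ, Model n d) ω M] {C : Set M} {ι : Type*} (A : AdaptedAtlas n d M C ι)

/-- The set `U_j^r`, the polydisc of radius `r` of the chart `Φ_j` in `C`. -/
def U (r : ℝ) (j : ι) : Set M :=
  {p | p ∈ (A.chart j).source ∧ p ∈ C ∧ (A.chart j p).1 ∈ Metric.ball (0 : Fin n → ℂ) r}

/-- The point of `C` with coordinate `z` in the chart `Φ_j`. -/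
def pt (j : ι) (z : Fin n → ℂ) : M := (A.chart j).symm (z, 0)

/-- `Û_{kj}^r = φ_j (U_k^r ∩ U_j^r)`, where `φ_j` is the chart `z_j` of `C`. -/
def dom (r : ℝ) (k j : ι) : Set (Fin n → ℂ) :=
  {z | z ∈ Metric.ball (0 : Fin n → ℂ) r ∧ A.pt j z ∈ A.U r k}

/-- `φ_k (U_i^r ∩ U_j^r ∩ U_k^r)`. -/
def dom₃ (r : ℝ) (i j k : ι) : Set (Fin n → ℂ) := A.dom r i k ∩ A.dom r j k

/-- The transition function `Φ_{kj} = Φ_k ∘ Φ_j⁻¹` of `M`. -/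
def Trans (k j : ι) (x : Model n d) : Model n d := A.chart k ((A.chart j).symm x)

/-- The transition function `φ_{kj}` of `C`. -/
def transC (k j : ι) (z : Fin n → ℂ) : Fin n → ℂ := (A.Trans k j (z, 0)).1

/-- The transition matrix `t_{kj} = ∂w_k/∂w_j` of the normal bundle `N_C`, at the point of `C` with
coordinate `z` in the chart `Φ_j`. -/
def t (k j : ι) (z : Fin n → ℂ) : Matrix (Fin d) (Fin d) ℂ :=
  LinearMap.toMatrix' (fderiv ℂ (fun w : Fin d → ℂ => (A.Trans k j (z, w)).2) 0).toLinearMap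

/-- The charts split `TM` along `C`: on `C` one has `∂z_k/∂w_j = 0`, so that the vector fields
`∂/∂w_j` span a holomorphic complement of `TC` in `TM|_C`. -/
def IsSplit : Prop :=
  ∀ k j, ∀ z ∈ A.dom A.rOut k j, fderiv ℂ (fun w : Fin d → ℂ => (A.Trans k j (z, w)).1) 0 = 0

/-- The transition matrices of the normal bundle are unitary. -/
def IsUnitary : Prop :=
  ∀ k j, ∀ z ∈ A.dom A.rOut k j, A.t k j z ∈ Matrix.unitaryGroup (Fin d) ℂ

/-! ### Čech cochains with values in `N_C ⊗ S^m N_C^*` -/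

/-- `u` is a holomorphic `0`-cochain of the covering `{U_j^r}` with values in `N_C ⊗ S^m N_C^*`,
written in the frames `e_j ⊗ (w_j^*)^Q`. -/
def IsCochain₀ (m : ℕ) (r : ℝ) (u : ι → (Fin n → ℂ) → Poly d) : Prop :=
  ∀ j l, (∀ z ∈ Metric.ball (0 : Fin n → ℂ) r, (u j z l).IsHomogeneous m) ∧
    ∀ Q, DifferentiableOn ℂ (fun z => MvPolynomial.coeff Q (u j z l)) (Metric.ball 0 r)

/-- `f` is a holomorphic `1`-cochain of the covering `{U_j^r}` with values in `N_C ⊗ S^m N_C^*`;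
`f k j` is written in the frame `e_k ⊗ (w_j^*)^Q` and in the coordinate `z_j`. -/
def IsCochain₁ (m : ℕ) (r : ℝ) (f : ι → ι → (Fin n → ℂ) → Poly d) : Prop :=
  ∀ k j l, (∀ z ∈ A.dom r k j, (f k j z l).IsHomogeneous m) ∧
    ∀ Q, DifferentiableOn ℂ (fun z => MvPolynomial.coeff Q (f k j z l)) (A.dom r k j)

/-- The coboundary of a `0`-cochain,
`(δu)_{kj}(z, v) = t_{kj}(z) u_j(z, v) - u_k(φ_{kj}(z), t_{kj}(z) v)`. -/
def delta (u : ι → (Fin n → ℂ) → Poly d) (k j : ι) (z : Fin n → ℂ) : Poly d :=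
  act (A.t k j z) (u j z) - fun l => subst (A.t k j z) (u k (A.transC k j z) l)

/-- The cocycle condition for a `1`-cochain of the covering `{U_j^r}`:
`f_{ij}(φ_{jk}(z), t_{jk}(z) v) - f_{ik}(z, v) + t_{ij}(φ_{jk}(z)) f_{jk}(z, v) = 0`. -/
def IsCocycle (r : ℝ) (f : ι → ι → (Fin n → ℂ) → Poly d) : Prop :=
  ∀ i j k, ∀ z ∈ A.dom₃ r i j k,
    (fun l => subst (A.t j k z) (f i j (A.transC j k z) l)) - f i k z +
      act (A.t i j (A.transC j k z)) (f j k z) = 0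

/-- `H^0(C, N_C ⊗ S^m N_C^*) = 0`. -/
def H0Vanishes (m : ℕ) : Prop :=
  ∀ u : ι → (Fin n → ℂ) → Poly d, IsCochain₀ m A.rOut u →
    (∀ k j, ∀ z ∈ A.dom A.rOut k j, A.delta u k j z = 0) →
    ∀ j, ∀ z ∈ Metric.ball (0 : Fin n → ℂ) A.rOut, u j z = 0

/-- `H^1(𝒰, N_C ⊗ S^m N_C^*) = 0` for the covering `𝒰 = {U_j^{r^*}}`. -/
def H1Vanishes (m : ℕ) : Prop :=
  ∀ f : ι → ι → (Fin n → ℂ) → Poly d, A.IsCochain₁ m A.rOut f → A.IsCocycle A.rOut f →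
    ∃ u : ι → (Fin n → ℂ) → Poly d, IsCochain₀ m A.rOut u ∧
      ∀ k j, ∀ z ∈ A.dom A.rOut k j, A.delta u k j z = f k j z

/-! ### The generalized small divisors -/

/-- The `L²` norm of a `0`-cochain of `{U_j^r}`: the maximum over `j` of the `L²` norms over
`φ_j(U_j^r)`, the fibres carrying the modified Fischer norm. -/
def norm₀ (r : ℝ) (u : ι → (Fin n → ℂ) → Poly d) : ℝ≥0∞ :=
  ⨆ j, (∫⁻ z in Metric.ball (0 : Fin n → ℂ) r, ENNReal.ofReal (fischerSqVec (u j z))) ^ (1 / 2 : ℝ)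

/-- The `L²` norm of a `1`-cochain of `{U_j^r}`: the maximum over `k, j` of the `L²` norms over
`φ_j(U_k^r ∩ U_j^r)`, the fibres carrying the modified Fischer norm. -/
def norm₁ (r : ℝ) (f : ι → ι → (Fin n → ℂ) → Poly d) : ℝ≥0∞ :=
  ⨆ (k) (j), (∫⁻ z in A.dom r k j, ENNReal.ofReal (fischerSqVec (f k j z))) ^ (1 / 2 : ℝ)

/-- `K_*(N_C ⊗ S^m N_C^*)`: the supremum, over the holomorphic `0`-cochains `u₁` of `{U_j^{r^*}}` with
`‖δu₁‖ = 1`, of the infimum of `‖u₀‖` over the holomorphic `0`-cochains `u₀` of `{U_j^{r_*}}` with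
`δu₀ = δu₁` on `{U_j^{r_*}}`. -/
def KStar (m : ℕ) : ℝ≥0∞ :=
  ⨆ (u₁ : ι → (Fin n → ℂ) → Poly d) (_ : IsCochain₀ m A.rOut u₁)
    (_ : A.norm₁ A.rOut (A.delta u₁) = 1),
    ⨅ (u₀ : ι → (Fin n → ℂ) → Poly d) (_ : IsCochain₀ m A.rIn u₀)
      (_ : ∀ k j, ∀ z ∈ A.dom A.rIn k j, A.delta u₀ k j z = A.delta u₁ k j z),
      norm₀ A.rIn u₀

/-- The supremum over `{U_k^{r^*} ∩ U_j^{r^*}}` of the operator norms (for the Hermitian norm of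
`ℂᵈ`) of the transition matrices of `N_C`. -/
def normT : ℝ≥0∞ :=
  ⨆ (k) (j) (z ∈ A.dom A.rOut k j), ‖Matrix.toEuclideanCLM (n := Fin d) (𝕜 := ℂ) (A.t k j z)‖ₑ

/-- The supremum over `{U_k^{r^*} ∩ U_j^{r^*}}` of the operator norms (for the modified Fischer norm)
of the transition maps `P ↦ P ∘ t_{kj}` of `S^m N_C^*`. -/
def normSymT (m : ℕ) : ℝ≥0∞ :=
  ⨆ (k) (j) (z ∈ A.dom A.rOut k j) (P : MvPolynomial (Fin d) ℂ) (_ : P.IsHomogeneous m)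
    (_ : fischerSq P ≤ 1), ENNReal.ofReal (Real.sqrt (fischerSq (subst (A.t k j z) P)))

/-- The generalized small divisor
`K(N_C ⊗ S^m N_C^*) = |{t_{kj}}| + K_*(N_C ⊗ S^m N_C^*) |{t_{kj}}| |{t_{kj}(S^m N_C^*)}|`. -/
def K (m : ℕ) : ℝ≥0∞ := A.normT + A.KStar m * A.normT * A.normSymT m

/-! ### Vertical linearization -/

/-- A neighborhood of `C` is formally vertically linearizable by a formal mapping that is tangent to
the identity and preserves the splitting: there are formal maps
`F_j(h, v) = (h, v) + ∑_{|Q| ≥ 2} f_{j,Q}(h) v^Q` with `f_{j,Q}` holomorphic on `φ_j(U_j)` such that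
`F_k⁻¹ Φ_{kj} F_j = (φ_{kj}(h) + ∑_{|Q| ≥ 2} g_{kj,Q}(h) v^Q, t_{kj}(h) v)` as formal power series in
`v`, that is, `F_k(φ_{kj} + g_{kj}, t_{kj} v)` and `Φ_{kj} F_j` agree up to order `N` in `v`, for
every `N`. -/
def FormallyVerticallyLinearizable : Prop :=
  ∃ (f : ι → (Fin d → ℕ) → (Fin n → ℂ) → Model n d)
    (g : ι → ι → (Fin d → ℕ) → (Fin n → ℂ) → (Fin n → ℂ)),
    (∀ j Q, DifferentiableOn ℂ (f j Q) (Metric.ball 0 A.rOut)) ∧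
    (∀ k j Q, DifferentiableOn ℂ (g k j Q) (A.dom A.rOut k j)) ∧
    ∀ k j, ∀ z ∈ A.dom A.rOut k j, ∀ N : ℕ,
      (fun v : Fin d → ℂ =>
        (fun x : Model n d => x + truncSeries (f k) N x)
          (A.transC k j z + truncSeries (g k j) N (z, v), (A.t k j z).mulVec v) -
        A.Trans k j ((z, v) + truncSeries (f j) N (z, v)))
      =O[𝓝 0] fun v => ‖v‖ ^ (N + 1)

/-- A neighborhood of `C` is holomorphically vertically linearizable: there are maps `F_j`,
holomorphic near `φ_j(U_j) × {0}`, with `F_j(h, v) = (h, v) + O(|v|²)`, such that, near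
`φ_j(U_k ∩ U_j) × {0}`,
`F_k⁻¹ Φ_{kj} F_j = (H_{kj}(h, v), t_{kj}(h) v)` with `H_{kj}(h, v) = φ_{kj}(h) + O(|v|²)`
holomorphic. -/
def HolomorphicallyVerticallyLinearizable : Prop :=
  ∃ (F : ι → Model n d → Model n d) (H : ι → ι → Model n d → (Fin n → ℂ)),
    (∀ j, AnalyticOnNhd ℂ (F j) (Metric.ball 0 A.rOut ×ˢ {0})) ∧
    (∀ j, ∀ z ∈ Metric.ball (0 : Fin n → ℂ) A.rOut, F j (z, 0) = (z, 0) ∧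
      fderiv ℂ (F j) (z, 0) = ContinuousLinearMap.id ℂ (Model n d)) ∧
    (∀ k j, AnalyticOnNhd ℂ (H k j) (A.dom A.rOut k j ×ˢ {0})) ∧
    (∀ k j, ∀ z ∈ A.dom A.rOut k j, H k j (z, 0) = A.transC k j z ∧
      fderiv ℂ (fun v : Fin d → ℂ => H k j (z, v)) 0 = 0) ∧
    ∀ k j, ∀ᶠ x in 𝓝ˢ (A.dom A.rOut k j ×ˢ {(0 : Fin d → ℂ)}),
      A.Trans k j (F j x) = F k (H k j x, (A.t k j x.1).mulVec x.2)

end AdaptedAtlas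

end VertLin

end

/-! ### Holomorphic maps in several variables: Cauchy estimates, Taylor series, Osgood's lemma. -/

noncomputable section

namespace VertLin

open Metric Filter Asymptotics

section Osgood

variable {E F : Type*} [NormedAddCommGroup E] [NormedSpace ℂ E] [NormedAddCommGroup F]
  [NormedSpace ℂ F]

/-! It is enough to look for maps `F_j(h, v) = (h, v + ∑_{q ≥ 2} f_{j,q}(h, v))` that leave the
horizontal coordinate alone. The horizontal component of `Φ_{kj} F_j` is then taken as `H_{kj}`, and
one equation in the normal direction remains; its defect, with the sums cut at degree `N`, is `rem`.
The charts respect the splitting, and unitary holomorphic matrices are locally constant by the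
maximum principle (`eventually_t_eq`), so adding a term of degree `N + 1` changes the defect, to
leading order, by the coboundary of that term (`isLittleO_rem_succ`). At each order the equation is
therefore `δu = obstr`.

Solvability. The identity `Φ_{ij} Φ_{jk} = Φ_{ik}` makes the obstruction a cocycle
(`isCocycle_obstr`), which settles the case `H¹ = 0`. A formal linearization, which may also move
`h`, is compared with the partial solution: the leading term of the discrepancy in degrees up to `N`
is a global section, killed by `H⁰ = 0`, and in degree `N + 1` its coboundary is the obstruction
(`exists_delta_eq_obstr_of_formal`).

Convergence. Since `H⁰ = 0`, a coboundary has only one primitive, so `K_*` bounds the primitive at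
hand (`norm₀_le_KStar`). The mean value inequality turns this `L²` bound into a supremum bound, and
since the smaller polydiscs already cover `C`, the bound returns to the full polydiscs through the
unitary transition maps (`exists_small_divisor_bound`). No domain is lost from one degree to the
next.

Comparing Taylor coefficients expresses `δf_{N+1}` through compositions of the terms of lower degree
(`fnorm_delta_le`). The modified Fischer norm is the norm of symmetric tensors, hence
submultiplicative and not increased by unitary substitutions. Compositions are measured against
weights `w_i = θ_i R^i / (8 (i+1)²)` with `w * w ≤ w` for convolution, where `θ_i` is the supremum
that defines `η`. They gain a factor of order `R⁻²` where `R⁻¹` is needed, and `K_m θ_m = η_m`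
absorbs the small divisor, so the induction closes for large `R` (`exists_geometric_bound`). The
bound on `η` makes the series converge; the limiting defect is holomorphic and flat along `v = 0`,
hence zero (`holomorphicallyVerticallyLinearizable_of_bound`). -/

theorem norm_fderiv_le_of_forall_norm_le {f : E → F} {c : E} {R B : ℝ} (hR : 0 < R)
    (hf : DifferentiableOn ℂ f (ball c R)) (hB : ∀ x ∈ ball c R, ‖f x‖ ≤ B) :
    ‖fderiv ℂ f c‖ ≤ 2 * B / R := by
  refine Complex.norm_fderiv_le_div_of_mapsTo_ball hf (fun x hx => ?_) hR
  rw [mem_closedBall, dist_eq_norm]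
  have h1 := hB x hx
  have h2 := hB c (mem_ball_self hR)
  linarith [norm_sub_le (f x) (f c)]

/-- A locally uniform limit of holomorphic maps between Banach spaces is holomorphic. -/
theorem differentiableAt_of_tendstoUniformlyOn [CompleteSpace F] {f : ℕ → E → F} {g : E → F} {c : E}
    {R : ℝ} (hR : 0 < R) (hf : ∀ i, DifferentiableOn ℂ (f i) (ball c R))
    (h : TendstoUniformlyOn f g atTop (ball c R)) : DifferentiableAt ℂ g c := by
  have hsub : ∀ x ∈ ball c (R / 2), ball x (R / 2) ⊆ ball c R := fun x hx =>
    ball_subset_ball' (by rw [mem_ball] at hx; linarith)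
  -- The Cauchy estimate on balls of half the radius makes the derivatives uniformly Cauchy, so the
  -- limit may be differentiated.
  have hcau : UniformCauchySeqOn (fun i => fderiv ℂ (f i)) atTop (ball c (R / 2)) := by
    rw [Metric.uniformCauchySeqOn_iff]
    intro ε hε
    obtain ⟨N, hN⟩ := Metric.uniformCauchySeqOn_iff.1 h.uniformCauchySeqOn (ε * R / 8) (by positivity)
    refine ⟨N, fun m hm n hn x hx => ?_⟩
    have hdm := fun (y : E) (hy : y ∈ ball x (R / 2)) => (hf m).differentiableAt (isOpen_ball.mem_nhds (hsub x hx hy))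
    have hdn := fun (y : E) (hy : y ∈ ball x (R / 2)) => (hf n).differentiableAt (isOpen_ball.mem_nhds (hsub x hx hy))
    have hx0 : x ∈ ball x (R / 2) := mem_ball_self (by positivity)
    rw [dist_eq_norm]
    have e : fderiv ℂ (f m) x - fderiv ℂ (f n) x = fderiv ℂ (fun y => f m y - f n y) x :=
      (fderiv_fun_sub (hdm x hx0) (hdn x hx0)).symm
    have := norm_fderiv_le_of_forall_norm_le (f := fun y => f m y - f n y) (c := x) (R := R / 2)
      (B := ε * R / 8) (by positivity)
      (fun y hy => ((hdm y hy).sub (hdn y hy)).differentiableWithinAt)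
      (fun y hy => by
        have := hN m hm n hn y (hsub x hx hy)
        rw [dist_eq_norm] at this
        exact this.le)
    rw [e]
    calc _ ≤ _ := this
      _ = ε / 2 := by field_simp; ring
      _ < ε := by linarith
  have hlim : ∀ x ∈ ball c (R / 2), ∃ L, Tendsto (fun i => fderiv ℂ (f i) x) atTop (𝓝 L) :=
    fun x hx => cauchySeq_tendsto_of_complete (hcau.cauchySeq hx)
  choose! g' hg' using hlim
  have hu := hcau.tendstoUniformlyOn_of_tendsto hg'
  have hc : c ∈ ball c (R / 2) := mem_ball_self (by positivity)
  exact (hasFDerivAt_of_tendstoUniformlyOn isOpen_ball hu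
    (fun i x hx => ((hf i).differentiableAt (isOpen_ball.mem_nhds
      (ball_subset_ball (by linarith) hx))).hasFDerivAt)
    (fun x hx => h.tendsto_at (ball_subset_ball (by linarith) hx)) hc).differentiableAt

/-- Schwarz's lemma of order two for `f` minus its linear part at `x`, which stays within `B + 2B +
B` of `f x`. -/
theorem norm_sub_sub_fderiv_le {f : E → F} {x v : E} {R B : ℝ} (hR : 0 < R)
    (hf : DifferentiableOn ℂ f (ball x R)) (hB : ∀ y ∈ ball x R, ‖f y‖ ≤ B) (hv : ‖v‖ < R) :
    ‖f (x + v) - f x - fderiv ℂ f x v‖ ≤ 4 * B * (‖v‖ / R) ^ 2 := by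
  have hx := mem_ball_self (x := x) hR
  have hdx := hf.differentiableAt (isOpen_ball.mem_nhds hx)
  have hB0 : 0 ≤ B := (norm_nonneg _).trans (hB x hx)
  set g : E → F := fun y => f y - fderiv ℂ f x (y - x) with hg
  have hgx : g x = f x := by simp [hg]
  have hfd := norm_fderiv_le_of_forall_norm_le hR hf hB
  have := Complex.dist_le_mul_div_pow_of_mapsTo_ball_of_isLittleO (f := g) (c := x) (z := x + v)
    (R₁ := R) (R₂ := 4 * B) (n := 1) (by fun_prop) (fun y hy => ?_) ?_ (by simpa using hv)
  · rw [dist_eq_norm, hgx] at this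
    simp only [hg, add_sub_cancel_left, dist_self_add_left] at this
    rwa [sub_right_comm] at this
  · rw [mem_closedBall, dist_eq_norm, hgx]
    have h1 : ‖fderiv ℂ f x (y - x)‖ ≤ 2 * B := by
      refine (ContinuousLinearMap.le_opNorm _ _).trans ?_
      rw [mem_ball, dist_eq_norm] at hy
      calc _ ≤ 2 * B / R * R := by gcongr
        _ = 2 * B := by field_simp
    calc ‖f y - fderiv ℂ f x (y - x) - f x‖ ≤ ‖f y‖ + ‖fderiv ℂ f x (y - x)‖ + ‖f x‖ :=
          (norm_sub_le _ _).trans (by gcongr; exact norm_sub_le _ _)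
      _ ≤ B + 2 * B + B := by gcongr; exacts [hB y hy, hB x hx]
      _ = 4 * B := by ring
  · have := hdx.hasFDerivAt.isLittleO
    simp only [hgx, pow_one]
    refine (this.congr_left fun y => ?_).norm_right
    simp only [hg, sub_right_comm]

/-- Directional derivatives of holomorphic maps between Banach spaces are holomorphic. -/
theorem differentiableOn_fderiv_apply [CompleteSpace F] {f : E → F} {U : Set E} (hU : IsOpen U)
    (hf : DifferentiableOn ℂ f U) (v : E) :
    DifferentiableOn ℂ (fun x => fderiv ℂ f x v) U := by
  intro c hc
  refine DifferentiableAt.differentiableWithinAt ?_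
  rcases eq_or_ne v 0 with rfl | hv
  · simp
  have hv' : 0 < ‖v‖ := norm_pos_iff.2 hv
  have hcont := (hf.differentiableAt (hU.mem_nhds hc)).continuousAt
  have hev : ∀ᶠ x in 𝓝 c, x ∈ U ∧ ‖f x‖ ≤ ‖f c‖ + 1 :=
    (Filter.eventually_of_mem (hU.mem_nhds hc) fun _ h => h).and ((hcont.norm.eventually (gt_mem_nhds (lt_add_one _))).mono fun _ h => h.le)
  obtain ⟨R, hR, hball⟩ := Metric.eventually_nhds_iff_ball.1 hev
  set B := ‖f c‖ + 1
  -- Increments tending to zero, scaled so that `‖h i • v‖ ≤ R / 4`. The difference quotients are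
  -- then defined on the ball of radius `R / 2` and converge uniformly there by the quadratic
  -- remainder bound.
  set h : ℕ → ℂ := fun i => ((R / 4 / ‖v‖ / (i + 1) : ℝ) : ℂ) with hh
  have hpos : ∀ i : ℕ, 0 < R / 4 / ‖v‖ / (i + 1) := fun i => by positivity
  have hnorm : ∀ i, ‖h i‖ = R / 4 / ‖v‖ / (i + 1) := fun i => by
    simp only [hh, Complex.norm_real, Real.norm_eq_abs, abs_of_pos (hpos i)]
  have hhv : ∀ i, ‖h i • v‖ = R / 4 / (i + 1) := fun i => by
    rw [norm_smul, hnorm]; field_simp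
  have hle : ∀ i : ℕ, R / 4 / (i + 1 : ℝ) ≤ R / 4 := fun i =>
    div_le_self (by positivity) (by linarith [(Nat.cast_nonneg i : (0:ℝ) ≤ i)])
  refine differentiableAt_of_tendstoUniformlyOn (R := R / 2)
    (f := fun i x => (h i)⁻¹ • (f (x + h i • v) - f x)) (by positivity) (fun i x hx => ?_) ?_
  · refine DifferentiableAt.differentiableWithinAt ?_
    rw [mem_ball] at hx
    have h1 : DifferentiableAt ℂ f (x + h i • v) := hf.differentiableAt (hU.mem_nhds (hball _ (by
      rw [mem_ball]
      calc dist (x + h i • v) c ≤ dist (x + h i • v) x + dist x c := dist_triangle _ _ _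
        _ < R := by rw [dist_self_add_left, hhv]; linarith [hle i])).1)
    have h2 : DifferentiableAt ℂ f x := hf.differentiableAt (hU.mem_nhds (hball _ (by
      rw [mem_ball]; linarith)).1)
    have h3 : DifferentiableAt ℂ (fun x => f (x + h i • v)) x :=
      DifferentiableAt.comp (f := fun x => x + h i • v) x h1 (by fun_prop)
    exact (h3.sub h2).const_smul _
  · rw [Metric.tendstoUniformlyOn_iff]
    intro ε hε
    have hB : 0 < B := by positivity
    have htend : Tendsto (fun i : ℕ => B * (4 * ‖v‖ / R) * (1 / ((i : ℝ) + 1))) atTop (𝓝 0) := by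
      simpa using tendsto_one_div_add_atTop_nhds_zero_nat.const_mul (B * (4 * ‖v‖ / R))
    filter_upwards [htend.eventually (gt_mem_nhds hε)] with i hi x hx
    have hsub : ball x (R / 2) ⊆ ball c R := ball_subset_ball' (by rw [mem_ball] at hx; linarith)
    have key := norm_sub_sub_fderiv_le (f := f) (x := x) (v := h i • v) (R := R / 2) (B := B)
      (by positivity)
      (fun y hy => (hf.differentiableAt (hU.mem_nhds (hball _ (hsub hy)).1)).differentiableWithinAt)
      (fun y hy => (hball _ (hsub hy)).2) (by rw [hhv]; linarith [hle i])
    have hne : h i ≠ 0 := norm_pos_iff.1 (by rw [hnorm]; exact hpos i)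
    rw [dist_comm, dist_eq_norm]
    have e : (h i)⁻¹ • (f (x + h i • v) - f x) - fderiv ℂ f x v
        = (h i)⁻¹ • (f (x + h i • v) - f x - fderiv ℂ f x (h i • v)) := by
      rw [map_smul, smul_sub (h i)⁻¹ (f (x + h i • v) - f x), smul_smul, inv_mul_cancel₀ hne, one_smul]
    rw [e, norm_smul, norm_inv, hnorm]
    refine lt_of_le_of_lt (mul_le_mul_of_nonneg_left key (by positivity)) ?_
    rw [hhv]
    refine lt_of_eq_of_lt ?_ hi
    field_simp
    ring

/-- On a finite dimensional space the regularity of the derivative can be tested on fixed vectors,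
so the induction only needs directional derivatives to be holomorphic. -/
theorem contDiffOn_of_differentiableOn_complex [FiniteDimensional ℂ E] [CompleteSpace F] {U : Set E}
    (hU : IsOpen U) (k : ℕ) : ∀ {f : E → F}, DifferentiableOn ℂ f U → ContDiffOn ℂ k f U := by
  induction k with
  | zero => exact fun hf => contDiffOn_zero.2 hf.continuousOn
  | succ k ih =>
    intro f hf
    push_cast
    refine (contDiffOn_succ_iff_fderiv_of_isOpen hU).2 ⟨hf, by simp, ?_⟩
    exact contDiffOn_clm_apply.2 fun v => ih (differentiableOn_fderiv_apply hU hf v)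

/-- Each differentiation costs a width `s` of the ball and, by the Cauchy estimate, a factor `2 /
s`. -/
theorem norm_iteratedFDeriv_le_of_forall_norm_le [FiniteDimensional ℂ E] [CompleteSpace F] {f : E → F}
    {c : E} {R B s : ℝ} (hs : 0 < s) (hf : DifferentiableOn ℂ f (ball c R))
    (hB : ∀ x ∈ ball c R, ‖f x‖ ≤ B) (k : ℕ) :
    ∀ x ∈ ball c (R - k * s), ‖iteratedFDeriv ℂ k f x‖ ≤ B * (2 / s) ^ k := by
  induction k with
  | zero => simpa using hB
  | succ k ih =>
    intro x hx
    rw [← norm_fderiv_iteratedFDeriv]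
    have hsub : ball x s ⊆ ball c (R - k * s) := ball_subset_ball' (by
      rw [mem_ball] at hx; push_cast at hx; linarith)
    have hk : 0 ≤ k * s := by positivity
    refine (norm_fderiv_le_of_forall_norm_le hs (fun y hy => ?_)
      (fun y hy => ih y (hsub hy))).trans (le_of_eq (by ring))
    have hy' : y ∈ ball c R := ball_subset_ball (by linarith) (hsub hy)
    have := ((contDiffOn_of_differentiableOn_complex isOpen_ball (k + 1) hf).contDiffAt
      (isOpen_ball.mem_nhds hy'))
    exact (this.differentiableAt_iteratedFDeriv (by exact_mod_cast Nat.lt_succ_self k)).differentiableWithinAt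

/-- The Taylor coefficients of a holomorphic map satisfy Cauchy type estimates. -/
theorem norm_taylor_le [FiniteDimensional ℂ E] [CompleteSpace F] {f : E → F}
    {c : E} {R B : ℝ} (hR : 0 < R) (hf : DifferentiableOn ℂ f (ball c R))
    (hB : ∀ x ∈ ball c R, ‖f x‖ ≤ B) (k : ℕ) :
    ‖((k.factorial : ℂ)⁻¹) • iteratedFDeriv ℂ k f c‖ ≤ 3 * B * (12 / R) ^ k := by
  have hB0 : 0 ≤ B := (norm_nonneg _).trans (hB c (mem_ball_self hR))
  -- With this width, `k` differentiations use less than half of the radius; the resulting factor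
  -- `(k + 1) ^ k` is compensated by `k!` up to `3 ^ (k + 1)`.
  have hs : 0 < R / (2 * (k + 1)) := by positivity
  have hc : c ∈ ball c (R - k * (R / (2 * (k + 1)))) := by
    apply mem_ball_self
    have : k * (R / (2 * (k + 1))) = R / 2 * (k / (k + 1)) := by field_simp
    have h2 : (k : ℝ) / (k + 1) ≤ 1 := by rw [div_le_one (by positivity)]; linarith
    rw [this]; nlinarith
  have h := norm_iteratedFDeriv_le_of_forall_norm_le hs hf hB k c hc
  rw [norm_smul, norm_inv, Complex.norm_natCast]
  have hk : ((k : ℝ) + 1) ^ k / k.factorial ≤ 3 * 3 ^ k := by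
    have h1 := Real.pow_div_factorial_le_exp (k + 1) (by positivity) (k + 1)
    have h2 : ((k : ℝ) + 1) ^ (k + 1) / ((k + 1).factorial : ℝ) = ((k : ℝ) + 1) ^ k / k.factorial := by
      rw [Nat.factorial_succ, pow_succ]; push_cast; field_simp
    have h3 : Real.exp (k + 1) = Real.exp 1 ^ (k + 1) := by
      rw [← Real.exp_nat_mul]; push_cast; rw [mul_one]
    rw [h2, h3] at h1
    calc _ ≤ _ := h1
      _ ≤ (3 : ℝ) ^ (k + 1) := by gcongr; exact Real.exp_one_lt_three.le
      _ = 3 * 3 ^ k := by ring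
  calc (k.factorial : ℝ)⁻¹ * ‖iteratedFDeriv ℂ k f c‖
      ≤ (k.factorial : ℝ)⁻¹ * (B * (2 / (R / (2 * (k + 1)))) ^ k) := by gcongr
    _ = B * (4 / R) ^ k * (((k : ℝ) + 1) ^ k / k.factorial) := by
        have : 2 / (R / (2 * ((k : ℝ) + 1))) = 4 / R * (k + 1) := by field_simp; ring
        rw [this, mul_pow]; ring
    _ ≤ B * (4 / R) ^ k * (3 * 3 ^ k) := by gcongr
    _ = 3 * B * (12 / R) ^ k := by
        rw [show (12 : ℝ) / R = 4 / R * 3 by ring, mul_pow]; ring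

theorem iteratedDeriv_comp_line [FiniteDimensional ℂ E] [CompleteSpace F] {f : E → F} {c y : E}
    {U : Set E} (hU : IsOpen U) (hf : DifferentiableOn ℂ f U) (k : ℕ) :
    ∀ ζ : ℂ, c + ζ • y ∈ U →
      iteratedDeriv k (fun ζ : ℂ => f (c + ζ • y)) ζ = iteratedFDeriv ℂ k f (c + ζ • y) fun _ => y := by
  induction k with
  | zero => simp
  | succ k ih =>
    intro ζ hζ
    rw [iteratedDeriv_succ]
    have hev : ∀ᶠ ξ : ℂ in 𝓝 ζ, c + ξ • y ∈ U :=
      (by fun_prop : Continuous fun ξ : ℂ => c + ξ • y).continuousAt.eventually_mem (hU.mem_nhds hζ)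
    have heq : iteratedDeriv k (fun ζ : ℂ => f (c + ζ • y)) =ᶠ[𝓝 ζ]
        fun ξ => iteratedFDeriv ℂ k f (c + ξ • y) fun _ => y := hev.mono fun ξ hξ => ih ξ hξ
    rw [heq.deriv_eq]
    have hd : DifferentiableAt ℂ (iteratedFDeriv ℂ k f) (c + ζ • y) :=
      ((contDiffOn_of_differentiableOn_complex hU (k + 1) hf).contDiffAt
        (hU.mem_nhds hζ)).differentiableAt_iteratedFDeriv (by exact_mod_cast Nat.lt_succ_self k)
    have hl : HasDerivAt (fun ξ : ℂ => c + ξ • y) y ζ := by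
      simpa using ((hasDerivAt_id ζ).smul_const y).const_add c
    have h1 := hd.hasFDerivAt.comp_hasDerivAt ζ hl
    have h2 := (ContinuousMultilinearMap.apply ℂ (fun _ : Fin k => E) F
      (fun _ => y)).hasFDerivAt.comp_hasDerivAt ζ h1
    rw [iteratedFDeriv_succ_apply_left]
    exact h2.deriv

/-- The Taylor series of `f` at `c`. -/
def taylor (f : E → F) (c : E) : FormalMultilinearSeries ℂ E F :=
  fun k => ((k.factorial : ℂ)⁻¹) • iteratedFDeriv ℂ k f c

theorem hasFPowerSeriesOnBall_taylor [FiniteDimensional ℂ E] [CompleteSpace F] {f : E → F}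
    {c : E} {R B : ℝ} (hR : 0 < R) (hf : DifferentiableOn ℂ f (ball c R))
    (hB : ∀ x ∈ ball c R, ‖f x‖ ≤ B) :
    HasFPowerSeriesOnBall f (taylor f c) c (ENNReal.ofReal (R / 12)) where
  r_le := by
    refine FormalMultilinearSeries.le_radius_of_bound _ (3 * B) fun k => ?_
    rw [Real.coe_toNNReal _ (by positivity)]
    calc ‖taylor f c k‖ * (R / 12) ^ k ≤ 3 * B * (12 / R) ^ k * (R / 12) ^ k := by
          gcongr; exact norm_taylor_le hR hf hB k
      _ = 3 * B := by
          rw [mul_assoc, ← mul_pow, div_mul_div_cancel₀ hR.ne', div_self (by norm_num), one_pow, mul_one]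
  r_pos := by simpa using by positivity
  hasSum := by
    intro y hy
    rw [Metric.eball_ofReal, mem_ball_zero_iff] at hy
    -- Summation is reduced to one variable along the line `ζ ↦ c + ζ • y`: for `‖y‖ < R / 12` the
    -- disc of radius 2 is admissible, and the series is evaluated at `ζ = 1`.
    have hmem : ∀ ζ ∈ ball (0 : ℂ) 2, c + ζ • y ∈ ball c R := fun ζ hζ => by
      rw [mem_ball_zero_iff] at hζ
      rw [mem_ball, dist_self_add_left, norm_smul]
      nlinarith [norm_nonneg y, norm_nonneg ζ]
    have hg : DifferentiableOn ℂ (fun ζ : ℂ => f (c + ζ • y)) (ball 0 2) :=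
      hf.comp (by fun_prop) hmem
    have := Complex.hasSum_taylorSeries_on_ball hg (z := 1) (by simp)
    simp only [sub_zero, one_pow, one_smul] at this
    refine this.congr_fun fun k => ?_
    rw [iteratedDeriv_comp_line isOpen_ball hf k 0 (by simpa using hR)]
    simp [taylor]

/-- **Osgood's lemma**: complex differentiable maps on open subsets of `ℂⁿ` are analytic. -/
theorem analyticOnNhd_of_differentiableOn [FiniteDimensional ℂ E] [CompleteSpace F] {f : E → F}
    {U : Set E} (hU : IsOpen U) (hf : DifferentiableOn ℂ f U) : AnalyticOnNhd ℂ f U := by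
  intro c hc
  have hcont := (hf.differentiableAt (hU.mem_nhds hc)).continuousAt
  have hev : ∀ᶠ x in 𝓝 c, x ∈ U ∧ ‖f x‖ ≤ ‖f c‖ + 1 :=
    (Filter.eventually_of_mem (hU.mem_nhds hc) fun _ h => h).and
      ((hcont.norm.eventually (gt_mem_nhds (lt_add_one _))).mono fun _ h => h.le)
  obtain ⟨R, hR, hball⟩ := Metric.eventually_nhds_iff_ball.1 hev
  exact (hasFPowerSeriesOnBall_taylor hR (hf.mono fun x hx => (hball x hx).1)
    fun x hx => (hball x hx).2).analyticAt

end Osgood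

end VertLin

end

/-! ### The modified Fischer norm as the norm of symmetric tensors. -/

noncomputable section

namespace VertLin

open MvPolynomial Finset

section Fischer

variable {d : ℕ}

/-- The space of tensors of degree `m` on `ℂᵈ`, with its Hilbert norm. -/
abbrev Tens (d m : ℕ) : Type := EuclideanSpace ℂ (Fin m → Fin d)

/-- The exponent of the monomial `∏ X_{i_l}`. -/
def expOf {m : ℕ} (i : Fin m → Fin d) : Fin d →₀ ℕ := ∑ l, Finsupp.single (i l) 1

theorem monomial_expOf {R : Type*} [CommSemiring R] {m : ℕ} (i : Fin m → Fin d) (a : R) :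
    monomial (expOf i) a = C a * ∏ l, (X (i l) : MvPolynomial (Fin d) R) := by
  have : (∏ l, (X (i l) : MvPolynomial (Fin d) R)) = monomial (expOf i) 1 := by
    rw [expOf]
    induction (univ : Finset (Fin m)) using Finset.induction_on with
    | empty => simp
    | insert a s ha ih => rw [prod_insert ha, sum_insert ha, ih, X, monomial_mul, one_mul]
  rw [this, C_mul_monomial, mul_one]

theorem degree_expOf {m : ℕ} (i : Fin m → Fin d) : (expOf i).degree = m := by
  simp [expOf, map_sum]

/-- The tensor indices with a given exponent. -/
def fib (m : ℕ) (Q : Fin d →₀ ℕ) : Finset (Fin m → Fin d) := univ.filter fun i => expOf i = Q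

/-- The coefficient of `X^Q` in `(∑ X_i)^m`, computed once by the multinomial theorem and once by
expanding into words. Its inverse is the weight `Q! / |Q|!` of the Fischer norm. -/
theorem card_fib {m : ℕ} {Q : Fin d →₀ ℕ} (hQ : Q.degree = m) :
    ((fib m Q).card : ℝ) = (m.factorial : ℝ) / ((∏ i, (Q i).factorial : ℕ) : ℝ) := by
  have h1 : ((fib m Q).card : ℕ) = Q.multinomial := by
    have h := coeff_sum_X_pow_of_fintype (R := ℕ) Q m
    have hs : (Q.sum fun _ m => m) = m := by rw [← hQ, Finsupp.degree_apply]; rfl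
    rw [if_pos hs, Fintype.sum_pow, coeff_sum] at h
    have e : ∀ i : Fin m → Fin d, coeff Q (∏ l, (X (i l) : MvPolynomial (Fin d) ℕ)) =
        if expOf i = Q then 1 else 0 := fun i => by
      have := monomial_expOf i (1 : ℕ)
      rw [C_1, one_mul] at this
      rw [← this, coeff_monomial]
    simp only [e, sum_boole] at h
    exact_mod_cast h
  rw [h1, Finsupp.multinomial_eq, eq_div_iff (by positivity)]
  have h2 := Nat.multinomial_spec Q.support Q
  have h3 : ∏ i ∈ Q.support, (Q i).factorial = ∏ i, (Q i).factorial :=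
    prod_subset (subset_univ _) fun i _ hi => by simp [Finsupp.notMem_support_iff.1 hi]
  have h4 : ∑ i ∈ Q.support, Q i = m := by rw [← hQ, Finsupp.degree_apply]
  rw [h3, h4] at h2
  rw [← h2]; push_cast; ring

theorem mem_fib {m : ℕ} {Q : Fin d →₀ ℕ} {i : Fin m → Fin d} : i ∈ fib m Q ↔ expOf i = Q := by
  simp [fib]

theorem card_fib_pos {m : ℕ} (i : Fin m → Fin d) : 0 < (fib m (expOf i)).card :=
  card_pos.2 ⟨i, mem_fib.2 rfl⟩

theorem exists_expOf {m : ℕ} {Q : Fin d →₀ ℕ} (hQ : Q.degree = m) : ∃ i : Fin m → Fin d, expOf i = Q := by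
  have h := card_fib hQ
  have hpos : 0 < (fib m Q).card := by
    have : (0:ℝ) < (fib m Q).card := by rw [h]; positivity
    exact_mod_cast this
  obtain ⟨i, hi⟩ := card_pos.1 hpos
  exact ⟨i, mem_fib.1 hi⟩

theorem sum_tens_eq_sum_fib {m : ℕ} {A : Type*} [AddCommMonoid A] (f : (Fin m → Fin d) → A) :
    ∑ i, f i = ∑ Q ∈ univ.image (expOf (m := m) (d := d)), ∑ i ∈ fib m Q, f i := by
  exact (sum_fiberwise_of_maps_to (fun i _ => mem_image_of_mem _ (mem_univ i)) f).symm

/-- The symmetric tensor of the homogeneous component of degree `m` of a polynomial. -/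
def tens (m : ℕ) : MvPolynomial (Fin d) ℂ →ₗ[ℂ] Tens d m where
  toFun P := WithLp.toLp 2 fun i => ((fib m (expOf i)).card : ℂ)⁻¹ * coeff (expOf i) P
  map_add' P Q := by ext i; simp [mul_add]
  map_smul' a P := by ext i; simp; ring

theorem tens_apply (m : ℕ) (P : MvPolynomial (Fin d) ℂ) (i : Fin m → Fin d) :
    tens m P i = ((fib m (expOf i)).card : ℂ)⁻¹ * coeff (expOf i) P := rfl

/-- The homogeneous polynomial `∑ A_i X_{i_1} ⋯ X_{i_m}` of a tensor `A`. -/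
def ofTens (m : ℕ) : Tens d m →ₗ[ℂ] MvPolynomial (Fin d) ℂ where
  toFun A := ∑ i, monomial (expOf i) (A i)
  map_add' A B := by simp [sum_add_distrib]
  map_smul' a A := by simp [smul_sum, smul_monomial]

theorem ofTens_apply (m : ℕ) (A : Tens d m) : ofTens m A = ∑ i, monomial (expOf i) (A i) := rfl

theorem ofTens_eq (m : ℕ) (A : Tens d m) : ofTens m A = ∑ i, C (A i) * ∏ l, X (i l) := by
  simp only [ofTens_apply, monomial_expOf]

theorem isHomogeneous_ofTens (m : ℕ) (A : Tens d m) : (ofTens m A).IsHomogeneous m :=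
  IsHomogeneous.sum _ _ _ fun i _ => isHomogeneous_monomial _ (degree_expOf i)

theorem coeff_ofTens (m : ℕ) (A : Tens d m) (Q : Fin d →₀ ℕ) :
    coeff Q (ofTens m A) = ∑ i ∈ fib m Q, A i := by
  classical
  simp only [ofTens_apply, coeff_sum, coeff_monomial, fib, sum_filter]

theorem ofTens_tens {m : ℕ} {P : MvPolynomial (Fin d) ℂ} (hP : P.IsHomogeneous m) :
    ofTens m (tens m P) = P := by
  ext Q
  rw [coeff_ofTens]
  by_cases hQ : Q.degree = m
  · obtain ⟨i, rfl⟩ := exists_expOf hQ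
    have : ∀ j ∈ fib m (expOf i), tens m P j =
        ((fib m (expOf i)).card : ℂ)⁻¹ * coeff (expOf i) P := fun j hj => by
      rw [tens_apply, mem_fib.1 hj]
    rw [sum_congr rfl this, sum_const, nsmul_eq_mul, mul_inv_cancel_left₀]
    exact_mod_cast (card_fib_pos i).ne'
  · rw [hP.coeff_eq_zero hQ]
    refine sum_eq_zero fun i hi => absurd ?_ hQ
    rw [← mem_fib.1 hi, degree_expOf]

/-- The composition is symmetrisation, that is, averaging over words with the same exponent, and
averaging is a contraction by Cauchy–Schwarz. -/
theorem norm_tens_ofTens_le {m : ℕ} (A : Tens d m) : ‖tens m (ofTens m A)‖ ≤ ‖A‖ := by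
  refine le_of_sq_le_sq ?_ (norm_nonneg _)
  rw [EuclideanSpace.norm_sq_eq, EuclideanSpace.norm_sq_eq, sum_tens_eq_sum_fib,
    sum_tens_eq_sum_fib (fun i => ‖A i‖ ^ 2)]
  refine sum_le_sum fun Q hQ => ?_
  obtain ⟨i, -, rfl⟩ := mem_image.1 hQ
  have hN : (0 : ℝ) < (fib m (expOf i)).card := by exact_mod_cast card_fib_pos i
  have : ∀ j ∈ fib m (expOf i), ‖tens m (ofTens m A) j‖ ^ 2 =
      (((fib m (expOf i)).card : ℝ)⁻¹ * ‖∑ j ∈ fib m (expOf i), A j‖) ^ 2 := fun j hj => by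
    rw [tens_apply, mem_fib.1 hj, coeff_ofTens, norm_mul, norm_inv, Complex.norm_natCast]
  rw [sum_congr rfl this, sum_const, nsmul_eq_mul]
  have h1 : ‖∑ j ∈ fib m (expOf i), A j‖ ^ 2 ≤ (fib m (expOf i)).card * ∑ j ∈ fib m (expOf i), ‖A j‖ ^ 2 :=
    (pow_le_pow_left₀ (norm_nonneg _) (norm_sum_le _ _) 2).trans sq_sum_le_card_mul_sum_sq
  calc ((fib m (expOf i)).card : ℝ) * (((fib m (expOf i)).card : ℝ)⁻¹ * ‖∑ j ∈ fib m (expOf i), A j‖) ^ 2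
      = ((fib m (expOf i)).card : ℝ)⁻¹ * ‖∑ j ∈ fib m (expOf i), A j‖ ^ 2 := by field_simp
    _ ≤ ((fib m (expOf i)).card : ℝ)⁻¹ * ((fib m (expOf i)).card * ∑ j ∈ fib m (expOf i), ‖A j‖ ^ 2) := by
        gcongr
    _ = _ := by rw [inv_mul_cancel_left₀ hN.ne']

/-- The coefficient `a_Q` is spread evenly over the `m! / Q!` words of exponent `Q`; together they
contribute `(m! / Q!) · |a_Q Q! / m!|² = (Q! / m!) |a_Q|²`. -/
theorem fischerSq_eq {m : ℕ} {P : MvPolynomial (Fin d) ℂ} (hP : P.IsHomogeneous m) :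
    fischerSq P = ‖tens m P‖ ^ 2 := by
  rw [EuclideanSpace.norm_sq_eq, sum_tens_eq_sum_fib, fischerSq]
  have hsub : P.support ⊆ univ.image (expOf (m := m) (d := d)) := fun Q hQ => by
    obtain ⟨i, rfl⟩ := exists_expOf (not_imp_comm.1 (hP.coeff_eq_zero (d := Q)) (mem_support_iff.1 hQ))
    exact mem_image_of_mem _ (mem_univ _)
  rw [sum_subset hsub fun Q _ hQ => by simp [notMem_support_iff.1 hQ]]
  refine sum_congr rfl fun Q hQ => ?_
  obtain ⟨i, -, rfl⟩ := mem_image.1 hQ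
  have hN : (0 : ℝ) < (fib m (expOf i)).card := by exact_mod_cast card_fib_pos i
  have : ∀ j ∈ fib m (expOf i), ‖tens m P j‖ ^ 2 =
      (((fib m (expOf i)).card : ℝ)⁻¹ * ‖coeff (expOf i) P‖) ^ 2 := fun j hj => by
    rw [tens_apply, mem_fib.1 hj, norm_mul, norm_inv, Complex.norm_natCast]
  have hs : ∑ l, expOf i l = m := by
    rw [← Finsupp.degree_eq_sum, degree_expOf]
  rw [sum_congr rfl this, sum_const, nsmul_eq_mul, hs, ← inv_div, ← card_fib (degree_expOf i)]
  field_simp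

/-- The Fischer norm of the homogeneous component of degree `m`. -/
def fnorm (m : ℕ) (P : MvPolynomial (Fin d) ℂ) : ℝ := ‖tens m P‖

theorem fnorm_nonneg (m : ℕ) (P : MvPolynomial (Fin d) ℂ) : 0 ≤ fnorm m P := norm_nonneg _

theorem fnorm_add_le (m : ℕ) (P Q : MvPolynomial (Fin d) ℂ) :
    fnorm m (P + Q) ≤ fnorm m P + fnorm m Q := by
  rw [fnorm, map_add]; exact norm_add_le _ _

theorem fnorm_sum_le {κ : Type*} (s : Finset κ) (m : ℕ) (P : κ → MvPolynomial (Fin d) ℂ) :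
    fnorm m (∑ a ∈ s, P a) ≤ ∑ a ∈ s, fnorm m (P a) := by
  rw [fnorm, map_sum]; exact norm_sum_le _ _

theorem tens_eq_zero {m k : ℕ} {P : MvPolynomial (Fin d) ℂ} (hP : P.IsHomogeneous k) (hk : k ≠ m) :
    tens m P = 0 := by
  ext i
  rw [tens_apply, hP.coeff_eq_zero (by rw [degree_expOf]; exact hk.symm), mul_zero]; rfl

theorem fnorm_eq_zero_of_isHomogeneous {m k : ℕ} {P : MvPolynomial (Fin d) ℂ} (hP : P.IsHomogeneous k)
    (hk : k ≠ m) : fnorm m P = 0 := by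
  rw [fnorm, tens_eq_zero hP hk, norm_zero]

theorem tens_homogeneousComponent (m : ℕ) (P : MvPolynomial (Fin d) ℂ) :
    tens m (homogeneousComponent m P) = tens m P := by
  ext i
  simp [tens_apply, coeff_homogeneousComponent, degree_expOf]

/-- The tensor product `D` of the two symmetric tensors represents `P * Q` and has norm equal to the
product of the norms; symmetrising it can only decrease the norm. -/
theorem fnorm_mul_le_of_isHomogeneous {a b : ℕ} {P Q : MvPolynomial (Fin d) ℂ} (hP : P.IsHomogeneous a)
    (hQ : Q.IsHomogeneous b) : fnorm (a + b) (P * Q) ≤ fnorm a P * fnorm b Q := by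
  set A := tens a P
  set B := tens b Q
  let D : Tens d (a + b) := WithLp.toLp 2 fun i => A (fun l => i (Fin.castAdd b l)) * B (fun l => i (Fin.natAdd a l))
  have hD : ofTens (a + b) D = P * Q := by
    rw [← ofTens_tens hP, ← ofTens_tens hQ, ofTens_eq, ofTens_eq, ofTens_eq, sum_mul_sum,
      ← (Fin.appendEquiv a b).sum_comp, Fintype.sum_prod_type]
    refine sum_congr rfl fun i _ => sum_congr rfl fun j _ => ?_
    simp [D, A, B, Fin.prod_univ_add, Fin.appendEquiv]
    ring
  have hn : ‖D‖ = ‖A‖ * ‖B‖ := by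
    rw [← sq_eq_sq₀ (norm_nonneg _) (by positivity), mul_pow, EuclideanSpace.norm_sq_eq,
      EuclideanSpace.norm_sq_eq, EuclideanSpace.norm_sq_eq, sum_mul_sum,
      ← (Fin.appendEquiv a b).sum_comp, Fintype.sum_prod_type]
    refine sum_congr rfl fun i _ => sum_congr rfl fun j _ => ?_
    simp [D, Fin.appendEquiv, mul_pow]
  calc fnorm (a + b) (P * Q) = ‖tens (a + b) (ofTens (a + b) D)‖ := by rw [hD, fnorm]
    _ ≤ ‖D‖ := norm_tens_ofTens_le _
    _ = _ := hn

theorem fnorm_mul_le (m : ℕ) (P Q : MvPolynomial (Fin d) ℂ) :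
    fnorm m (P * Q) ≤ ∑ ab ∈ HasAntidiagonal.antidiagonal m, fnorm ab.1 P * fnorm ab.2 Q := by
  have key : tens m (P * Q) = ∑ ab ∈ HasAntidiagonal.antidiagonal m,
      tens m (homogeneousComponent ab.1 P * homogeneousComponent ab.2 Q) := by
    -- A range beyond both degrees and `m`: both factors are sums of their components over it, and
    -- its square contains the antidiagonal of `m`.
    set p := max P.totalDegree Q.totalDegree + m + 1
    have hP : P = ∑ i ∈ range p, homogeneousComponent i P := by
      conv_lhs => rw [← sum_homogeneousComponent P]
      refine sum_subset (range_subset_range.2 (by omega)) fun i _ hi => ?_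
      exact homogeneousComponent_eq_zero _ _ (by simpa using hi)
    have hQ : Q = ∑ i ∈ range p, homogeneousComponent i Q := by
      conv_lhs => rw [← sum_homogeneousComponent Q]
      refine sum_subset (range_subset_range.2 (by omega)) fun i _ hi => ?_
      exact homogeneousComponent_eq_zero _ _ (by simpa using hi)
    conv_lhs => rw [hP, hQ, sum_mul_sum, ← sum_product', map_sum]
    symm
    refine sum_subset (fun ab hab => ?_) fun ab _ hab => ?_
    · rw [HasAntidiagonal.mem_antidiagonal] at hab
      simp only [mem_product, mem_range]; omega
    · exact tens_eq_zero ((homogeneousComponent_isHomogeneous _ _).mul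
        (homogeneousComponent_isHomogeneous _ _)) (by simpa using hab)
  rw [fnorm, key]
  refine (norm_sum_le _ _).trans (sum_le_sum fun ab hab => ?_)
  rw [HasAntidiagonal.mem_antidiagonal] at hab
  subst hab
  refine (fnorm_mul_le_of_isHomogeneous (homogeneousComponent_isHomogeneous _ _)
    (homogeneousComponent_isHomogeneous _ _)).trans (le_of_eq ?_)
  simp only [fnorm, tens_homogeneousComponent]

theorem sum_norm_sq_vecMul {κ : Type*} [Fintype κ] [DecidableEq κ] {M : Matrix κ κ ℂ}
    (hM : M * M.conjTranspose = 1) (a : κ → ℂ) :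
    ∑ j, ‖Matrix.vecMul a M j‖ ^ 2 = ∑ i, ‖a i‖ ^ 2 := by
  have h : ∀ b : κ → ℂ, ((∑ j, ‖b j‖ ^ 2 : ℝ) : ℂ) = dotProduct b (star b) := fun b => by
    simp [dotProduct, Complex.mul_conj']
  have : ((∑ j, ‖Matrix.vecMul a M j‖ ^ 2 : ℝ) : ℂ) = ((∑ i, ‖a i‖ ^ 2 : ℝ) : ℂ) := by
    rw [h, h, Matrix.star_vecMul, ← Matrix.dotProduct_mulVec, Matrix.mulVec_mulVec, hM, Matrix.one_mulVec]
  exact_mod_cast this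

theorem subst_isHomogeneous {m : ℕ} {P : MvPolynomial (Fin d) ℂ} (hP : P.IsHomogeneous m)
    (T : Matrix (Fin d) (Fin d) ℂ) : (subst T P).IsHomogeneous m := by
  rw [subst, ← one_mul m]
  exact hP.aeval _ fun i => IsHomogeneous.sum _ _ _ fun l _ => isHomogeneous_C_mul_X _ _

/-- On tensors the substitution is the `m`-fold tensor power of `T`, which is unitary together with
`T`; symmetrisation does the rest. -/
theorem fnorm_subst_le {m : ℕ} {P : MvPolynomial (Fin d) ℂ} (hP : P.IsHomogeneous m)
    {T : Matrix (Fin d) (Fin d) ℂ} (hT : T ∈ Matrix.unitaryGroup (Fin d) ℂ) :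
    fnorm m (subst T P) ≤ fnorm m P := by
  set A := tens m P
  let M : Matrix (Fin m → Fin d) (Fin m → Fin d) ℂ := fun i j => ∏ l, T (i l) (j l)
  have hM : M * M.conjTranspose = 1 := by
    ext i i'
    have hTT : T * T.conjTranspose = 1 := Matrix.mem_unitaryGroup_iff.1 hT
    have h1 : ∀ a b, ∑ c, T a c * star (T b c) = if a = b then 1 else 0 := fun a b => by
      have := congrFun (congrFun hTT a) b
      simpa [Matrix.mul_apply, Matrix.one_apply] using this
    calc (M * M.conjTranspose) i i' = ∑ j : Fin m → Fin d, ∏ l, T (i l) (j l) * star (T (i' l) (j l)) := by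
          rw [Matrix.mul_apply]
          refine sum_congr rfl fun j _ => ?_
          rw [prod_mul_distrib, Matrix.conjTranspose_apply, star_prod]
      _ = ∏ l, ∑ c, T (i l) c * star (T (i' l) c) := by rw [Fintype.prod_sum]
      _ = ∏ l, if i l = i' l then 1 else 0 := by simp only [h1]
      _ = (1 : Matrix _ _ ℂ) i i' := by
          rw [Matrix.one_apply]
          split_ifs with h
          · subst h; simp
          · obtain ⟨l, hl⟩ := Function.ne_iff.1 h
            exact prod_eq_zero (mem_univ l) (if_neg hl)
  let D : Tens d m := WithLp.toLp 2 (Matrix.vecMul A M)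
  have hD : ofTens m D = subst T P := by
    rw [← ofTens_tens hP, ofTens_eq, ofTens_eq, subst, map_sum]
    simp only [map_mul, map_prod, bind₁_X_right, bind₁_C_right, Fintype.prod_sum, mul_sum]
    rw [sum_comm]
    refine sum_congr rfl fun j _ => ?_
    simp only [D, Matrix.vecMul, dotProduct, map_sum, sum_mul, prod_mul_distrib, M, map_mul, map_prod, A]
    exact sum_congr rfl fun i _ => by ring
  have hn : ‖D‖ = ‖A‖ := by
    rw [← sq_eq_sq₀ (norm_nonneg _) (by positivity), EuclideanSpace.norm_sq_eq, EuclideanSpace.norm_sq_eq]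
    exact sum_norm_sq_vecMul hM _
  calc fnorm m (subst T P) = ‖tens m (ofTens m D)‖ := by rw [hD, fnorm]
    _ ≤ ‖D‖ := norm_tens_ofTens_le _
    _ = _ := hn

theorem fnorm_X (l : Fin d) : fnorm 1 (X l : MvPolynomial (Fin d) ℂ) ≤ 1 := by
  have h := norm_tens_ofTens_le (m := 1) (d := d) (PiLp.single 2 (fun _ => l) 1)
  rw [PiLp.norm_single, norm_one] at h
  have e : ofTens 1 (PiLp.single 2 (fun _ => l) 1) = (X l : MvPolynomial (Fin d) ℂ) := by
    rw [ofTens_eq, sum_eq_single (fun _ => l)]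
    · simp
    · intro i _ hi; simp [hi]
    · simp
  rwa [e] at h

end Fischer

end VertLin

end

/-! ### Vector valued polynomials and their order of vanishing. -/

noncomputable section

namespace VertLin

open MvPolynomial Finset Filter Asymptotics

section VectorPolynomials

variable {d : ℕ}

/-- Vector valued tensors of degree `m` on `ℂᵈ`. -/
abbrev TensV (d m : ℕ) : Type := EuclideanSpace ℂ (Fin d × (Fin m → Fin d))

/-- The tensor of the homogeneous component of degree `m` of a vector valued polynomial. -/
def tensV (m : ℕ) : Poly d →ₗ[ℂ] TensV d m where
  toFun P := WithLp.toLp 2 fun a => tens m (P a.1) a.2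
  map_add' P Q := by ext i; simp
  map_smul' a P := by ext i; simp

theorem tensV_apply (m : ℕ) (P : Poly d) (l : Fin d) (i : Fin m → Fin d) :
    tensV m P (l, i) = tens m (P l) i := rfl

/-- The vector valued homogeneous polynomial of a vector valued tensor. -/
def ofTensV (m : ℕ) : TensV d m →ₗ[ℂ] Poly d where
  toFun A l := ofTens m (WithLp.toLp 2 fun i => A (l, i))
  map_add' A B := by
    ext1 l
    simp only [PiLp.add_apply, Pi.add_apply, ← map_add]
    rfl
  map_smul' a A := by
    ext1 l
    simp only [PiLp.smul_apply, Pi.smul_apply, RingHom.id_apply, ← map_smul]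
    rfl

theorem ofTensV_apply (m : ℕ) (A : TensV d m) (l : Fin d) :
    ofTensV m A l = ofTens m (WithLp.toLp 2 fun i => A (l, i)) := rfl

theorem isHomogeneous_ofTensV (m : ℕ) (A : TensV d m) (l : Fin d) :
    (ofTensV m A l).IsHomogeneous m := isHomogeneous_ofTens _ _

/-- The Fischer norm of the homogeneous component of degree `m` of a vector valued polynomial. -/
def vnorm (m : ℕ) (P : Poly d) : ℝ := ‖tensV m P‖

theorem vnorm_nonneg (m : ℕ) (P : Poly d) : 0 ≤ vnorm m P := norm_nonneg _

theorem vnorm_sq (m : ℕ) (P : Poly d) : vnorm m P ^ 2 = ∑ l, fnorm m (P l) ^ 2 := by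
  simp only [vnorm, fnorm, EuclideanSpace.norm_sq_eq, Fintype.sum_prod_type, tensV_apply]

theorem fischerSqVec_eq {m : ℕ} {P : Poly d} (hP : ∀ l, (P l).IsHomogeneous m) :
    fischerSqVec P = vnorm m P ^ 2 := by
  rw [vnorm_sq, fischerSqVec]
  exact sum_congr rfl fun l _ => fischerSq_eq (hP l)

theorem fnorm_le_vnorm (m : ℕ) (P : Poly d) (l : Fin d) : fnorm m (P l) ≤ vnorm m P := by
  refine le_of_sq_le_sq ?_ (vnorm_nonneg _ _)
  rw [vnorm_sq]
  exact single_le_sum (f := fun l => fnorm m (P l) ^ 2) (fun _ _ => sq_nonneg _) (mem_univ l)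

theorem vnorm_le_sum (m : ℕ) (P : Poly d) : vnorm m P ≤ ∑ l, fnorm m (P l) := by
  refine le_of_sq_le_sq ?_ (sum_nonneg fun _ _ => fnorm_nonneg _ _)
  rw [vnorm_sq]
  exact sum_sq_le_sq_sum_of_nonneg fun _ _ => fnorm_nonneg _ _

theorem vnorm_add_le (m : ℕ) (P Q : Poly d) : vnorm m (P + Q) ≤ vnorm m P + vnorm m Q := by
  rw [vnorm, map_add]; exact norm_add_le _ _

theorem vnorm_sub_le (m : ℕ) (P Q : Poly d) : vnorm m (P - Q) ≤ vnorm m P + vnorm m Q := by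
  rw [vnorm, map_sub]; exact norm_sub_le _ _

/-- For each fixed word, `T` acts on the vector of the `d` components, and a unitary matrix
preserves its Euclidean norm. -/
theorem vnorm_act {m : ℕ} (P : Poly d) {T : Matrix (Fin d) (Fin d) ℂ}
    (hT : T ∈ Matrix.unitaryGroup (Fin d) ℂ) : vnorm m (act T P) = vnorm m P := by
  rw [← sq_eq_sq₀ (vnorm_nonneg _ _) (vnorm_nonneg _ _)]
  simp only [vnorm, EuclideanSpace.norm_sq_eq, Fintype.sum_prod_type_right]
  refine sum_congr rfl fun i _ => ?_
  have hTT : T.transpose * T.transpose.conjTranspose = 1 := by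
    have : star T * T = 1 := Matrix.mem_unitaryGroup_iff'.1 hT
    have h := congrArg Matrix.transpose this
    rw [Matrix.transpose_mul, Matrix.transpose_one] at h
    exact h
  rw [← sum_norm_sq_vecMul hTT fun l => tensV m P (l, i)]
  refine sum_congr rfl fun l _ => ?_
  rw [tensV_apply, Matrix.vecMul_transpose]
  congr 2
  simp only [act, C_mul', map_sum, map_smul, Matrix.mulVec, dotProduct, tensV_apply]
  simp [WithLp.ofLp_sum]

theorem vnorm_subst_le {m : ℕ} {P : Poly d} (hP : ∀ l, (P l).IsHomogeneous m)
    {T : Matrix (Fin d) (Fin d) ℂ} (hT : T ∈ Matrix.unitaryGroup (Fin d) ℂ) :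
    vnorm m (fun l => subst T (P l)) ≤ vnorm m P := by
  refine le_of_sq_le_sq ?_ (vnorm_nonneg _ _)
  rw [vnorm_sq, vnorm_sq]
  refine sum_le_sum fun l _ => pow_le_pow_left₀ (fnorm_nonneg _ _) (fnorm_subst_le (hP l) hT) 2

theorem ofTensV_tensV {m : ℕ} {P : Poly d} (hP : ∀ l, (P l).IsHomogeneous m) :
    ofTensV m (tensV m P) = P := by
  ext1 l
  have h : (WithLp.toLp 2 fun i => tensV m P (l, i)) = tens m (P l) := by ext i; rfl
  rw [ofTensV_apply, h, ofTens_tens (hP l)]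

theorem fnorm_ofTensV_le (m : ℕ) (A : TensV d m) (l : Fin d) : fnorm m (ofTensV m A l) ≤ ‖A‖ := by
  rw [ofTensV_apply, fnorm]
  refine (norm_tens_ofTens_le _).trans (le_of_sq_le_sq ?_ (norm_nonneg _))
  rw [EuclideanSpace.norm_sq_eq, EuclideanSpace.norm_sq_eq, Fintype.sum_prod_type]
  exact single_le_sum (f := fun l => ∑ i, ‖A (l, i)‖ ^ 2) (fun _ _ => by positivity) (mem_univ l)

/-- The value of a vector valued polynomial. -/
def ev (P : Poly d) (v : Fin d → ℂ) : Fin d → ℂ := fun l => eval v (P l)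

theorem ev_add (P Q : Poly d) (v : Fin d → ℂ) : ev (P + Q) v = ev P v + ev Q v := by
  ext l; simp [ev]

theorem ev_sub (P Q : Poly d) (v : Fin d → ℂ) : ev (P - Q) v = ev P v - ev Q v := by
  ext l; simp [ev]

theorem ev_neg (P : Poly d) (v : Fin d → ℂ) : ev (-P) v = -ev P v := by
  ext l; simp [ev]

theorem ev_zero (v : Fin d → ℂ) : ev (0 : Poly d) v = 0 := by
  ext l; simp [ev]

theorem ev_sum {κ : Type*} (s : Finset κ) (P : κ → Poly d) (v : Fin d → ℂ) :
    ev (∑ a ∈ s, P a) v = ∑ a ∈ s, ev (P a) v := by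
  ext l; simp [ev]

theorem ev_act (T : Matrix (Fin d) (Fin d) ℂ) (P : Poly d) (v : Fin d → ℂ) :
    ev (act T P) v = T.mulVec (ev P v) := by
  ext l; simp [ev, act, Matrix.mulVec, dotProduct]

theorem eval_subst (T : Matrix (Fin d) (Fin d) ℂ) (P : MvPolynomial (Fin d) ℂ) (v : Fin d → ℂ) :
    eval v (subst T P) = eval (T.mulVec v) P := by
  induction P using MvPolynomial.induction_on with
  | C a => simp [subst]
  | add p q hp hq => rw [subst, map_add, map_add, map_add, ← hp, ← hq]; rfl
  | mul_X p i hp =>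
    rw [subst, map_mul, map_mul, map_mul, ← hp, bind₁_X_right]
    simp [subst, Matrix.mulVec, dotProduct]

theorem ev_subst (T : Matrix (Fin d) (Fin d) ℂ) (P : Poly d) (v : Fin d → ℂ) :
    ev (fun l => subst T (P l)) v = ev P (T.mulVec v) := by
  ext l; exact eval_subst T (P l) v

theorem eval_smul_of_isHomogeneous {m : ℕ} {P : MvPolynomial (Fin d) ℂ} (hP : P.IsHomogeneous m)
    (a : ℂ) (v : Fin d → ℂ) : eval (a • v) P = a ^ m * eval v P := by
  rw [← ofTens_tens hP, ofTens_eq]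
  simp only [map_sum, map_mul, map_prod, eval_X, eval_C, Pi.smul_apply, smul_eq_mul, prod_mul_distrib,
    prod_const, card_univ, Fintype.card_fin, mul_sum]
  exact sum_congr rfl fun i _ => by ring

theorem norm_eval_le {m : ℕ} {P : MvPolynomial (Fin d) ℂ} (hP : P.IsHomogeneous m) (v : Fin d → ℂ) :
    ‖eval v P‖ ≤ fnorm m P * (d * ‖v‖) ^ m := by
  conv_lhs => rw [← ofTens_tens hP, ofTens_eq]
  simp only [map_sum, map_mul, map_prod, eval_X, eval_C]
  refine (norm_sum_le _ _).trans ?_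
  calc ∑ i, ‖tens m P i * ∏ l, v (i l)‖ ≤ ∑ _i : Fin m → Fin d, fnorm m P * ‖v‖ ^ m := by
        refine sum_le_sum fun i _ => ?_
        rw [norm_mul, norm_prod]
        refine mul_le_mul ?_ ?_ (by positivity) (fnorm_nonneg _ _)
        · exact PiLp.norm_apply_le (tens m P) i
        · calc ∏ l, ‖v (i l)‖ ≤ ∏ _l : Fin m, ‖v‖ :=
              prod_le_prod (fun _ _ => norm_nonneg _) fun l _ => norm_le_pi_norm v _
            _ = ‖v‖ ^ m := by simp
    _ = fnorm m P * (d * ‖v‖) ^ m := by simp [mul_pow]; ring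

theorem norm_ev_le {m : ℕ} {P : Poly d} (hP : ∀ l, (P l).IsHomogeneous m) (v : Fin d → ℂ) :
    ‖ev P v‖ ≤ vnorm m P * (d * ‖v‖) ^ m := by
  refine (pi_norm_le_iff_of_nonneg (mul_nonneg (vnorm_nonneg _ _) (by positivity))).2 fun l => ?_
  refine (norm_eval_le (hP l) v).trans ?_
  gcongr
  exact fnorm_le_vnorm m P l

theorem norm_ev_ofTensV_le {m : ℕ} (A : TensV d m) (v : Fin d → ℂ) :
    ‖ev (ofTensV m A) v‖ ≤ ‖A‖ * (d * ‖v‖) ^ m := by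
  refine (pi_norm_le_iff_of_nonneg (by positivity)).2 fun l => ?_
  refine (norm_eval_le (isHomogeneous_ofTensV m A l) v).trans ?_
  gcongr
  exact fnorm_ofTensV_le m A l

/-- Along `a ↦ a • v` homogeneity gives `P(a v) = a^m P(v)`; division by `a^m` and `a → 0` force
`P(v) = 0`. -/
theorem eq_zero_of_isLittleO {m : ℕ} {P : MvPolynomial (Fin d) ℂ} (hP : P.IsHomogeneous m)
    (h : (fun v => eval v P) =o[𝓝 0] fun v : Fin d → ℂ => ‖v‖ ^ m) : P = 0 := by
  refine hP.funext (isHomogeneous_zero _ _ _) fun v => ?_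
  rw [map_zero]
  have ht : Tendsto (fun a : ℂ => a • v) (𝓝[≠] 0) (𝓝 0) := by
    have : Continuous fun a : ℂ => a • v := by fun_prop
    simpa using (this.tendsto 0).mono_left nhdsWithin_le_nhds
  have h1 := h.comp_tendsto ht
  have h2 : (fun _ : ℂ => eval v P) =o[𝓝[≠] (0 : ℂ)] fun _ => ‖v‖ ^ m := by
    have h3 := (isBigO_refl (fun a : ℂ => (a ^ m)⁻¹) (𝓝[≠] 0)).norm_right.mul_isLittleO h1
    refine (h3.congr' ?_ EventuallyEq.rfl).trans_isBigO ?_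
    · filter_upwards [self_mem_nhdsWithin] with a ha
      have : a ^ m ≠ 0 := pow_ne_zero _ ha
      simp only [Function.comp_apply, eval_smul_of_isHomogeneous hP]
      field_simp
    · refine IsBigO.of_bound 1 ?_
      filter_upwards [self_mem_nhdsWithin] with a ha
      have : ‖a‖ ≠ 0 := norm_ne_zero_iff.2 ha
      simp only [Function.comp_apply, norm_smul, mul_pow, norm_mul, norm_inv, norm_pow, norm_norm, one_mul]
      rw [inv_mul_cancel_left₀ (pow_ne_zero _ this)]
  rcases eq_or_ne v 0 with rfl | hv
  · rcases Nat.eq_zero_or_pos m with rfl | hm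
    · simpa [isLittleO_const_const_iff] using h2
    · simpa [hm.ne'] using h2
  · simpa [isLittleO_const_const_iff, hv] using h2

theorem isBigO_eval_of_isHomogeneous {m : ℕ} {P : MvPolynomial (Fin d) ℂ} (hP : P.IsHomogeneous m) :
    (fun v => eval v P) =O[𝓝 0] fun v : Fin d → ℂ => ‖v‖ ^ m := by
  refine IsBigO.of_bound (fnorm m P * d ^ m) (Eventually.of_forall fun v => ?_)
  refine (norm_eval_le hP v).trans (le_of_eq ?_)
  rw [norm_pow, norm_norm]; ring

theorem isLittleO_pow_norm {X Y : Type*} [NormedAddCommGroup Y] {l : Filter X} {g : X → Y}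
    (hg : Tendsto g l (𝓝 0)) {a b : ℕ} (h : a < b) :
    (fun x => ‖g x‖ ^ b) =o[l] fun x => ‖g x‖ ^ a := by
  obtain ⟨c, rfl⟩ := Nat.exists_eq_add_of_lt h
  have h1 : (fun x => ‖g x‖ ^ (c + 1)) =o[l] fun _ => (1 : ℝ) := by
    rw [isLittleO_one_iff]
    simpa using hg.norm.pow (c + 1)
  simpa [pow_add, mul_assoc] using (isBigO_refl (fun x => ‖g x‖ ^ a) l).mul_isLittleO h1

theorem isBigO_pow_norm {X Y : Type*} [NormedAddCommGroup Y] {l : Filter X} {g : X → Y}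
    (hg : Tendsto g l (𝓝 0)) {a b : ℕ} (h : a ≤ b) :
    (fun x => ‖g x‖ ^ b) =O[l] fun x => ‖g x‖ ^ a := by
  rcases h.eq_or_lt with rfl | h
  · exact isBigO_refl _ _
  · exact (isLittleO_pow_norm hg h).isBigO

/-- Flatness of order `m` contains flatness of every lower order, so the components of degree at
most `m` are removed one by one from below, those of higher degree being negligible. -/
theorem homogeneousComponent_eq_zero_of_isLittleO {m : ℕ} {P : MvPolynomial (Fin d) ℂ}
    (h : (fun v => eval v P) =o[𝓝 0] fun v : Fin d → ℂ => ‖v‖ ^ m) :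
    homogeneousComponent m P = 0 := by
  have key : ∀ i ≤ m, homogeneousComponent i P = 0 := by
    intro i
    induction i using Nat.strong_induction_on with
    | _ i ih =>
      intro hi
      refine eq_zero_of_isLittleO (homogeneousComponent_isHomogeneous _ _) ?_
      have h0 := h.trans_isBigO (isBigO_pow_norm (tendsto_id (α := Fin d → ℂ) (x := 𝓝 0)) hi)
      set p := P.totalDegree + i + 1
      have hP : P = ∑ j ∈ range p, homogeneousComponent j P := by
        conv_lhs => rw [← sum_homogeneousComponent P]
        refine sum_subset (range_subset_range.2 (by omega)) fun i _ hi => ?_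
        exact homogeneousComponent_eq_zero _ _ (by simpa using hi)
      have h1 : ∀ v, eval v (homogeneousComponent i P) =
          eval v P - ∑ j ∈ (range p).erase i, eval v (homogeneousComponent j P) := fun v => by
        conv_rhs => enter [1]; rw [hP]
        rw [map_sum, ← add_sum_erase (range p) _ (mem_range.2 (by omega : i < p))]
        ring
      simp only [h1]
      refine h0.sub (IsLittleO.fun_sum fun j hj => ?_)
      rcases lt_or_gt_of_ne (mem_erase.1 hj).1 with hlt | hgt
      · rw [ih j hlt (by omega)]; simp
      · exact (isBigO_eval_of_isHomogeneous (homogeneousComponent_isHomogeneous _ _)).trans_isLittleO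
          (isLittleO_pow_norm tendsto_id hgt)
  exact key m le_rfl

theorem ev_eq_zero_of_isLittleO {m : ℕ} {P : Poly d} (hP : ∀ l, (P l).IsHomogeneous m)
    (h : (fun v => ev P v) =o[𝓝 0] fun v : Fin d → ℂ => ‖v‖ ^ m) : P = 0 := by
  ext1 l
  exact eq_zero_of_isLittleO (hP l) (isLittleO_pi.1 h l)

end VectorPolynomials

end VertLin

end

/-! ### Expansion in the vertical variable, uniformly along the base. -/

noncomputable section

namespace VertLin

open MvPolynomial Finset Filter Asymptotics

section VerticalExpansion

variable {n d : ℕ} {F : Type*} [NormedAddCommGroup F] [NormedSpace ℂ F] [CompleteSpace F]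

/-- If a holomorphic map vanishes to a given order in the vertical directions along nearby horizontal
points, then it does so uniformly. -/
theorem exists_norm_le_of_isLittleO {g : Model n d → F} {z : Fin n → ℂ}
    (hg : AnalyticAt ℂ g (z, 0)) : ∃ δ > 0, ∃ B, ∀ m : ℕ, ∀ z' ∈ Metric.ball z δ,
      ((fun v => g (z', v)) =o[𝓝 0] fun v : Fin d → ℂ => ‖v‖ ^ m) →
      ∀ v ∈ Metric.ball (0 : Fin d → ℂ) δ, ‖g (z', v)‖ ≤ B * (‖v‖ / δ) ^ (m + 1) := by
  have hev : ∀ᶠ x in 𝓝 ((z, 0) : Model n d), AnalyticAt ℂ g x ∧ ‖g x‖ ≤ ‖g (z, 0)‖ + 1 :=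
    hg.eventually_analyticAt.and
      ((hg.continuousAt.norm.eventually (gt_mem_nhds (lt_add_one _))).mono fun _ h => h.le)
  obtain ⟨δ, hδ, hball⟩ := Metric.eventually_nhds_iff_ball.1 hev
  set B := ‖g (z, 0)‖ + 1
  have hmem : ∀ z' ∈ Metric.ball z δ, ∀ v ∈ Metric.ball (0 : Fin d → ℂ) δ,
      ((z', v) : Model n d) ∈ Metric.ball ((z, 0) : Model n d) δ := fun z' hz' v hv => by
    rw [← ball_prod_same]; exact ⟨hz', hv⟩
  refine ⟨δ, hδ, 2 * B, fun m z' hz' ho v hv => ?_⟩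
  have h00 : g (z', 0) = 0 := by
    have := ho.def (c := 1) one_pos
    rcases Nat.eq_zero_or_pos m with rfl | hm
    · have h1 : ∀ c : ℝ, 0 < c → ‖g (z', 0)‖ ≤ c := fun c hc => by
        simpa using (ho.def hc).self_of_nhds
      exact norm_le_zero_iff.1 (le_of_forall_pos_le_add fun c hc => by simpa using h1 c hc)
    · simpa [hm.ne'] using this.self_of_nhds
  -- Schwarz's lemma of order `m + 1` on the vertical slice over `z'`. The radius `δ` and the bound
  -- depend neither on `z'` nor on `m`; both uniformities are used below.
  have := Complex.dist_le_mul_div_pow_of_mapsTo_ball_of_isLittleO (f := fun v => g (z', v)) (c := 0)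
    (z := v) (R₁ := δ) (R₂ := 2 * B) (n := m) (fun w hw => ?_) (fun w hw => ?_) ?_ hv
  · simpa [h00] using this
  · exact ((hball _ (hmem z' hz' w hw)).1.differentiableAt.comp w
      (f := fun w => ((z', w) : Model n d)) (by fun_prop)).differentiableWithinAt
  · rw [Metric.mem_closedBall, dist_eq_norm]
    have h1 := (hball _ (hmem z' hz' w hw)).2
    have h2 := (hball _ (hmem z' hz' 0 (Metric.mem_ball_self hδ))).2
    linarith [norm_sub_le (g (z', w)) (g (z', 0))]
  · simpa [h00] using ho

theorem isBigO_of_forall_isLittleO {g : Model n d → F} {z : Fin n → ℂ} {m : ℕ}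
    (hg : AnalyticAt ℂ g (z, 0))
    (h : ∀ᶠ z' in 𝓝 z, (fun v => g (z', v)) =o[𝓝 0] fun v : Fin d → ℂ => ‖v‖ ^ m) :
    g =O[𝓝 (z, 0)] fun x => ‖x.2‖ ^ (m + 1) := by
  obtain ⟨δ, hδ, B, hB⟩ := exists_norm_le_of_isLittleO hg
  refine IsBigO.of_bound (B / δ ^ (m + 1)) ?_
  rw [nhds_prod_eq]
  filter_upwards [(h.and (Metric.ball_mem_nhds z hδ)).prod_mk (Metric.ball_mem_nhds 0 hδ)] with x hx
  have := hB m x.1 hx.1.2 hx.1.1 x.2 hx.2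
  rw [div_pow] at this
  rw [norm_pow, norm_norm, div_mul_eq_mul_div, ← mul_div_assoc']
  exact this

/-- The bound of `exists_norm_le_of_isLittleO` has the same constants for all `m`, so at a fixed
point with `‖v‖ < δ` one may let `m` tend to infinity. -/
theorem eventually_eq_zero_of_forall_isLittleO {g : Model n d → F} {z : Fin n → ℂ}
    (hg : AnalyticAt ℂ g (z, 0))
    (h : ∀ᶠ z' in 𝓝 z, ∀ m : ℕ, (fun v => g (z', v)) =o[𝓝 0] fun v : Fin d → ℂ => ‖v‖ ^ m) :
    ∀ᶠ x in 𝓝 ((z, 0) : Model n d), g x = 0 := by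
  obtain ⟨δ, hδ, B, hB⟩ := exists_norm_le_of_isLittleO hg
  rw [nhds_prod_eq]
  filter_upwards [(h.and (Metric.ball_mem_nhds z hδ)).prod_mk (Metric.ball_mem_nhds 0 hδ)] with x hx
  have h1 : ‖x.2‖ / δ < 1 := by
    rw [div_lt_one hδ]; simpa using hx.2
  have h2 : Tendsto (fun m : ℕ => B * (‖x.2‖ / δ) ^ (m + 1)) atTop (𝓝 0) := by
    have := ((tendsto_pow_atTop_nhds_zero_of_lt_one (by positivity) h1).comp
      (tendsto_add_atTop_nat 1)).const_mul B
    simpa using this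
  exact norm_le_zero_iff.1 (ge_of_tendsto' h2 fun m => hB m x.1 hx.1.2 (hx.1.1 m) x.2 hx.2)

/-- `P` is a family of vector valued polynomials, homogeneous of degree `m`, that depends
holomorphically on the parameter in `Ω`. -/
def HolPoly (m : ℕ) (Ω : Set (Fin n → ℂ)) (P : (Fin n → ℂ) → Poly d) : Prop :=
  ∀ l, (∀ z ∈ Ω, (P z l).IsHomogeneous m) ∧ ∀ Q, DifferentiableOn ℂ (fun z => coeff Q (P z l)) Ω

variable {m : ℕ} {Ω : Set (Fin n → ℂ)} {P : (Fin n → ℂ) → Poly d}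

theorem HolPoly.mono {Ω' : Set (Fin n → ℂ)} (hP : HolPoly m Ω P) (h : Ω' ⊆ Ω) : HolPoly m Ω' P :=
  fun l => ⟨fun z hz => (hP l).1 z (h hz), fun Q => ((hP l).2 Q).mono h⟩

theorem HolPoly.differentiableOn_tensV (hP : HolPoly m Ω P) :
    DifferentiableOn ℂ (fun z => tensV m (P z)) Ω := by
  refine (differentiableOn_euclidean ..).2 fun a => ?_
  exact ((hP a.1).2 (expOf a.2)).const_mul _

theorem HolPoly.continuousAt_tensV (hP : HolPoly m Ω P) (hΩ : IsOpen Ω) {z : Fin n → ℂ} (hz : z ∈ Ω) :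
    ContinuousAt (fun z => tensV m (P z)) z :=
  (hP.differentiableOn_tensV.differentiableAt (hΩ.mem_nhds hz)).continuousAt

theorem HolPoly.ev_eq (hP : HolPoly m Ω P) {z : Fin n → ℂ} (hz : z ∈ Ω) (v : Fin d → ℂ) :
    ev (P z) v = ev (ofTensV m (tensV m (P z))) v := by
  rw [ofTensV_tensV fun l => (hP l).1 z hz]

theorem ev_ofTensV_apply (A : TensV d m) (v : Fin d → ℂ) (l : Fin d) :
    ev (ofTensV m A) v l = ∑ i : Fin m → Fin d, A (l, i) * ∏ a, v (i a) := by
  simp [ev, ofTensV_apply, ofTens_eq]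

theorem HolPoly.analyticAt_ev (hP : HolPoly m Ω P) (hΩ : IsOpen Ω) {x : Model n d} (hx : x.1 ∈ Ω) :
    AnalyticAt ℂ (fun x : Model n d => ev (P x.1) x.2) x := by
  have hU : IsOpen {x : Model n d | x.1 ∈ Ω} := hΩ.preimage continuous_fst
  refine analyticOnNhd_of_differentiableOn hU (f := fun x : Model n d => ev (P x.1) x.2) ?_ x hx
  have h1 : DifferentiableOn ℂ (fun x : Model n d => tensV m (P x.1)) {x : Model n d | x.1 ∈ Ω} :=
    hP.differentiableOn_tensV.comp differentiable_fst.differentiableOn fun x hx => hx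
  refine DifferentiableOn.congr (f := fun x : Model n d => ev (ofTensV m (tensV m (P x.1))) x.2) ?_
    fun x hx => hP.ev_eq hx _
  refine differentiableOn_pi.2 fun l => ?_
  simp only [ev_ofTensV_apply]
  refine DifferentiableOn.fun_sum fun i _ => ?_
  refine DifferentiableOn.mul ?_ fun x _ => (Finset.analyticAt_fun_prod _ fun a _ => ?_).differentiableWithinAt
  · exact (differentiableOn_euclidean ..).1 h1 (l, i)
  · exact ((ContinuousLinearMap.proj (R := ℂ) (φ := fun _ : Fin d => ℂ) (i a)).comp
      (ContinuousLinearMap.snd ℂ _ _)).analyticAt x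

/-- The coefficient tensor is continuous in the base point, so freezing the base point costs only
`o(‖w‖^m)`. This is how leading terms at moving points are compared at a fixed `z`. -/
theorem HolPoly.isLittleO_ev_sub (hP : HolPoly m Ω P) (hΩ : IsOpen Ω) {z : Fin n → ℂ} (hz : z ∈ Ω)
    {X : Type*} {l : Filter X} {A : X → Fin n → ℂ} (hA : Tendsto A l (𝓝 z)) (w : X → Fin d → ℂ) :
    (fun s => ev (P (A s)) (w s) - ev (P z) (w s)) =o[l] fun s => ‖w s‖ ^ m := by
  have h1 : Tendsto (fun s => tensV m (P (A s)) - tensV m (P z)) l (𝓝 0) := by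
    have := ((hP.continuousAt_tensV hΩ hz).tendsto.comp hA).sub_const (tensV m (P z))
    simpa using this
  have h2 : (fun s => tensV m (P (A s)) - tensV m (P z)) =o[l] fun _ => (1 : ℝ) :=
    (isLittleO_one_iff ℝ).2 h1
  have h3 : (fun s => ‖tensV m (P (A s)) - tensV m (P z)‖ * (d * ‖w s‖) ^ m) =o[l]
      fun s => 1 * ‖w s‖ ^ m := by
    refine h2.norm_left.mul_isBigO (IsBigO.of_bound (d ^ m) (Eventually.of_forall fun s => ?_))
    simp [mul_pow]
  simp only [one_mul] at h3
  refine IsBigO.trans_isLittleO (IsBigO.of_bound 1 ?_) h3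
  filter_upwards [hA.eventually_mem (hΩ.mem_nhds hz)] with s hs
  rw [hP.ev_eq hs, hP.ev_eq hz, ← ev_sub, ← map_sub, one_mul]
  refine (norm_ev_ofTensV_le _ _).trans (le_abs_self _)

theorem isBigO_ev {Q : Poly d} (hQ : ∀ l, (Q l).IsHomogeneous m) {X : Type*} {l : Filter X}
    (w : X → Fin d → ℂ) : (fun s => ev Q (w s)) =O[l] fun s => ‖w s‖ ^ m := by
  refine IsBigO.of_bound (vnorm m Q * d ^ m) (Eventually.of_forall fun s => ?_)
  refine (norm_ev_le hQ _).trans (le_of_eq ?_)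
  rw [norm_pow, norm_norm, mul_pow]; ring

theorem HolPoly.isBigO_ev (hP : HolPoly m Ω P) (hΩ : IsOpen Ω) {z : Fin n → ℂ} (hz : z ∈ Ω)
    {X : Type*} {l : Filter X} {A : X → Fin n → ℂ} (hA : Tendsto A l (𝓝 z)) (w : X → Fin d → ℂ) :
    (fun s => ev (P (A s)) (w s)) =O[l] fun s => ‖w s‖ ^ m := by
  have := (hP.isLittleO_ev_sub hΩ hz hA w).isBigO.add (VertLin.isBigO_ev (fun l => (hP l).1 z hz) w)
  simpa using this

/-- Telescoping: the factors are exchanged one at a time. -/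
theorem isLittleO_prod_sub_prod {X κ : Type*} {l : Filter X} {g : X → ℝ} (s : Finset κ)
    {a b : κ → X → ℂ} (ha : ∀ i, a i =O[l] g) (hb : ∀ i, b i =O[l] g)
    (hab : ∀ i, (fun x => a i x - b i x) =o[l] g) :
    (fun x => ∏ i ∈ s, a i x - ∏ i ∈ s, b i x) =o[l] fun x => g x ^ s.card := by
  classical
  have hprod : ∀ s : Finset κ, (fun x => ∏ i ∈ s, b i x) =O[l] fun x => g x ^ s.card := by
    intro s
    have := IsBigO.finsetProd (s := s) (f := b) (g := fun _ => g) (l := l) fun i _ => hb i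
    simpa using this
  induction s using Finset.induction_on with
  | empty => simpa using tendsto_const_nhds
  | insert i s hi ih =>
    have h := ((ha i).mul_isLittleO ih).add ((hab i).mul_isBigO (hprod s))
    refine (h.congr_left fun x => ?_).congr_right fun x => ?_
    · rw [prod_insert hi, prod_insert hi]; ring
    · rw [card_insert_of_notMem hi, pow_succ']

theorem isLittleO_ev_sub_ev {Q : Poly d} (hQ : ∀ l, (Q l).IsHomogeneous m) {X : Type*} {l : Filter X}
    {w w' : X → Fin d → ℂ} {g : X → ℝ} (hw : w =O[l] g) (hw' : w' =O[l] g)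
    (h : (fun s => w s - w' s) =o[l] g) :
    (fun s => ev Q (w s) - ev Q (w' s)) =o[l] fun s => g s ^ m := by
  refine isLittleO_pi.2 fun a => ?_
  rw [← ofTensV_tensV hQ]
  simp only [Pi.sub_apply, ev_ofTensV_apply, ← sum_sub_distrib, ← mul_sub]
  refine IsLittleO.fun_sum fun i _ => IsLittleO.const_mul_left ?_ _
  have := isLittleO_prod_sub_prod (l := l) (g := g) (univ : Finset (Fin m))
    (a := fun b s => w s (i b)) (b := fun b s => w' s (i b))
    (fun b => isBigO_pi.1 hw (i b)) (fun b => isBigO_pi.1 hw' (i b)) fun b => isLittleO_pi.1 h (i b)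
  simpa using this

end VerticalExpansion

section VerticalTaylor

variable {n d : ℕ}

/-- The polynomial `v ↦ p (v, …, v)` of a multilinear map `p`. -/
def mlPoly {a k : ℕ} {σ : Type*} (p : (Fin k → Fin a) → ℂ) (Y : Fin a → MvPolynomial σ ℂ) : MvPolynomial σ ℂ :=
  ∑ i, C (p i) * ∏ l, Y (i l)

theorem multilinear_diag_eq {a k : ℕ} {E F : Type*} [NormedAddCommGroup E] [NormedSpace ℂ E]
    [NormedAddCommGroup F] [NormedSpace ℂ F] (p : E [×k]→L[ℂ] F) (e : Fin a → E) (w : Fin a → ℂ) :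
    p (fun _ => ∑ b, w b • e b) = ∑ i : Fin k → Fin a, (∏ l, w (i l)) • p fun l => e (i l) := by
  rw [ContinuousMultilinearMap.map_sum]
  exact sum_congr rfl fun i _ => p.map_smul_univ _ _

/-- The unit vectors of the vertical directions. -/
def vert (n : ℕ) {d : ℕ} (b : Fin d) : Model n d := (0, Pi.single b 1)

theorem sum_smul_vert (w : Fin d → ℂ) : ∑ b, w b • vert n b = (0, w) := by
  have h : ∑ b, w b • (Pi.single b 1 : Fin d → ℂ) = w := by
    ext i; simp [Finset.sum_apply, Pi.single_apply]
  ext i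
  · simp [vert, Prod.fst_sum]
  · simp only [vert, Prod.snd_sum, Prod.smul_mk, h]

theorem norm_vert_le (b : Fin d) : ‖vert n b‖ ≤ 1 := by
  refine norm_prod_le_iff.2 ⟨by simp [vert], ?_⟩
  refine (pi_norm_le_iff_of_nonneg zero_le_one).2 fun i => ?_
  by_cases h : i = b
  · subst h; simp [vert]
  · simp [vert, h]

/-- The part of degree `q` in the vertical variable of the Taylor expansion of `g` at `(z, 0)`. -/
def vTay (q : ℕ) (g : Model n d → Fin d → ℂ) (z : Fin n → ℂ) : Poly d :=
  fun l => ofTens q (WithLp.toLp 2 fun i => taylor g (z, 0) q (fun a => vert n (i a)) l)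

theorem vTay_isHomogeneous (q : ℕ) (g : Model n d → Fin d → ℂ) (z : Fin n → ℂ) (l : Fin d) :
    (vTay q g z l).IsHomogeneous q := isHomogeneous_ofTens _ _

theorem ev_vTay (q : ℕ) (g : Model n d → Fin d → ℂ) (z : Fin n → ℂ) (v : Fin d → ℂ) :
    ev (vTay q g z) v = taylor g (z, 0) q fun _ => (0, v) := by
  have h := multilinear_diag_eq (taylor g (z, 0) q) (vert n) v
  rw [sum_smul_vert] at h
  rw [h]
  ext l
  simp [ev, vTay, ofTens_eq, Finset.sum_apply, mul_comm]

theorem holPoly_vTay {Ω : Set (Fin n → ℂ)} (q : ℕ) {g : Model n d → Fin d → ℂ}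
    (hg : ∀ z ∈ Ω, AnalyticAt ℂ g (z, 0)) : HolPoly q Ω (vTay q g) := by
  refine fun l => ⟨fun z _ => vTay_isHomogeneous q g z l, fun Q => ?_⟩
  simp only [vTay, coeff_ofTens]
  refine DifferentiableOn.fun_sum fun i _ => fun z hz => DifferentiableAt.differentiableWithinAt ?_
  have h1 : DifferentiableAt ℂ (iteratedFDeriv ℂ q g) (z, 0) := by
    have := (hg z hz).contDiffAt (n := (q + 1 : ℕ))
    exact this.differentiableAt_iteratedFDeriv (by exact_mod_cast Nat.lt_succ_self q)
  have h2 : DifferentiableAt ℂ (fun z : Fin n → ℂ => iteratedFDeriv ℂ q g (z, 0)) z :=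
    DifferentiableAt.comp (f := fun z : Fin n → ℂ => ((z, 0) : Model n d)) z h1 (by fun_prop)
  have h3 : DifferentiableAt ℂ (fun z : Fin n → ℂ =>
      iteratedFDeriv ℂ q g (z, 0) fun a => vert n (i a)) z :=
    (ContinuousMultilinearMap.apply ℂ (fun _ : Fin q => Model n d) (Fin d → ℂ)
      (fun a => vert n (i a))).differentiableAt.comp z h2
  have h4 := (differentiableAt_pi.1 h3 l).const_mul ((q.factorial : ℂ)⁻¹)
  exact h4

theorem hasFPowerSeriesAt_taylor {E F : Type*} [NormedAddCommGroup E] [NormedSpace ℂ E]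
    [FiniteDimensional ℂ E] [NormedAddCommGroup F] [NormedSpace ℂ F] [CompleteSpace F] {g : E → F} {c : E}
    (hg : AnalyticAt ℂ g c) : HasFPowerSeriesAt g (taylor g c) c := by
  have hev : ∀ᶠ x in 𝓝 c, AnalyticAt ℂ g x ∧ ‖g x‖ ≤ ‖g c‖ + 1 :=
    hg.eventually_analyticAt.and
      ((hg.continuousAt.norm.eventually (gt_mem_nhds (lt_add_one _))).mono fun _ h => h.le)
  obtain ⟨R, hR, hball⟩ := Metric.eventually_nhds_iff_ball.1 hev
  exact (hasFPowerSeriesOnBall_taylor hR (fun x hx => (hball x hx).1.differentiableAt.differentiableWithinAt)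
    fun x hx => (hball x hx).2).hasFPowerSeriesAt

theorem isBigO_sub_sum_taylor {E F X : Type*} [NormedAddCommGroup E] [NormedSpace ℂ E]
    [FiniteDimensional ℂ E] [NormedAddCommGroup F] [NormedSpace ℂ F] [CompleteSpace F] {g : E → F} {c : E}
    (hg : AnalyticAt ℂ g c) (m : ℕ) {l : Filter X} {y : X → E} (hy : Tendsto y l (𝓝 0)) :
    (fun s => g (c + y s) - ∑ q ∈ range (m + 1), taylor g c q fun _ => y s) =O[l]
      fun s => ‖y s‖ ^ (m + 1) :=
  ((hasFPowerSeriesAt_taylor hg).isBigO_sub_partialSum_pow (m + 1)).comp_tendsto hy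

theorem isBigO_sub_sum_vTay {g : Model n d → Fin d → ℂ} {z : Fin n → ℂ} (hg : AnalyticAt ℂ g (z, 0))
    (m : ℕ) : (fun v => g (z, v) - ∑ q ∈ range (m + 1), ev (vTay q g z) v) =O[𝓝 0]
      fun v => ‖v‖ ^ (m + 1) := by
  have h := isBigO_sub_sum_taylor hg m (l := 𝓝 (0 : Fin d → ℂ)) (y := fun v => ((0, v) : Model n d))
    ((by fun_prop : Continuous fun v : Fin d → ℂ => ((0, v) : Model n d)).tendsto' _ _ rfl)
  simpa [ev_vTay, Prod.norm_def] using h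

theorem vTay_eq_zero {g : Model n d → Fin d → ℂ} {z : Fin n → ℂ} (hg : AnalyticAt ℂ g (z, 0))
    {m : ℕ} (h : (fun v => g (z, v)) =o[𝓝 0] fun v => ‖v‖ ^ m) :
    ∀ q ≤ m, vTay q g z = 0 := by
  intro q hq
  have h1 := (isBigO_sub_sum_vTay hg q).trans_isLittleO
    (isLittleO_pow_norm (tendsto_id (α := Fin d → ℂ) (x := 𝓝 0)) (Nat.lt_succ_self q))
  have h2 := (h.trans_isBigO (isBigO_pow_norm (tendsto_id (α := Fin d → ℂ) (x := 𝓝 0)) hq)).sub h1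
  ext1 l
  have h3 : (fun v => eval v (∑ q ∈ range (q + 1), vTay q g z l)) =o[𝓝 0] fun v : Fin d → ℂ => ‖v‖ ^ q := by
    have := isLittleO_pi.1 h2 l
    refine this.congr_left fun v => ?_
    simp [ev, Finset.sum_apply]
  have h4 := homogeneousComponent_eq_zero_of_isLittleO h3
  rw [map_sum, sum_eq_single q] at h4
  · rwa [homogeneousComponent_eq_self (vTay_isHomogeneous q g z l)] at h4
  · intro b _ hb
    rw [homogeneousComponent_of_mem ((mem_homogeneousSubmodule _ _).2 (vTay_isHomogeneous b g z l)),
      if_neg (Ne.symm hb)]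
  · simp

/-- The leading term in the vertical variable of a holomorphic map that vanishes to order `m` along
`v = 0`. -/
theorem isLittleO_sub_ev_vTay {g : Model n d → Fin d → ℂ} {Ω : Set (Fin n → ℂ)} (hΩ : IsOpen Ω)
    (hg : ∀ z ∈ Ω, AnalyticAt ℂ g (z, 0)) {m : ℕ}
    (h : ∀ z ∈ Ω, (fun v => g (z, v)) =o[𝓝 0] fun v => ‖v‖ ^ m) {z : Fin n → ℂ} (hz : z ∈ Ω) :
    (fun x : Model n d => g x - ev (vTay (m + 1) g z) x.2) =o[𝓝 (z, 0)] fun x => ‖x.2‖ ^ (m + 1) := by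
  have hP := holPoly_vTay (m + 1) hg
  have hG : AnalyticAt ℂ (fun x : Model n d => g x - ev (vTay (m + 1) g x.1) x.2) (z, 0) :=
    (hg z hz).fun_sub (hP.analyticAt_ev hΩ (x := (z, 0)) hz)
  -- First the leading term at the moving base point is subtracted. The rest is flat on every nearby
  -- slice, hence flat uniformly, and only then is the base point frozen at `z`.
  have h1 : ∀ᶠ z' in 𝓝 z, (fun v => g (z', v) - ev (vTay (m + 1) g z') v) =o[𝓝 0]
      fun v : Fin d → ℂ => ‖v‖ ^ (m + 1) := by
    filter_upwards [hΩ.mem_nhds hz] with z' hz'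
    have h2 := (isBigO_sub_sum_vTay (hg z' hz') (m + 1)).trans_isLittleO
      (isLittleO_pow_norm (tendsto_id (α := Fin d → ℂ) (x := 𝓝 0)) (Nat.lt_succ_self (m + 1)))
    refine h2.congr_left fun v => ?_
    rw [sum_range_succ, sum_eq_zero, zero_add]
    intro q hq
    rw [vTay_eq_zero (hg z' hz') (h z' hz') q (by rw [mem_range] at hq; omega), ev_zero]
  have hsnd : Tendsto (fun x : Model n d => x.2) (𝓝 (z, 0)) (𝓝 0) := continuous_snd.tendsto' _ _ rfl
  have hfst : Tendsto (fun x : Model n d => x.1) (𝓝 (z, 0)) (𝓝 z) := continuous_fst.tendsto' _ _ rfl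
  have h3 := (isBigO_of_forall_isLittleO hG h1).trans_isLittleO
    (isLittleO_pow_norm hsnd (Nat.lt_succ_self (m + 1)))
  refine (h3.add (hP.isLittleO_ev_sub hΩ hz hfst fun x => x.2)).congr_left fun x => ?_
  abel

end VerticalTaylor

end VertLin

end

/-! ### Transition functions of the manifold, of `C` and of the normal bundle. -/

noncomputable section

namespace VertLin

open MvPolynomial Finset Filter Asymptotics

namespace AdaptedAtlas

variable {n d : ℕ} {M : Type*} [TopologicalSpace M] [ChartedSpace (Model n d) M]
  [IsManifold 𝓘(ℂ, Model n d) ω M] {C : Set M} {ι : Type*} (A : AdaptedAtlas n d M C ι)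

theorem mk_mem_target {j : ι} {z : Fin n → ℂ} (hz : z ∈ Metric.closedBall (0 : Fin n → ℂ) A.rOut) :
    ((z, 0) : Model n d) ∈ (A.chart j).target := A.polydisc_subset j ⟨hz, rfl⟩

theorem pt_mem_source {j : ι} {z : Fin n → ℂ} (hz : z ∈ Metric.closedBall (0 : Fin n → ℂ) A.rOut) :
    A.pt j z ∈ (A.chart j).source := (A.chart j).map_target (A.mk_mem_target hz)

theorem chart_pt {j : ι} {z : Fin n → ℂ} (hz : z ∈ Metric.closedBall (0 : Fin n → ℂ) A.rOut) :
    A.chart j (A.pt j z) = (z, 0) := (A.chart j).right_inv (A.mk_mem_target hz)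

theorem pt_mem {j : ι} {z : Fin n → ℂ} (hz : z ∈ Metric.closedBall (0 : Fin n → ℂ) A.rOut) :
    A.pt j z ∈ C := by
  rw [A.mem_iff j _ (A.pt_mem_source hz), A.chart_pt hz]

theorem ball_subset_closedBall {r : ℝ} (hr : r ≤ A.rOut) {z : Fin n → ℂ}
    (hz : z ∈ Metric.ball (0 : Fin n → ℂ) r) : z ∈ Metric.closedBall (0 : Fin n → ℂ) A.rOut :=
  Metric.ball_subset_closedBall (Metric.ball_subset_ball hr hz)

theorem mem_dom_iff {r : ℝ} (hr : r ≤ A.rOut) {k j : ι} {z : Fin n → ℂ} :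
    z ∈ A.dom r k j ↔ z ∈ Metric.ball (0 : Fin n → ℂ) r ∧ A.pt j z ∈ (A.chart k).source ∧
      A.transC k j z ∈ Metric.ball (0 : Fin n → ℂ) r := by
  constructor
  · rintro ⟨h1, h2, h3, h4⟩
    exact ⟨h1, h2, h4⟩
  · rintro ⟨h1, h2, h3⟩
    exact ⟨h1, h2, A.pt_mem (A.ball_subset_closedBall hr h1), h3⟩

theorem dom_mono {r s : ℝ} (h : r ≤ s) (k j : ι) : A.dom r k j ⊆ A.dom s k j := by
  rintro z ⟨h1, h2, h3, h4⟩
  exact ⟨Metric.ball_subset_ball h h1, h2, h3, Metric.ball_subset_ball h h4⟩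

theorem dom_subset_ball (r : ℝ) (k j : ι) : A.dom r k j ⊆ Metric.ball 0 r := fun _ h => h.1

theorem trans_zero {k j : ι} {z : Fin n → ℂ} (hz : z ∈ A.dom A.rOut k j) :
    A.Trans k j (z, 0) = (A.transC k j z, 0) := by
  obtain ⟨h1, h2, h3⟩ := (A.mem_dom_iff le_rfl).1 hz
  have h4 := (A.mem_iff k _ h2).1 (A.pt_mem (A.ball_subset_closedBall le_rfl h1))
  exact Prod.ext rfl h4

theorem pt_transC {k j : ι} {z : Fin n → ℂ} (hz : z ∈ A.dom A.rOut k j) :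
    A.pt k (A.transC k j z) = A.pt j z := by
  obtain ⟨h1, h2, h3⟩ := (A.mem_dom_iff le_rfl).1 hz
  rw [pt, ← A.trans_zero hz]
  exact (A.chart k).left_inv h2

theorem transC_mem_ball {r : ℝ} (hr : r ≤ A.rOut) {k j : ι} {z : Fin n → ℂ} (hz : z ∈ A.dom r k j) :
    A.transC k j z ∈ Metric.ball 0 r := ((A.mem_dom_iff hr).1 hz).2.2

theorem mem_dom_of_pt_eq {r : ℝ} {i j k : ι} {z z' : Fin n → ℂ}
    (h : A.pt j z' = A.pt k z) (hz' : z' ∈ Metric.ball 0 r) (hz : z ∈ A.dom r i k) : z' ∈ A.dom r i j := by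
  refine ⟨hz', ?_⟩
  rw [h]; exact hz.2

theorem transC_of_pt_eq {i j k : ι} {z z' : Fin n → ℂ} (h : A.pt j z' = A.pt k z) :
    A.transC i j z' = A.transC i k z := by
  have : A.Trans i j (z', 0) = A.Trans i k (z, 0) := congrArg (A.chart i) h
  exact congrArg Prod.fst this

theorem mem_dom_self {r : ℝ} (hr : r ≤ A.rOut) {j : ι} {z : Fin n → ℂ} (hz : z ∈ Metric.ball 0 r) :
    z ∈ A.dom r j j := by
  have hz' := A.ball_subset_closedBall hr hz
  refine (A.mem_dom_iff hr).2 ⟨hz, A.pt_mem_source hz', ?_⟩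
  have : A.transC j j z = z := congrArg Prod.fst (A.chart_pt hz')
  rwa [this]

theorem transC_self {j : ι} {z : Fin n → ℂ} (hz : z ∈ Metric.ball 0 A.rOut) : A.transC j j z = z :=
  congrArg Prod.fst (A.chart_pt (A.ball_subset_closedBall le_rfl hz))

theorem transC_mem_dom {r : ℝ} (hr : r ≤ A.rOut) {i j k : ι} {z : Fin n → ℂ} (hz : z ∈ A.dom r i k)
    (hz' : z ∈ A.dom r j k) : A.transC j k z ∈ A.dom r i j :=
  A.mem_dom_of_pt_eq (A.pt_transC (A.dom_mono hr _ _ hz')) (A.transC_mem_ball hr hz') hz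

theorem transC_transC {i j k : ι} {z : Fin n → ℂ} (hz : z ∈ A.dom A.rOut j k) :
    A.transC i j (A.transC j k z) = A.transC i k z := A.transC_of_pt_eq (A.pt_transC hz)

/-- The domain of the transition function `Φ_{kj}`. -/
def transDom (k j : ι) : Set (Model n d) :=
  (A.chart j).target ∩ (A.chart j).symm ⁻¹' (A.chart k).source

theorem isOpen_transDom (k j : ι) : IsOpen (A.transDom k j) :=
  (A.chart j).isOpen_inter_preimage_symm (A.chart k).open_source

theorem mk_mem_transDom {k j : ι} {z : Fin n → ℂ} (hz : z ∈ A.dom A.rOut k j) :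
    ((z, 0) : Model n d) ∈ A.transDom k j := by
  obtain ⟨h1, h2, h3⟩ := (A.mem_dom_iff le_rfl).1 hz
  exact ⟨A.mk_mem_target (A.ball_subset_closedBall le_rfl h1), h2⟩

theorem analyticAt_trans {k j : ι} {x : Model n d} (hx : x ∈ A.transDom k j) :
    AnalyticAt ℂ (A.Trans k j) x := by
  have h1 : ContMDiffAt 𝓘(ℂ, Model n d) 𝓘(ℂ, Model n d) ω (A.chart j).symm x :=
    contMDiffAt_symm_of_mem_maximalAtlas (A.chart_mem j) hx.1
  have h2 : ContMDiffAt 𝓘(ℂ, Model n d) 𝓘(ℂ, Model n d) ω (A.chart k) ((A.chart j).symm x) :=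
    contMDiffAt_of_mem_maximalAtlas (A.chart_mem k) hx.2
  have h3 := h2.comp x h1
  rw [contMDiffAt_iff_contDiffAt] at h3
  exact h3.analyticAt

theorem analyticAt_trans_mk {k j : ι} {z : Fin n → ℂ} (hz : z ∈ A.dom A.rOut k j) :
    AnalyticAt ℂ (A.Trans k j) (z, 0) := A.analyticAt_trans (A.mk_mem_transDom hz)

theorem trans_trans {i j k : ι} {x : Model n d} (hx : x ∈ A.transDom j k) :
    A.Trans i j (A.Trans j k x) = A.Trans i k x :=
  congrArg (A.chart i) ((A.chart j).left_inv hx.2)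

theorem continuousOn_pt (j : ι) : ContinuousOn (A.pt j) (Metric.closedBall 0 A.rOut) :=
  (A.chart j).continuousOn_symm.comp (f := fun z : Fin n → ℂ => ((z, 0) : Model n d)) (by fun_prop)
    fun _ hz => A.mk_mem_target hz

theorem isOpen_dom {r : ℝ} (hr : r ≤ A.rOut) (k j : ι) : IsOpen (A.dom r k j) := by
  have hV : IsOpen ((A.chart k).source ∩ A.chart k ⁻¹' (Prod.fst ⁻¹' Metric.ball 0 r)) :=
    (A.chart k).isOpen_inter_preimage (Metric.isOpen_ball.preimage continuous_fst)
  have h := ((A.continuousOn_pt j).mono fun z hz => A.ball_subset_closedBall hr hz).isOpen_inter_preimage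
    Metric.isOpen_ball hV
  convert h using 1
  ext z
  rw [A.mem_dom_iff hr]
  rfl

theorem analyticAt_transC {k j : ι} {z : Fin n → ℂ} (hz : z ∈ A.dom A.rOut k j) :
    AnalyticAt ℂ (A.transC k j) z := by
  have h1 : AnalyticAt ℂ (fun z : Fin n → ℂ => ((z, 0) : Model n d)) z :=
    analyticAt_id.prod analyticAt_const
  have h2 : AnalyticAt ℂ (fun z : Fin n → ℂ => A.Trans k j (z, 0)) z :=
    AnalyticAt.comp (g := A.Trans k j) (f := fun z : Fin n → ℂ => ((z, 0) : Model n d))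
      (A.analyticAt_trans_mk hz) h1
  exact analyticAt_fst.comp h2

theorem t_mulVec {k j : ι} {z : Fin n → ℂ} (hz : z ∈ A.dom A.rOut k j) (w : Fin d → ℂ) :
    (A.t k j z).mulVec w = (fderiv ℂ (A.Trans k j) (z, 0) (0, w)).2 := by
  rw [t, LinearMap.toMatrix'_mulVec]
  have h1 : HasFDerivAt (fun w : Fin d → ℂ => ((z, w) : Model n d))
      (ContinuousLinearMap.inr ℂ (Fin n → ℂ) (Fin d → ℂ)) 0 := hasFDerivAt_prodMk_right _ _
  have h2 := ((A.analyticAt_trans_mk hz).differentiableAt.hasFDerivAt.comp (0 : Fin d → ℂ) h1).snd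
  have h3 : fderiv ℂ (fun w : Fin d → ℂ => (A.Trans k j (z, w)).2) 0 = _ := h2.fderiv
  rw [h3]
  rfl

theorem fderiv_trans_apply (hsplit : A.IsSplit) {k j : ι} {z : Fin n → ℂ} (hz : z ∈ A.dom A.rOut k j)
    (w : Fin d → ℂ) : fderiv ℂ (A.Trans k j) (z, 0) (0, w) = (0, (A.t k j z).mulVec w) := by
  refine Prod.ext ?_ (A.t_mulVec hz w).symm
  have h1 : HasFDerivAt (fun w : Fin d → ℂ => ((z, w) : Model n d))
      (ContinuousLinearMap.inr ℂ (Fin n → ℂ) (Fin d → ℂ)) 0 := hasFDerivAt_prodMk_right _ _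
  have h2 := ((A.analyticAt_trans_mk hz).differentiableAt.hasFDerivAt.comp (0 : Fin d → ℂ) h1).fst
  have h3 : fderiv ℂ (fun w : Fin d → ℂ => (A.Trans k j (z, w)).1) 0 = _ := h2.fderiv
  rw [hsplit k j z hz] at h3
  exact (congrArg (fun L : (Fin d → ℂ) →L[ℂ] (Fin n → ℂ) => L w) h3).symm

theorem t_apply {k j : ι} {z : Fin n → ℂ} (hz : z ∈ A.dom A.rOut k j) (a b : Fin d) :
    A.t k j z a b = (fderiv ℂ (A.Trans k j) (z, 0) (vert n b)).2 a := by
  rw [vert, ← A.t_mulVec hz]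
  simp

theorem differentiableOn_t (k j : ι) (a b : Fin d) :
    DifferentiableOn ℂ (fun z => A.t k j z a b) (A.dom A.rOut k j) := by
  refine DifferentiableOn.congr (f := fun z => (fderiv ℂ (A.Trans k j) (z, 0) (vert n b)).2 a) ?_
    fun z hz => A.t_apply hz a b
  intro z hz
  refine DifferentiableAt.differentiableWithinAt ?_
  have h1 : DifferentiableAt ℂ (fderiv ℂ (A.Trans k j)) (z, 0) :=
    (A.analyticAt_trans_mk hz).fderiv.differentiableAt
  have h2 : DifferentiableAt ℂ (fun z : Fin n → ℂ => fderiv ℂ (A.Trans k j) (z, 0)) z :=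
    DifferentiableAt.comp (f := fun z : Fin n → ℂ => ((z, 0) : Model n d)) z h1 (by fun_prop)
  have h3 : DifferentiableAt ℂ (fun z : Fin n → ℂ => (fderiv ℂ (A.Trans k j) (z, 0) (vert n b)).2) z :=
    (h2.clm_apply (differentiableAt_const _)).snd
  exact differentiableAt_pi.1 h3 a

/-- Unitary holomorphic transition matrices are locally constant. -/
theorem eventually_t_eq (hunitary : A.IsUnitary) {k j : ι} {z : Fin n → ℂ} (hz : z ∈ A.dom A.rOut k j) :
    ∀ᶠ z' in 𝓝 z, A.t k j z' = A.t k j z := by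
  have hdom := (A.isOpen_dom le_rfl k j).mem_nhds hz
  -- The rows of a unitary matrix are unit vectors, so the matrix, read as a Euclidean vector, has
  -- constant norm `√d`. In a strictly convex space the maximum principle then makes the vector
  -- itself locally constant.
  let f : (Fin n → ℂ) → EuclideanSpace ℂ (Fin d × Fin d) := fun z =>
    WithLp.toLp 2 fun a => A.t k j z a.1 a.2
  have hf : ∀ z ∈ A.dom A.rOut k j, ‖f z‖ ^ 2 = d := fun z hz => by
    have h := Matrix.mem_unitaryGroup_iff.1 (hunitary k j z hz)
    have h1 : ∀ a, ∑ b, ‖A.t k j z a b‖ ^ 2 = 1 := fun a => by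
      have h2 := congrFun (congrFun h a) a
      rw [Matrix.mul_apply, Matrix.one_apply_eq] at h2
      have h3 : ((∑ b, ‖A.t k j z a b‖ ^ 2 : ℝ) : ℂ) = 1 := by
        rw [← h2]; push_cast
        exact sum_congr rfl fun b _ => (Complex.mul_conj' _).symm
      exact_mod_cast h3
    rw [EuclideanSpace.norm_sq_eq, Fintype.sum_prod_type]
    simp only [f, h1]
    simp
  have hd : ∀ᶠ z' in 𝓝 z, DifferentiableAt ℂ f z' := by
    filter_upwards [hdom] with z' hz'
    refine (differentiableAt_euclidean ..).2 fun a => ?_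
    exact (A.differentiableOn_t k j a.1 a.2).differentiableAt ((A.isOpen_dom le_rfl k j).mem_nhds hz')
  have hmax : IsLocalMax (norm ∘ f) z := by
    filter_upwards [hdom] with z' hz'
    refine le_of_sq_le_sq ?_ (norm_nonneg _)
    exact ((hf z' hz').trans (hf z hz).symm).le
  filter_upwards [Complex.eventually_eq_of_isLocalMax_norm hd hmax] with z' hz'
  ext a b
  exact congrArg (fun v : EuclideanSpace ℂ (Fin d × Fin d) => v (a, b)) hz'

/-- The chain rule for `Φ_{ik} = Φ_{ij} Φ_{jk}`: by the splitting, vertical vectors along `C` stay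
vertical, so the vertical blocks multiply. -/
theorem t_mul_t (hsplit : A.IsSplit) {i j k : ι} {z : Fin n → ℂ} (hik : z ∈ A.dom A.rOut i k)
    (hjk : z ∈ A.dom A.rOut j k) : A.t i j (A.transC j k z) * A.t j k z = A.t i k z := by
  have hij := A.transC_mem_dom le_rfl hik hjk
  refine Matrix.ext_of_mulVec_single fun b => ?_
  rw [← Matrix.mulVec_mulVec, A.t_mulVec hik, A.t_mulVec hij]
  have h1 : HasFDerivAt (A.Trans i j) (fderiv ℂ (A.Trans i j) (A.transC j k z, 0)) (A.Trans j k (z, 0)) := by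
    rw [A.trans_zero hjk]; exact (A.analyticAt_trans_mk hij).differentiableAt.hasFDerivAt
  have h2 := h1.comp _ (A.analyticAt_trans_mk hjk).differentiableAt.hasFDerivAt
  have h3 : A.Trans i k =ᶠ[𝓝 (z, 0)] A.Trans i j ∘ A.Trans j k := by
    filter_upwards [(A.isOpen_transDom j k).mem_nhds (A.mk_mem_transDom hjk)] with x hx
    exact (A.trans_trans hx).symm
  rw [h3.fderiv_eq, h2.fderiv, ContinuousLinearMap.comp_apply, A.fderiv_trans_apply hsplit hjk]

theorem t_self {j : ι} {z : Fin n → ℂ} (hz : z ∈ Metric.ball 0 A.rOut) : A.t j j z = 1 := by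
  have hz' := A.mem_dom_self le_rfl (j := j) hz
  refine Matrix.ext_of_mulVec_single fun b => ?_
  have h3 : A.Trans j j =ᶠ[𝓝 (z, 0)] id := by
    filter_upwards [(A.isOpen_transDom j j).mem_nhds (A.mk_mem_transDom hz')] with x hx
    exact (A.chart j).right_inv hx.1
  rw [A.t_mulVec hz', h3.fderiv_eq, fderiv_id, Matrix.one_mulVec]
  rfl

/-- Compactness applied to the increasing family of polydiscs of radius `rIn - rIn / (m + 2)`. The
gap below `rIn` is the room for the mean value inequality, and the gap below `rOut` the room for
Cauchy estimates. -/
theorem exists_rad (hC : IsCompact C) : ∃ r, 0 < r ∧ r < A.rIn ∧ ∀ p ∈ C, ∃ i, p ∈ A.U r i := by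
  let V : ℕ → Set M := fun m => ⋃ i, (A.chart i).source ∩ A.chart i ⁻¹'
    (Prod.fst ⁻¹' Metric.ball (0 : Fin n → ℂ) (A.rIn - A.rIn / (m + 2)))
  have hV : ∀ m, IsOpen (V m) := fun m => isOpen_iUnion fun i =>
    (A.chart i).isOpen_inter_preimage (Metric.isOpen_ball.preimage continuous_fst)
  have hpos := A.rIn_pos
  have hmono : Monotone V := fun a b hab => by
    refine Set.iUnion_mono fun i => Set.inter_subset_inter_right _ (Set.preimage_mono
      (Set.preimage_mono (Metric.ball_subset_ball ?_)))
    gcongr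
  have hcov : C ⊆ ⋃ m, V m := fun p hp => by
    obtain ⟨i, h1, h2⟩ := A.covers p hp
    rw [mem_ball_zero_iff] at h2
    have ht : Tendsto (fun m : ℕ => A.rIn - A.rIn / (m + 2)) atTop (𝓝 (A.rIn - 0)) := by
      refine tendsto_const_nhds.sub (tendsto_const_nhds.div_atTop ?_)
      exact tendsto_atTop_add_const_right _ _ tendsto_natCast_atTop_atTop
    rw [sub_zero] at ht
    obtain ⟨m, hm⟩ := (ht.eventually (lt_mem_nhds h2)).exists
    refine Set.mem_iUnion.2 ⟨m, Set.mem_iUnion.2 ⟨i, h1, ?_⟩⟩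
    simpa using hm
  obtain ⟨m, hm⟩ := hC.elim_directed_cover V hV hcov hmono.directed_le
  have h2 : A.rIn / (m + 2) < A.rIn := div_lt_self hpos (by linarith [(Nat.cast_nonneg m : (0:ℝ) ≤ m)])
  refine ⟨A.rIn - A.rIn / (m + 2), by linarith, by linarith [div_pos hpos (by positivity : (0:ℝ) < m + 2)],
    fun (p : M) (hp : p ∈ C) => ?_⟩
  have h5 : p ∈ V m := hm hp
  obtain ⟨i, h3, h4⟩ := Set.mem_iUnion.1 h5
  exact ⟨i, h3, hp, h4⟩

/-- The transition functions are holomorphic and bounded on balls of uniform radius. -/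
theorem exists_trans_bound [T2Space M] (k j : ι) : ∃ δ > 0, ∃ B, ∀ z ∈ A.dom A.rOut k j,
    DifferentiableOn ℂ (A.Trans k j) (Metric.ball (z, 0) δ) ∧
      ∀ x ∈ Metric.ball ((z, 0) : Model n d) δ, ‖A.Trans k j x‖ ≤ B := by
  have hP : IsCompact (A.pt k '' Metric.closedBall 0 A.rOut) :=
    (isCompact_closedBall _ _).image_of_continuousOn (A.continuousOn_pt k)
  -- A closed version of the overlap. In a Hausdorff space the image of the closed polydisc is
  -- closed, so `S` is compact; a whole neighborhood of it lies in the domain of `Φ_{kj}`, which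
  -- gives constants valid up to the edge of the overlap.
  let S : Set (Fin n → ℂ) := Metric.closedBall 0 A.rOut ∩ A.pt j ⁻¹' (A.pt k '' Metric.closedBall 0 A.rOut)
  have hS : IsCompact S := (isCompact_closedBall _ _).of_isClosed_subset
    ((A.continuousOn_pt j).preimage_isClosed_of_isClosed Metric.isClosed_closedBall hP.isClosed)
    Set.inter_subset_left
  have hS' : IsCompact ((fun z : Fin n → ℂ => ((z, 0) : Model n d)) '' S) := hS.image (by fun_prop)
  have hsub : (fun z : Fin n → ℂ => ((z, 0) : Model n d)) '' S ⊆ A.transDom k j := by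
    rintro _ ⟨z, ⟨h1, z', h2, h3⟩, rfl⟩
    refine ⟨A.mk_mem_target h1, ?_⟩
    change A.pt j z ∈ (A.chart k).source
    rw [← h3]; exact A.pt_mem_source h2
  obtain ⟨δ, hδ, hδsub⟩ := hS'.exists_cthickening_subset_open (A.isOpen_transDom k j) hsub
  have hcomp : IsCompact (Metric.cthickening δ ((fun z : Fin n → ℂ => ((z, 0) : Model n d)) '' S)) :=
    hS'.cthickening
  obtain ⟨B, hB⟩ := hcomp.exists_bound_of_continuousOn (f := A.Trans k j) fun x hx =>
    (A.analyticAt_trans (hδsub hx)).continuousAt.continuousWithinAt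
  refine ⟨δ, hδ, B, fun z hz => ?_⟩
  have hzS : z ∈ S := by
    refine ⟨A.ball_subset_closedBall le_rfl hz.1, A.transC k j z, ?_, A.pt_transC hz⟩
    exact Metric.ball_subset_closedBall (A.transC_mem_ball le_rfl hz)
  have hball : Metric.ball ((z, 0) : Model n d) δ ⊆
      Metric.cthickening δ ((fun z : Fin n → ℂ => ((z, 0) : Model n d)) '' S) := fun x hx =>
    Metric.mem_cthickening_of_dist_le x (z, 0) δ _ ⟨z, hzS, rfl⟩ (Metric.mem_ball.1 hx).le
  exact ⟨fun x hx => (A.analyticAt_trans (hδsub (hball hx))).differentiableAt.differentiableWithinAt,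
    fun x hx => hB x (hball hx)⟩

end AdaptedAtlas

end VertLin

end

/-! ### The defect of a truncated vertical change of coordinates. -/

noncomputable section

namespace VertLin

open MvPolynomial Finset Filter Asymptotics

section Aux

theorem isBigO_sub_of_analyticAt {E F X : Type*} [NormedAddCommGroup E] [NormedSpace ℂ E]
    [NormedAddCommGroup F] [NormedSpace ℂ F] [CompleteSpace F] {g : E → F} {c : E}
    (hg : AnalyticAt ℂ g c) {l : Filter X} {p q : X → E} (hp : Tendsto p l (𝓝 c))
    (hq : Tendsto q l (𝓝 c)) : (fun s => g (p s) - g (q s)) =O[l] fun s => p s - q s :=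
  hg.hasStrictFDerivAt.isBigO_sub.comp_tendsto (hp.prodMk_nhds hq)

theorem isLittleO_sub_of_hasStrictFDerivAt {E F X : Type*} [NormedAddCommGroup E] [NormedSpace ℂ E]
    [NormedAddCommGroup F] [NormedSpace ℂ F] {g : E → F} {g' : E →L[ℂ] F} {c : E}
    (hg : HasStrictFDerivAt g g' c) {l : Filter X} {p q : X → E} (hp : Tendsto p l (𝓝 c))
    (hq : Tendsto q l (𝓝 c)) :
    (fun s => g (p s) - g (q s) - g' (p s - q s)) =o[l] fun s => p s - q s :=
  hg.isLittleO.comp_tendsto (hp.prodMk_nhds hq)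

variable {d : ℕ} {X : Type*} {l : Filter X}

theorem isBigO_mulVec (T : Matrix (Fin d) (Fin d) ℂ) (w : X → Fin d → ℂ) :
    (fun s => T.mulVec (w s)) =O[l] w :=
  (LinearMap.toContinuousLinearMap T.mulVecLin).isBigO_comp w l

theorem tendsto_mulVec (T : Matrix (Fin d) (Fin d) ℂ) {w : X → Fin d → ℂ} (hw : Tendsto w l (𝓝 0)) :
    Tendsto (fun s => T.mulVec (w s)) l (𝓝 0) := by
  have := ((LinearMap.toContinuousLinearMap T.mulVecLin).continuous.tendsto 0).comp hw
  rw [map_zero] at this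
  exact this

end Aux

namespace AdaptedAtlas

variable {n d : ℕ} {M : Type*} [TopologicalSpace M] [ChartedSpace (Model n d) M]
  [IsManifold 𝓘(ℂ, Model n d) ω M] {C : Set M} {ι : Type*} (A : AdaptedAtlas n d M C ι)

/-- The vertical component `v + ∑_{2 ≤ q ≤ N} f_q(z, v)` of a truncated vertical change of coordinates. -/
def vmap (f : ℕ → (Fin n → ℂ) → Poly d) (N : ℕ) (x : Model n d) : Fin d → ℂ :=
  x.2 + ∑ q ∈ Icc 2 N, ev (f q x.1) x.2

/-- The deviation of the transition function from being vertically linear in the coordinates defined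
by `f`, truncated at degree `N`. -/
def rem (f : ι → ℕ → (Fin n → ℂ) → Poly d) (N : ℕ) (k j : ι) (x : Model n d) : Fin d → ℂ :=
  (A.Trans k j (x.1, vmap (f j) N x)).2 -
    vmap (f k) N ((A.Trans k j (x.1, vmap (f j) N x)).1, (A.t k j x.1).mulVec x.2)

section

variable {r : ℝ} {f : ℕ → (Fin n → ℂ) → Poly d} {N : ℕ}

theorem analyticAt_vmap (hf : ∀ q ∈ Icc 2 N, HolPoly q (Metric.ball 0 r) (f q)) {x : Model n d}
    (hx : x.1 ∈ Metric.ball (0 : Fin n → ℂ) r) : AnalyticAt ℂ (vmap f N) x := by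
  refine analyticAt_snd.fun_add (Finset.analyticAt_fun_sum _ fun q hq => ?_)
  exact (hf q hq).analyticAt_ev Metric.isOpen_ball hx

theorem vmap_zero (hf : ∀ q ∈ Icc 2 N, HolPoly q (Metric.ball 0 r) (f q)) {z : Fin n → ℂ}
    (hz : z ∈ Metric.ball (0 : Fin n → ℂ) r) : vmap f N (z, 0) = 0 := by
  simp only [vmap, zero_add]
  refine sum_eq_zero fun q hq => ?_
  have := norm_ev_le (fun l => (hf q hq l).1 z hz) 0
  rw [mem_Icc] at hq
  rw [norm_zero, mul_zero, zero_pow (by omega), mul_zero] at this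
  exact norm_le_zero_iff.1 this

theorem isBigO_vmap_sub (hf : ∀ q ∈ Icc 2 N, HolPoly q (Metric.ball 0 r) (f q)) {z : Fin n → ℂ}
    (hz : z ∈ Metric.ball (0 : Fin n → ℂ) r) {X : Type*} {l : Filter X} {a : X → Fin n → ℂ}
    {w : X → Fin d → ℂ} (ha : Tendsto a l (𝓝 z)) (hw : Tendsto w l (𝓝 0)) :
    (fun s => vmap f N (a s, w s) - w s) =O[l] fun s => ‖w s‖ ^ 2 := by
  simp only [vmap, add_sub_cancel_left]
  refine IsBigO.fun_sum fun q hq => ?_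
  exact ((hf q hq).isBigO_ev Metric.isOpen_ball hz ha w).trans
    (isBigO_pow_norm hw (mem_Icc.1 hq).1)

theorem hasStrictFDerivAt_vmap (hf : ∀ q ∈ Icc 2 N, HolPoly q (Metric.ball 0 r) (f q)) {z : Fin n → ℂ}
    (hz : z ∈ Metric.ball (0 : Fin n → ℂ) r) :
    HasStrictFDerivAt (vmap f N) (ContinuousLinearMap.snd ℂ (Fin n → ℂ) (Fin d → ℂ)) (z, 0) := by
  have hfst : Tendsto (fun x : Model n d => x.1) (𝓝 (z, 0)) (𝓝 z) := continuous_fst.tendsto' _ _ rfl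
  have hsnd : Tendsto (fun x : Model n d => x.2) (𝓝 (z, 0)) (𝓝 0) := continuous_snd.tendsto' _ _ rfl
  have h1 : HasFDerivAt (vmap f N) (ContinuousLinearMap.snd ℂ (Fin n → ℂ) (Fin d → ℂ)) (z, 0) := by
    refine HasFDerivAt.of_isLittleO ?_
    have h2 := (isBigO_vmap_sub hf hz hfst hsnd).trans_isLittleO
      (isLittleO_pow_norm hsnd (by norm_num : 1 < 2))
    simp only [pow_one] at h2
    have h3 : (fun x : Model n d => x.2) =O[𝓝 (z, 0)] fun x => x - (z, 0) :=
      IsBigO.of_bound 1 (Eventually.of_forall fun x => by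
        rw [one_mul]
        have := norm_snd_le (x - ((z, 0) : Model n d))
        simpa only [Prod.snd_sub, sub_zero] using this)
    refine (h2.norm_right.congr_left fun x => ?_).trans_isBigO (h3.norm_left.norm_left)
    rw [vmap_zero hf hz]
    simp
  have h4 := (analyticAt_vmap hf (x := (z, 0)) hz).hasStrictFDerivAt
  rwa [h1.fderiv] at h4

theorem isLittleO_vmap_sub_vmap (hf : ∀ q ∈ Icc 2 N, HolPoly q (Metric.ball 0 r) (f q)) {z : Fin n → ℂ}
    (hz : z ∈ Metric.ball (0 : Fin n → ℂ) r) {X : Type*} {l : Filter X} {a : X → Fin n → ℂ}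
    {w w' : X → Fin d → ℂ} (ha : Tendsto a l (𝓝 z)) (hw : Tendsto w l (𝓝 0)) (hw' : Tendsto w' l (𝓝 0)) :
    (fun s => vmap f N (a s, w s) - vmap f N (a s, w' s) - (w s - w' s)) =o[l] fun s => w s - w' s := by
  have := isLittleO_sub_of_hasStrictFDerivAt (hasStrictFDerivAt_vmap hf hz) (ha.prodMk_nhds hw)
    (ha.prodMk_nhds hw')
  refine this.trans_isBigO (IsBigO.of_bound 1 (Eventually.of_forall fun s => ?_))
  simp [Prod.norm_def]

theorem isBigO_vmap_sub_fst (hf : ∀ q ∈ Icc 2 N, HolPoly q (Metric.ball 0 r) (f q)) {z : Fin n → ℂ}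
    (hz : z ∈ Metric.ball (0 : Fin n → ℂ) r) {X : Type*} {l : Filter X} {a a' : X → Fin n → ℂ}
    {w : X → Fin d → ℂ} (ha : Tendsto a l (𝓝 z)) (ha' : Tendsto a' l (𝓝 z)) (hw : Tendsto w l (𝓝 0)) :
    (fun s => vmap f N (a s, w s) - vmap f N (a' s, w s)) =O[l] fun s => a s - a' s := by
  refine (isBigO_sub_of_analyticAt (analyticAt_vmap hf (x := (z, 0)) hz) (ha.prodMk_nhds hw)
    (ha'.prodMk_nhds hw)).trans (IsBigO.of_bound 1 (Eventually.of_forall fun s => ?_))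
  simp [Prod.norm_def]

theorem tendsto_vmap (hf : ∀ q ∈ Icc 2 N, HolPoly q (Metric.ball 0 r) (f q)) {z : Fin n → ℂ}
    (hz : z ∈ Metric.ball (0 : Fin n → ℂ) r) {X : Type*} {l : Filter X} {a : X → Fin n → ℂ}
    {w : X → Fin d → ℂ} (ha : Tendsto a l (𝓝 z)) (hw : Tendsto w l (𝓝 0)) :
    Tendsto (fun s => vmap f N (a s, w s)) l (𝓝 0) := by
  have := (analyticAt_vmap hf (x := (z, 0)) hz).continuousAt.tendsto.comp (ha.prodMk_nhds hw)
  rwa [vmap_zero hf hz] at this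

end

section

variable {f : ι → ℕ → (Fin n → ℂ) → Poly d} {N : ℕ} {k j : ι} {z : Fin n → ℂ}

theorem tendsto_trans (hz : z ∈ A.dom A.rOut k j) {X : Type*} {l : Filter X} {a : X → Fin n → ℂ}
    {b : X → Fin d → ℂ} (ha : Tendsto a l (𝓝 z)) (hb : Tendsto b l (𝓝 0)) :
    Tendsto (fun s => A.Trans k j (a s, b s)) l (𝓝 (A.transC k j z, 0)) := by
  have := (A.analyticAt_trans_mk hz).continuousAt.tendsto.comp (ha.prodMk_nhds hb)
  rwa [A.trans_zero hz] at this

theorem tendsto_trans_fst (hz : z ∈ A.dom A.rOut k j) {X : Type*} {l : Filter X} {a : X → Fin n → ℂ}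
    {b : X → Fin d → ℂ} (ha : Tendsto a l (𝓝 z)) (hb : Tendsto b l (𝓝 0)) :
    Tendsto (fun s => (A.Trans k j (a s, b s)).1) l (𝓝 (A.transC k j z)) :=
  (continuous_fst.tendsto (A.transC k j z, (0 : Fin d → ℂ))).comp (A.tendsto_trans hz ha hb)

theorem tendsto_trans_snd (hz : z ∈ A.dom A.rOut k j) {X : Type*} {l : Filter X} {a : X → Fin n → ℂ}
    {b : X → Fin d → ℂ} (ha : Tendsto a l (𝓝 z)) (hb : Tendsto b l (𝓝 0)) :
    Tendsto (fun s => (A.Trans k j (a s, b s)).2) l (𝓝 0) :=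
  (continuous_snd.tendsto (A.transC k j z, (0 : Fin d → ℂ))).comp (A.tendsto_trans hz ha hb)

theorem analyticAt_rem (hunitary : A.IsUnitary)
    (hf : ∀ j, ∀ q ∈ Icc 2 N, HolPoly q (Metric.ball 0 A.rOut) (f j q))
    (hz : z ∈ A.dom A.rOut k j) : AnalyticAt ℂ (A.rem f N k j) (z, 0) := by
  have h1 : AnalyticAt ℂ (fun x : Model n d => (x.1, vmap (f j) N x)) (z, 0) :=
    analyticAt_fst.prod (analyticAt_vmap (hf j) (x := (z, 0)) hz.1)
  have h3 : AnalyticAt ℂ (fun x : Model n d => A.Trans k j (x.1, vmap (f j) N x)) (z, 0) := by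
    refine AnalyticAt.fun_comp (g := A.Trans k j) ?_ h1
    rw [vmap_zero (hf j) hz.1]
    exact A.analyticAt_trans_mk hz
  have h4 : AnalyticAt ℂ (fun x : Model n d =>
      (((A.Trans k j (x.1, vmap (f j) N x)).1, (A.t k j z).mulVec x.2) : Model n d)) (z, 0) := by
    refine (analyticAt_fst.fun_comp h3).prod ?_
    exact ((LinearMap.toContinuousLinearMap (A.t k j z).mulVecLin).comp
      (ContinuousLinearMap.snd ℂ (Fin n → ℂ) (Fin d → ℂ))).analyticAt _
  have h5 : AnalyticAt ℂ (fun x : Model n d => (A.Trans k j (x.1, vmap (f j) N x)).2 -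
      vmap (f k) N ((A.Trans k j (x.1, vmap (f j) N x)).1, (A.t k j z).mulVec x.2)) (z, 0) := by
    refine (analyticAt_snd.fun_comp h3).fun_sub (AnalyticAt.fun_comp (g := vmap (f k) N) ?_ h4)
    refine analyticAt_vmap (hf k) ?_
    simp only
    rw [vmap_zero (hf j) hz.1, A.trans_zero hz]
    exact A.transC_mem_ball le_rfl hz
  refine h5.congr ?_
  have hfst : Tendsto (fun x : Model n d => x.1) (𝓝 (z, 0)) (𝓝 z) := continuous_fst.tendsto' _ _ rfl
  filter_upwards [hfst.eventually (A.eventually_t_eq hunitary hz)] with x hx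
  rw [rem, hx]

/-- Transport of an approximate identity through a transition function. -/
theorem isLittleO_trans_sub (hunitary : A.IsUnitary)
    (hf : ∀ j, ∀ q ∈ Icc 2 N, HolPoly q (Metric.ball 0 A.rOut) (f j q))
    (hz : z ∈ A.dom A.rOut k j) {X : Type*} {l : Filter X} {a : X → Fin n → ℂ} {b w : X → Fin d → ℂ}
    {g : X → ℝ} (ha : Tendsto a l (𝓝 z)) (hb : Tendsto b l (𝓝 0)) (hw : Tendsto w l (𝓝 0))
    (h : (fun s => vmap (f j) N (a s, w s) - b s) =o[l] g) :
    (fun s => (A.Trans k j (a s, b s)).2 -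
      vmap (f k) N ((A.Trans k j (a s, b s)).1, (A.t k j z).mulVec (w s)) -
      A.rem f N k j (a s, w s)) =o[l] g := by
  have hY := tendsto_vmap (hf j) hz.1 ha hw
  -- The transition function and `vmap` are Lipschitz near the points concerned, so replacing `b` by
  -- the value of `vmap` changes every term by `o(g)`.
  have h1 : (fun s => A.Trans k j (a s, b s) - A.Trans k j (a s, vmap (f j) N (a s, w s))) =o[l] g := by
    refine (isBigO_sub_of_analyticAt (A.analyticAt_trans_mk hz) (ha.prodMk_nhds hb)
      (ha.prodMk_nhds hY)).trans_isLittleO ?_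
    refine IsBigO.trans_isLittleO (IsBigO.of_bound 1 (Eventually.of_forall fun s => ?_)) h
    simp [Prod.norm_def, norm_sub_rev]
  have hw' := tendsto_mulVec (A.t k j z) hw
  have h1' : (fun s => (A.Trans k j (a s, b s)).1 -
      (A.Trans k j (a s, vmap (f j) N (a s, w s))).1) =o[l] g :=
    (isBigO_fst_prod'.trans_isLittleO h1).congr_left fun s => by simp only [Prod.fst_sub]
  have h2 := (isBigO_vmap_sub_fst (hf k) (A.transC_mem_ball le_rfl hz)
    (A.tendsto_trans_fst hz ha hb) (A.tendsto_trans_fst hz ha hY) hw').trans_isLittleO h1'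
  have h3 := isBigO_snd_prod'.trans_isLittleO h1
  refine (h3.sub h2).congr' ?_ EventuallyEq.rfl
  filter_upwards [ha.eventually (A.eventually_t_eq hunitary hz)] with s hs
  simp only [rem, hs, Prod.snd_sub]
  abel

/-- The effect of adding a term of degree `N + 1`. -/
theorem isLittleO_rem_succ (hsplit : A.IsSplit) (hunitary : A.IsUnitary) (hN : 1 ≤ N)
    (hf : ∀ j, ∀ q ∈ Icc 2 (N + 1), HolPoly q (Metric.ball 0 A.rOut) (f j q))
    (hz : z ∈ A.dom A.rOut k j) :
    (fun x : Model n d => A.rem f (N + 1) k j x - A.rem f N k j x -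
      ev (A.delta (fun j => f j (N + 1)) k j z) x.2) =o[𝓝 (z, 0)] fun x => ‖x.2‖ ^ (N + 1) := by
  have hfst : Tendsto (fun x : Model n d => x.1) (𝓝 (z, 0)) (𝓝 z) := continuous_fst.tendsto' _ _ rfl
  have hsnd : Tendsto (fun x : Model n d => x.2) (𝓝 (z, 0)) (𝓝 0) := continuous_snd.tendsto' _ _ rfl
  have hf' : ∀ j, ∀ q ∈ Icc 2 N, HolPoly q (Metric.ball 0 A.rOut) (f j q) := fun j q hq =>
    hf j q (by rw [mem_Icc] at hq ⊢; omega)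
  have hmem : N + 1 ∈ Icc 2 (N + 1) := by rw [mem_Icc]; omega
  have hzk := A.transC_mem_ball le_rfl hz
  have hY := tendsto_vmap (hf' j) hz.1 hfst hsnd
  have hY' := tendsto_vmap (hf j) hz.1 hfst hsnd
  have hYs : ∀ (j : ι) (x : Model n d), vmap (f j) (N + 1) x =
      vmap (f j) N x + ev (f j (N + 1) x.1) x.2 := fun j x => by
    rw [vmap, vmap, sum_Icc_succ_top (by omega), add_assoc]
  have hδ := (hf j _ hmem).isBigO_ev Metric.isOpen_ball hz.1 hfst fun x : Model n d => x.2
  have hst := (A.analyticAt_trans_mk hz).hasStrictFDerivAt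
  have h1 := isLittleO_sub_of_hasStrictFDerivAt hst (hfst.prodMk_nhds hY') (hfst.prodMk_nhds hY)
  -- The splitting enters here: the derivative sends the vertical increment to a vertical vector, so
  -- the horizontal component moves only by `o(‖v‖^(N+1))`.
  have h1' : (fun x : Model n d => A.Trans k j (x.1, vmap (f j) (N + 1) x) -
      A.Trans k j (x.1, vmap (f j) N x) - (0, (A.t k j z).mulVec (ev (f j (N + 1) x.1) x.2)))
      =o[𝓝 (z, 0)] fun x => ‖x.2‖ ^ (N + 1) := by
    refine (h1.congr_left fun x => ?_).trans_isBigO (IsBigO.trans (IsBigO.of_bound 1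
      (Eventually.of_forall fun x => ?_)) hδ)
    · have : ((x.1, vmap (f j) (N + 1) (x.1, x.2)) - (x.1, vmap (f j) N (x.1, x.2)) : Model n d) =
          (0, ev (f j (N + 1) x.1) x.2) := by
        rw [hYs]; simp
      rw [this, A.fderiv_trans_apply hsplit hz]
    · rw [hYs]; simp [Prod.norm_def]
  have hT : Tendsto (fun x : Model n d => (A.Trans k j (x.1, vmap (f j) N x)).1) (𝓝 (z, 0))
      (𝓝 (A.transC k j z)) := A.tendsto_trans_fst hz hfst hY
  have hT' : Tendsto (fun x : Model n d => (A.Trans k j (x.1, vmap (f j) (N + 1) x)).1) (𝓝 (z, 0))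
      (𝓝 (A.transC k j z)) := A.tendsto_trans_fst hz hfst hY'
  have hw' := tendsto_mulVec (A.t k j z) hsnd
  have h2 : (fun x : Model n d => (A.Trans k j (x.1, vmap (f j) (N + 1) x)).1 -
      (A.Trans k j (x.1, vmap (f j) N x)).1) =o[𝓝 (z, 0)] fun x => ‖x.2‖ ^ (N + 1) :=
    (isBigO_fst_prod'.trans_isLittleO h1').congr_left fun x => by
      simp only [Prod.fst_sub, sub_zero]
  have h3 : (fun x : Model n d => (A.Trans k j (x.1, vmap (f j) (N + 1) x)).2 -
      (A.Trans k j (x.1, vmap (f j) N x)).2 - (A.t k j z).mulVec (ev (f j (N + 1) x.1) x.2))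
      =o[𝓝 (z, 0)] fun x => ‖x.2‖ ^ (N + 1) :=
    (isBigO_snd_prod'.trans_isLittleO h1').congr_left fun x => by
      simp only [Prod.snd_sub]
  have h4 := (isBigO_vmap_sub_fst (hf' k) hzk hT' hT hw').trans_isLittleO h2
  -- The base points of the two new terms are frozen at `z` and at its image, which turns their
  -- contributions into the coboundary at `z`.
  have h5 := (hf j _ hmem).isLittleO_ev_sub Metric.isOpen_ball hz.1 hfst fun x : Model n d => x.2
  have h6 : (fun x : Model n d => (A.t k j z).mulVec (ev (f j (N + 1) x.1) x.2 - ev (f j (N + 1) z) x.2))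
      =o[𝓝 (z, 0)] fun x => ‖x.2‖ ^ (N + 1) := (isBigO_mulVec _ _).trans_isLittleO h5
  have h7 := ((hf k _ hmem).isLittleO_ev_sub Metric.isOpen_ball hzk
    hT' fun x : Model n d => (A.t k j z).mulVec x.2).trans_isBigO
      (((isBigO_mulVec (A.t k j z) fun x : Model n d => x.2).norm_left.norm_right).pow (N + 1))
  refine (((h3.sub h4).add h6).sub h7).congr' ?_ EventuallyEq.rfl
  filter_upwards [hfst.eventually (A.eventually_t_eq hunitary hz)] with x hx
  simp only [rem, hx, hYs k, delta, ev_sub, ev_act, ev_subst, Matrix.mulVec_sub]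
  abel

end

end AdaptedAtlas

end VertLin

end

/-! ### The obstruction cocycle and the solution order by order. -/

noncomputable section

namespace VertLin

open MvPolynomial Finset Filter Asymptotics

namespace AdaptedAtlas

variable {n d : ℕ} {M : Type*} [TopologicalSpace M] [ChartedSpace (Model n d) M]
  [IsManifold 𝓘(ℂ, Model n d) ω M] {C : Set M} {ι : Type*} (A : AdaptedAtlas n d M C ι)

/-- The changes of coordinates defined by `f` linearize the transition functions vertically up to
order `N`. -/
def Solves (f : ι → ℕ → (Fin n → ℂ) → Poly d) (N : ℕ) : Prop :=
  ∀ k j, ∀ z ∈ A.dom A.rOut k j, A.rem f N k j =o[𝓝 (z, 0)] fun x => ‖x.2‖ ^ N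

/-- The obstruction to linearizing up to order `N + 1`. -/
def obstr (f : ι → ℕ → (Fin n → ℂ) → Poly d) (N : ℕ) (k j : ι) (z : Fin n → ℂ) : Poly d :=
  -vTay (N + 1) (A.rem f N k j) z

variable {f : ι → ℕ → (Fin n → ℂ) → Poly d} {N : ℕ}

theorem vmap_congr {f f' : ℕ → (Fin n → ℂ) → Poly d} (h : ∀ q ≤ N, f q = f' q) (x : Model n d) :
    vmap f N x = vmap f' N x := by
  simp only [vmap]
  congr 1
  exact sum_congr rfl fun q hq => by rw [h q (mem_Icc.1 hq).2]

theorem rem_congr {f' : ι → ℕ → (Fin n → ℂ) → Poly d} (h : ∀ j, ∀ q ≤ N, f j q = f' j q) (k j : ι) :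
    A.rem f N k j = A.rem f' N k j := by
  funext x
  simp only [rem, vmap_congr (h _)]

theorem tendsto_mk (z : Fin n → ℂ) :
    Tendsto (fun v : Fin d → ℂ => ((z, v) : Model n d)) (𝓝 0) (𝓝 (z, 0)) :=
  (by fun_prop : Continuous fun v : Fin d → ℂ => ((z, v) : Model n d)).tendsto' _ _ rfl

/-- For `N = 1` the sum in `vmap` is empty, and the defect is the first order remainder of the
normal component of `Φ_{kj}` along `C`. Strict differentiability controls it uniformly in the base
point. -/
theorem solves_one (hunitary : A.IsUnitary) : A.Solves f 1 := by
  intro k j z hz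
  have hfst : Tendsto (fun x : Model n d => x.1) (𝓝 (z, 0)) (𝓝 z) := continuous_fst.tendsto' _ _ rfl
  have hsnd : Tendsto (fun x : Model n d => x.2) (𝓝 (z, 0)) (𝓝 0) := continuous_snd.tendsto' _ _ rfl
  have h1 := isLittleO_sub_of_hasStrictFDerivAt (A.analyticAt_trans_mk hz).hasStrictFDerivAt
    (hfst.prodMk_nhds hsnd) (hfst.prodMk_nhds (tendsto_const_nhds (x := (0 : Fin d → ℂ))))
  have h2 : (fun x : Model n d => ((x.1, x.2) - (x.1, 0) : Model n d)) =O[𝓝 (z, 0)]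
      fun x => ‖x.2‖ ^ 1 := IsBigO.of_bound 1 (Eventually.of_forall fun x => by
    simp [Prod.norm_def])
  refine (isBigO_snd_prod'.trans_isLittleO (h1.trans_isBigO h2)).congr' ?_ EventuallyEq.rfl
  filter_upwards [hfst.eventually (A.eventually_t_eq hunitary hz),
    hfst.eventually ((A.isOpen_dom le_rfl k j).mem_nhds hz)] with x hx hx'
  have h3 : ((x.1, x.2) - (x.1, 0) : Model n d) = (0, x.2) := by
    rw [Prod.mk_sub_mk, sub_self, sub_zero]
  simp only [rem, vmap, hx, h3, Prod.snd_sub, ← A.t_mulVec hz]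
  rw [A.trans_zero hx']
  simp

theorem Solves.isLittleO_fibre (h : A.Solves f N) {k j : ι} {z : Fin n → ℂ} (hz : z ∈ A.dom A.rOut k j) :
    (fun v => A.rem f N k j (z, v)) =o[𝓝 0] fun v : Fin d → ℂ => ‖v‖ ^ N :=
  (h k j z hz).comp_tendsto (tendsto_mk z)

theorem isLittleO_rem_add_obstr (hunitary : A.IsUnitary)
    (hf : ∀ j q, HolPoly q (Metric.ball 0 A.rOut) (f j q)) (h : A.Solves f N) {k j : ι} {z : Fin n → ℂ}
    (hz : z ∈ A.dom A.rOut k j) :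
    (fun x => A.rem f N k j x + ev (A.obstr f N k j z) x.2) =o[𝓝 (z, 0)] fun x => ‖x.2‖ ^ (N + 1) := by
  have := isLittleO_sub_ev_vTay (A.isOpen_dom le_rfl k j)
    (fun z hz => A.analyticAt_rem hunitary (fun j q _ => hf j q) hz) (fun z hz => h.isLittleO_fibre A hz) hz
  refine this.congr_left fun x => ?_
  rw [obstr, ev_neg, sub_eq_add_neg]

theorem holPoly_obstr (hunitary : A.IsUnitary)
    (hf : ∀ j q, HolPoly q (Metric.ball 0 A.rOut) (f j q)) (k j : ι) :
    HolPoly (N + 1) (A.dom A.rOut k j) (A.obstr f N k j) := by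
  intro l
  have := holPoly_vTay (N + 1) (Ω := A.dom A.rOut k j) (g := A.rem f N k j) fun z hz => A.analyticAt_rem hunitary (N := N) (fun j q _ => hf j q) hz
  refine ⟨fun z hz => ((this l).1 z hz).neg, fun Q => ?_⟩
  simpa [obstr] using ((this l).2 Q).neg

theorem isHomogeneous_act {m : ℕ} {P : Poly d} (hP : ∀ l, (P l).IsHomogeneous m)
    (T : Matrix (Fin d) (Fin d) ℂ) (l : Fin d) : (act T P l).IsHomogeneous m :=
  IsHomogeneous.sum _ _ _ fun μ _ => by
    simpa using (isHomogeneous_C (Fin d) (T l μ)).mul (hP μ)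

theorem solves_succ (hsplit : A.IsSplit) (hunitary : A.IsUnitary) (hN : 1 ≤ N)
    (hf : ∀ j q, HolPoly q (Metric.ball 0 A.rOut) (f j q)) (h : A.Solves f N)
    (hu : ∀ k j, ∀ z ∈ A.dom A.rOut k j, A.delta (fun j => f j (N + 1)) k j z = A.obstr f N k j z) :
    A.Solves f (N + 1) := by
  intro k j z hz
  have h1 := A.isLittleO_rem_add_obstr hunitary hf h hz
  have h2 := A.isLittleO_rem_succ hsplit hunitary hN (fun j q _ => hf j q) hz
  refine (h1.add h2).congr_left fun x => ?_
  rw [hu k j z hz]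
  abel

/-- `Φ_{ik} = Φ_{ij} Φ_{jk}` is evaluated at the image of `(z, v)` under the change of coordinates
of index `k`. The defect of `Φ_{jk}` is absorbed into the argument `T v + rem_{jk}` of `vmap (f j)`,
after which `Φ_{ij}` produces `rem_{ij} + S rem_{jk}` modulo `o(‖v‖^(N+1))`. Equating this with
`rem_{ik}` and taking leading terms gives the cocycle relation. -/
theorem isCocycle_obstr (hsplit : A.IsSplit) (hunitary : A.IsUnitary) (hN : 1 ≤ N)
    (hf : ∀ j q, HolPoly q (Metric.ball 0 A.rOut) (f j q)) (h : A.Solves f N) :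
    A.IsCocycle A.rOut (A.obstr f N) := by
  rintro i j k z ⟨hik, hjk⟩
  have hf' : ∀ j, ∀ q ∈ Icc 2 N, HolPoly q (Metric.ball 0 A.rOut) (f j q) := fun j q _ => hf j q
  have hij := A.transC_mem_dom le_rfl hik hjk
  have hid : Tendsto (fun v : Fin d → ℂ => v) (𝓝 0) (𝓝 0) := tendsto_id
  have hz : Tendsto (fun _ : Fin d → ℂ => z) (𝓝 0) (𝓝 z) := tendsto_const_nhds
  have hy := tendsto_vmap (hf' k) hik.1 hz hid
  have ha := A.tendsto_trans_fst hjk hz hy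
  have hb := A.tendsto_trans_snd hjk hz hy
  have hrem : (fun v => A.rem f N j k (z, v) + ev (A.obstr f N j k z) v) =o[𝓝 0]
      fun v : Fin d → ℂ => ‖v‖ ^ (N + 1) :=
    (A.isLittleO_rem_add_obstr hunitary hf h hjk).comp_tendsto (tendsto_mk z)
  have hremO : (fun v => A.rem f N j k (z, v)) =O[𝓝 0] fun v : Fin d → ℂ => ‖v‖ ^ (N + 1) :=
    (hrem.isBigO.sub (isBigO_ev (fun l => (A.holPoly_obstr hunitary hf j k l).1 z hjk) _)).congr_left
      fun v => add_sub_cancel_right _ _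
  have hremo : (fun v => A.rem f N j k (z, v)) =o[𝓝 0] fun v : Fin d → ℂ => ‖v‖ := by
    have := hremO.trans_isLittleO (isLittleO_pow_norm hid (by omega : 1 < N + 1))
    simpa only [pow_one] using this
  have hremt : Tendsto (fun v => A.rem f N j k (z, v)) (𝓝 0) (𝓝 0) :=
    hremO.trans_tendsto (by simpa using hid.norm.pow (N + 1))
  have htv := tendsto_mulVec (A.t j k z) hid
  have hw : Tendsto (fun v => (A.t j k z).mulVec v + A.rem f N j k (z, v)) (𝓝 0) (𝓝 0) := by
    simpa using htv.add hremt
  set T := A.t j k z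
  set S := A.t i j (A.transC j k z)
  set a : (Fin d → ℂ) → Fin n → ℂ := fun v => (A.Trans j k (z, vmap (f k) N (z, v))).1
  set b : (Fin d → ℂ) → Fin d → ℂ := fun v => (A.Trans j k (z, vmap (f k) N (z, v))).2
  have hzi := A.transC_mem_ball le_rfl hij
  have hzj := A.transC_mem_ball le_rfl hjk
  -- Since `vmap` is tangent to the identity, an additive error outside it may be moved into its
  -- argument.
  have h1 : (fun v => vmap (f j) N (a v, T.mulVec v + A.rem f N j k (z, v)) - b v) =o[𝓝 0]
      fun v => ‖v‖ ^ (N + 1) := by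
    have := (isLittleO_vmap_sub_vmap (hf' j) hzj ha hw htv).trans_isBigO
      ((hremO.congr_left fun v => (add_sub_cancel_left _ _).symm))
    refine this.congr_left fun v => ?_
    simp only [rem, a, b, T]
    abel
  have h2 := A.isLittleO_trans_sub hunitary hf' hij ha hb hw h1
  have ha' : Tendsto (fun v => (A.Trans i k (z, vmap (f k) N (z, v))).1) (𝓝 0) (𝓝 (A.transC i k z)) :=
    A.tendsto_trans_fst hik hz hy
  have hSw := tendsto_mulVec S hw
  have hSt := tendsto_mulVec S htv
  have hST : S * T = A.t i k z := A.t_mul_t hsplit hik hjk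
  rw [A.transC_transC hjk] at hzi
  -- For the same reason the defect, now multiplied by `S`, comes back out of `vmap (f i)`
  -- additively.
  have h3 := (isLittleO_vmap_sub_vmap (hf' i) hzi ha' hSw hSt).trans_isBigO
    (((isBigO_mulVec S _).trans hremO).congr_left fun v => by
      rw [← Matrix.mulVec_sub, add_sub_cancel_left])
  have hTv : (fun v => T.mulVec v) =O[𝓝 0] fun v => ‖v‖ := (isBigO_mulVec T fun v => v).norm_right
  have hwO : (fun v => T.mulVec v + A.rem f N j k (z, v)) =O[𝓝 0] fun v => ‖v‖ := hTv.add hremo.isBigO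
  have h4 : (fun v => A.rem f N i j (a v, T.mulVec v + A.rem f N j k (z, v)) +
      ev (A.obstr f N i j (A.transC j k z)) (T.mulVec v + A.rem f N j k (z, v))) =o[𝓝 0]
      fun v => ‖v‖ ^ (N + 1) :=
    ((A.isLittleO_rem_add_obstr hunitary hf h hij).comp_tendsto (ha.prodMk_nhds hw)).trans_isBigO
      (hwO.norm_left.pow (N + 1))
  have h5 := isLittleO_ev_sub_ev (fun l => (A.holPoly_obstr hunitary hf i j l (N := N)).1 _ hij) hwO hTv
    (hremo.congr_left fun v => (add_sub_cancel_left _ _).symm)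
  have h6 : (fun v => A.rem f N i k (z, v) + ev (A.obstr f N i k z) v) =o[𝓝 0]
      fun v : Fin d → ℂ => ‖v‖ ^ (N + 1) :=
    (A.isLittleO_rem_add_obstr hunitary hf h hik).comp_tendsto (tendsto_mk z)
  have h7 := (isBigO_mulVec S _).trans_isLittleO hrem
  refine ev_eq_zero_of_isLittleO (m := N + 1) (fun l => ?_)
    (((((h2.add h3).add h4).sub h5).sub h6).add h7 |>.congr' ?_ EventuallyEq.rfl)
  · exact ((subst_isHomogeneous ((A.holPoly_obstr hunitary hf i j l).1 _ hij) _).sub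
      ((A.holPoly_obstr hunitary hf i k l).1 _ hik)).add
      (isHomogeneous_act (fun l => (A.holPoly_obstr hunitary hf j k l).1 _ hjk) _ l)
  · have hev : ∀ᶠ v in 𝓝 0, ((z, vmap (f k) N (z, v)) : Model n d) ∈ A.transDom j k :=
      (hz.prodMk_nhds hy).eventually ((A.isOpen_transDom j k).mem_nhds (A.mk_mem_transDom hjk))
    filter_upwards [hev] with v hv
    have hT := A.trans_trans (i := i) hv
    have hab : ((a v, b v) : Model n d) = A.Trans j k (z, vmap (f k) N (z, v)) := rfl
    have hS : S.mulVec (T.mulVec v) = (A.t i k z).mulVec v := by rw [Matrix.mulVec_mulVec, hST]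
    have hSd : A.t i j (A.transC j k z) = S := rfl
    rw [hab, hT]
    simp only [ev_sub, ev_add, ev_act, ev_subst, hSd, Matrix.mulVec_add, hS]
    have hr : A.rem f N i k (z, v) = (A.Trans i k (z, vmap (f k) N (z, v))).2 -
      vmap (f i) N ((A.Trans i k (z, vmap (f k) N (z, v))).1, (A.t i k z).mulVec v) := rfl
    rw [hr]
    abel

theorem exists_delta_eq_obstr (hsplit : A.IsSplit) (hunitary : A.IsUnitary) (hN : 1 ≤ N)
    (hH1 : A.H1Vanishes (N + 1)) (hf : ∀ j q, HolPoly q (Metric.ball 0 A.rOut) (f j q))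
    (h : A.Solves f N) : ∃ u : ι → (Fin n → ℂ) → Poly d, IsCochain₀ (N + 1) A.rOut u ∧
      ∀ k j, ∀ z ∈ A.dom A.rOut k j, A.delta u k j z = A.obstr f N k j z :=
  hH1 _ (A.holPoly_obstr hunitary hf) (A.isCocycle_obstr hsplit hunitary hN hf h)

theorem exists_solution (hsplit : A.IsSplit) (hunitary : A.IsUnitary)
    (hstep : ∀ N ≥ 1, ∀ f : ι → ℕ → (Fin n → ℂ) → Poly d,
      (∀ j q, HolPoly q (Metric.ball 0 A.rOut) (f j q)) → A.Solves f N →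
      ∃ u : ι → (Fin n → ℂ) → Poly d, IsCochain₀ (N + 1) A.rOut u ∧
        ∀ k j, ∀ z ∈ A.dom A.rOut k j, A.delta u k j z = A.obstr f N k j z) :
    ∃ f : ι → ℕ → (Fin n → ℂ) → Poly d, (∀ j q, HolPoly q (Metric.ball 0 A.rOut) (f j q)) ∧
      ∀ N ≥ 1, A.Solves f N := by
  -- Stage `N` linearizes up to order `N + 1`, and the passage to stage `N + 1` alters only the
  -- coefficient of degree `N + 2`.
  let P : ℕ → (ι → ℕ → (Fin n → ℂ) → Poly d) → Prop := fun N f =>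
    (∀ j q, HolPoly q (Metric.ball 0 A.rOut) (f j q)) ∧ A.Solves f (N + 1)
  have step : ∀ N, ∀ f, P N f → ∃ f', P (N + 1) f' ∧ ∀ j q, q ≠ N + 2 → f' j q = f j q := by
    rintro N f ⟨hf, hs⟩
    obtain ⟨u, hu, hd⟩ := hstep (N + 1) (by omega) f hf hs
    let f' : ι → ℕ → (Fin n → ℂ) → Poly d := fun j => Function.update (f j) (N + 2) (u j)
    have hne : ∀ j q, q ≠ N + 2 → f' j q = f j q := fun j q hq => Function.update_of_ne hq _ _
    have heq : ∀ j, f' j (N + 2) = u j := fun j => Function.update_self _ _ _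
    have hf' : ∀ j q, HolPoly q (Metric.ball 0 A.rOut) (f' j q) := by
      intro j q
      by_cases hq : q = N + 2
      · rw [hq, heq]; exact hu j
      · rw [hne j q hq]; exact hf j q
    have hrem : ∀ k j, A.rem f' (N + 1) k j = A.rem f (N + 1) k j := fun k j =>
      A.rem_congr (fun j q hq => hne j q (by omega)) k j
    refine ⟨f', ⟨hf', A.solves_succ hsplit hunitary (by omega) hf' ?_ ?_⟩, hne⟩
    · intro k j z hz
      rw [hrem]
      exact hs k j z hz
    · intro k j z hz
      simp only [heq]
      rw [hd k j z hz, obstr, obstr, hrem]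
  choose! g hg hne using step
  let F : ℕ → ι → ℕ → (Fin n → ℂ) → Poly d := fun N => Nat.rec (fun _ _ _ => 0) g N
  have hF : ∀ N, P N (F N) := by
    intro N
    induction N with
    | zero =>
      refine ⟨fun j q l => ⟨fun z _ => isHomogeneous_zero _ _ _, fun Q => ?_⟩, A.solves_one hunitary⟩
      simp [F]
    | succ N ih => exact hg N _ ih
  -- The diagonal family `F q j q` agrees with stage `N` in all degrees up to `N + 1`, which are the
  -- only ones that the defect of order `N + 1` sees. The extreme case `q = N + 1` holds because the
  -- step from `N` to `N + 1` leaves that degree alone.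
  have hst : ∀ j q N, q ≤ N + 1 → F N j q = F q j q := by
    intro j q
    have h1 : ∀ N, q ≤ N → F N j q = F q j q := fun N hN => by
      induction N, hN using Nat.le_induction with
      | base => rfl
      | succ N hN ih => rw [← ih]; exact hne N _ (hF N) j q (by omega)
    intro N hN
    rcases Nat.lt_or_ge N q with hlt | hge
    · obtain rfl : q = N + 1 := by omega
      exact (hne N _ (hF N) j (N + 1) (by omega)).symm
    · exact h1 N hge
  refine ⟨fun j q => F q j q, fun j q => (hF q).1 j q, fun N hN k j z hz => ?_⟩
  obtain ⟨N, rfl⟩ : ∃ N', N = N' + 1 := ⟨N - 1, by omega⟩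
  rw [A.rem_congr (f' := F N) fun j q hq => (hst j q N hq).symm]
  exact (hF N).2 k j z hz

end AdaptedAtlas

end VertLin

end

/-! ### Comparison of a formal linearization with a partial solution. -/

noncomputable section

namespace VertLin

open MvPolynomial Finset Filter Asymptotics

section TruncSeries

variable {n d : ℕ} {X : Type*} [NormedAddCommGroup X] [NormedSpace ℂ X]
  {Ω : Set (Fin n → ℂ)} {f : (Fin d → ℕ) → (Fin n → ℂ) → X} {N : ℕ}

theorem analyticAt_truncSeries [CompleteSpace X] (hΩ : IsOpen Ω) (hf : ∀ Q, DifferentiableOn ℂ (f Q) Ω) {x : Model n d}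
    (hx : x.1 ∈ Ω) : AnalyticAt ℂ (truncSeries f N) x := by
  unfold truncSeries
  refine Finset.analyticAt_fun_sum _ fun m _ => Finset.analyticAt_fun_sum _ fun Q _ => ?_
  refine AnalyticAt.fun_smul (Finset.analyticAt_fun_prod _ fun i _ => AnalyticAt.fun_pow ?_ _) ?_
  · exact ((ContinuousLinearMap.proj (R := ℂ) (φ := fun _ : Fin d => ℂ) i).comp
      (ContinuousLinearMap.snd ℂ (Fin n → ℂ) (Fin d → ℂ))).analyticAt x
  · exact AnalyticAt.fun_comp (g := f Q) (analyticOnNhd_of_differentiableOn hΩ (hf Q) _ hx) analyticAt_fst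

theorem isBigO_truncSeries (hΩ : IsOpen Ω) (hf : ∀ Q, DifferentiableOn ℂ (f Q) Ω) {z : Fin n → ℂ}
    (hz : z ∈ Ω) {Y : Type*} {l : Filter Y} {a : Y → Fin n → ℂ} {w : Y → Fin d → ℂ}
    (ha : Tendsto a l (𝓝 z)) (hw : Tendsto w l (𝓝 0)) :
    (fun s => truncSeries f N (a s, w s)) =O[l] fun s => ‖w s‖ ^ 2 := by
  unfold truncSeries
  refine IsBigO.fun_sum fun m hm => IsBigO.fun_sum fun Q hQ => ?_
  have h1 : (fun s => ∏ i, w s i ^ Q i) =O[l] fun s => ‖w s‖ ^ m := by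
    refine IsBigO.of_bound 1 (Eventually.of_forall fun s => ?_)
    rw [norm_prod, one_mul, norm_pow, norm_norm, ← (mem_piAntidiag.1 hQ).1, ← prod_pow_eq_pow_sum]
    refine prod_le_prod (fun i _ => norm_nonneg _) fun i _ => ?_
    rw [norm_pow]
    exact pow_le_pow_left₀ (norm_nonneg _) (norm_le_pi_norm _ i) _
  have h2 : (fun s => f Q (a s)) =O[l] fun _ => (1 : ℝ) :=
    (((hf Q).differentiableAt (hΩ.mem_nhds hz)).continuousAt.tendsto.comp ha).isBigO_one ℝ
  have h3 := (h1.trans (isBigO_pow_norm hw (mem_Icc.1 hm).1)).smul h2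
  simpa using h3

end TruncSeries

namespace AdaptedAtlas

variable {n d : ℕ} {M : Type*} [TopologicalSpace M] [ChartedSpace (Model n d) M]
  [IsManifold 𝓘(ℂ, Model n d) ω M] {C : Set M} {ι : Type*} (A : AdaptedAtlas n d M C ι)

/-- The discrepancy between a change of coordinates `F` and the vertical one defined by `f`. -/
def discr (f : ℕ → (Fin n → ℂ) → Poly d) (N : ℕ) (F : Model n d → Model n d) (x : Model n d) :
    Fin d → ℂ :=
  (F x).2 - vmap f N ((F x).1, x.2)

variable {f : ι → ℕ → (Fin n → ℂ) → Poly d} {N : ℕ} {F : ι → Model n d → Model n d}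

theorem analyticAt_discr {f : ℕ → (Fin n → ℂ) → Poly d} {F : Model n d → Model n d} {r : ℝ}
    (hf : ∀ q, HolPoly q (Metric.ball 0 r) (f q)) {z : Fin n → ℂ}
    (hz : z ∈ Metric.ball (0 : Fin n → ℂ) r) (hF : AnalyticAt ℂ F (z, 0)) (hF0 : F (z, 0) = (z, 0)) :
    AnalyticAt ℂ (discr f N F) (z, 0) := by
  refine (analyticAt_snd.fun_comp hF).fun_sub (AnalyticAt.fun_comp (g := vmap f N) ?_
    ((analyticAt_fst.fun_comp hF).prod analyticAt_snd))
  refine analyticAt_vmap (fun q _ => hf q) ?_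
  simpa [hF0] using hz

/-- With `e_j` the discrepancy, the vertical part of `F_j(z, v)` is `vmap (f j)` at `(a, v + e_j)`
up to higher order, so `a` and `w = v + e_j` are the witnesses. Applying `Φ_{kj}` and comparing with
`F_k` gives `e_k(T v) = T e_j(v) + rem`; the leading terms of `e` turn this into a statement about
their coboundary. -/
theorem isLittleO_discr_compare (hunitary : A.IsUnitary)
    (hf : ∀ j q, HolPoly q (Metric.ball 0 A.rOut) (f j q))
    (hF : ∀ j, ∀ z ∈ Metric.ball (0 : Fin n → ℂ) A.rOut, AnalyticAt ℂ (F j) (z, 0))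
    (hF0 : ∀ j, ∀ z ∈ Metric.ball (0 : Fin n → ℂ) A.rOut, F j (z, 0) = (z, 0)) {q : ℕ} (hq : 1 ≤ q)
    (he : ∀ j, ∀ z ∈ Metric.ball (0 : Fin n → ℂ) A.rOut,
      (fun v => discr (f j) N (F j) (z, v)) =o[𝓝 0] fun v => ‖v‖ ^ q)
    {k j : ι} {z : Fin n → ℂ} (hz : z ∈ A.dom A.rOut k j) {a' : (Fin d → ℂ) → Fin n → ℂ}
    (ha' : Tendsto a' (𝓝 0) (𝓝 (A.transC k j z)))
    (hconj : (fun v => F k (a' v, (A.t k j z).mulVec v) - A.Trans k j (F j (z, v))) =o[𝓝 0]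
      fun v => ‖v‖ ^ (q + 1)) :
    ∃ (a : (Fin d → ℂ) → Fin n → ℂ) (w : (Fin d → ℂ) → Fin d → ℂ), Tendsto a (𝓝 0) (𝓝 z) ∧
      Tendsto w (𝓝 0) (𝓝 0) ∧ (fun v => w v - v) =o[𝓝 0] (fun v => ‖v‖) ∧
      (fun v => ev (A.delta (fun j => vTay (q + 1) (discr (f j) N (F j))) k j z) v +
        A.rem f N k j (a v, w v)) =o[𝓝 0] fun v => ‖v‖ ^ (q + 1) := by
  have hf' : ∀ j, ∀ q ∈ Icc 2 N, HolPoly q (Metric.ball 0 A.rOut) (f j q) := fun j q _ => hf j q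
  have hzk := A.transC_mem_ball le_rfl hz
  have hid : Tendsto (fun v : Fin d → ℂ => v) (𝓝 0) (𝓝 0) := tendsto_id
  have hlead : ∀ j, ∀ z ∈ Metric.ball (0 : Fin n → ℂ) A.rOut, (fun x : Model n d =>
      discr (f j) N (F j) x - ev (vTay (q + 1) (discr (f j) N (F j)) z) x.2) =o[𝓝 (z, 0)]
      fun x => ‖x.2‖ ^ (q + 1) := fun j z hz =>
    isLittleO_sub_ev_vTay Metric.isOpen_ball
      (fun z hz => analyticAt_discr (hf j) hz (hF j z hz) (hF0 j z hz)) (he j) hz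
  have hFt : Tendsto (fun v => F j (z, v)) (𝓝 0) (𝓝 (z, 0)) := by
    have := (hF j z hz.1).continuousAt.tendsto.comp (tendsto_mk z)
    rwa [hF0 j z hz.1] at this
  set a : (Fin d → ℂ) → Fin n → ℂ := fun v => (F j (z, v)).1
  set b : (Fin d → ℂ) → Fin d → ℂ := fun v => (F j (z, v)).2
  set e : (Fin d → ℂ) → Fin d → ℂ := fun v => discr (f j) N (F j) (z, v)
  set T := A.t k j z
  have ha : Tendsto a (𝓝 0) (𝓝 z) := (continuous_fst.tendsto ((z, 0) : Model n d)).comp hFt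
  have hb : Tendsto b (𝓝 0) (𝓝 0) := (continuous_snd.tendsto ((z, 0) : Model n d)).comp hFt
  have helead : (fun v => e v - ev (vTay (q + 1) (discr (f j) N (F j)) z) v) =o[𝓝 0]
      fun v => ‖v‖ ^ (q + 1) := (hlead j z hz.1).comp_tendsto (tendsto_mk z)
  have heO : e =O[𝓝 0] fun v => ‖v‖ ^ (q + 1) :=
    (helead.isBigO.add (isBigO_ev (fun l => vTay_isHomogeneous _ _ z l) _)).congr_left
      fun v => sub_add_cancel _ _
  have heo : e =o[𝓝 0] fun v => ‖v‖ := by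
    have := heO.trans_isLittleO (isLittleO_pow_norm hid (by omega : 1 < q + 1))
    simpa only [pow_one] using this
  have het : Tendsto e (𝓝 0) (𝓝 0) := heO.trans_tendsto (by simpa using hid.norm.pow (q + 1))
  have hw : Tendsto (fun v => v + e v) (𝓝 0) (𝓝 0) := by simpa using hid.add het
  refine ⟨a, fun v => v + e v, ha, hw, heo.congr_left fun v => (add_sub_cancel_left _ _).symm, ?_⟩
  have h1 : (fun v => vmap (f j) N (a v, v + e v) - b v) =o[𝓝 0] fun v => ‖v‖ ^ (q + 1) := by
    refine ((isLittleO_vmap_sub_vmap (hf' j) hz.1 ha hw hid).trans_isBigO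
      (heO.congr_left fun v => (add_sub_cancel_left _ _).symm)).congr_left fun v => ?_
    simp only [add_sub_cancel_left]
    simp only [e, a, b, discr]
    abel
  have h2 := A.isLittleO_trans_sub hunitary hf' hz ha hb hw h1
  have hTv := tendsto_mulVec T hid
  have hTw := tendsto_mulVec T hw
  have hc := A.tendsto_trans_fst hz ha hb
  have hFk : Tendsto (fun v => F k (a' v, T.mulVec v)) (𝓝 0) (𝓝 (A.transC k j z, 0)) := by
    have := (hF k _ hzk).continuousAt.tendsto.comp (ha'.prodMk_nhds hTv)
    rwa [hF0 k _ hzk] at this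
  have hFk1 : Tendsto (fun v => (F k (a' v, T.mulVec v)).1) (𝓝 0) (𝓝 (A.transC k j z)) :=
    (continuous_fst.tendsto ((A.transC k j z, 0) : Model n d)).comp hFk
  have h3 : (fun v => (F k (a' v, T.mulVec v)).1 - (A.Trans k j (a v, b v)).1) =o[𝓝 0]
      fun v => ‖v‖ ^ (q + 1) :=
    (isBigO_fst_prod'.trans_isLittleO hconj).congr_left fun v => by simp only [Prod.fst_sub, a, b]
  have h4 : (fun v => (F k (a' v, T.mulVec v)).2 - (A.Trans k j (a v, b v)).2) =o[𝓝 0]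
      fun v => ‖v‖ ^ (q + 1) :=
    (isBigO_snd_prod'.trans_isLittleO hconj).congr_left fun v => by simp only [Prod.snd_sub, a, b]
  have h5 := (isBigO_vmap_sub_fst (hf' k) hzk hFk1 hc hTv).trans_isLittleO h3
  have h6 := (isLittleO_vmap_sub_vmap (hf' k) hzk hc hTw hTv).trans_isBigO
    (((isBigO_mulVec T e).trans heO).congr_left fun v => by
      rw [← Matrix.mulVec_sub, add_sub_cancel_left])
  have h7 : (fun v => discr (f k) N (F k) (a' v, T.mulVec v) -
      ev (vTay (q + 1) (discr (f k) N (F k)) (A.transC k j z)) (T.mulVec v)) =o[𝓝 0]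
      fun v => ‖v‖ ^ (q + 1) :=
    ((hlead k _ hzk).comp_tendsto (ha'.prodMk_nhds hTv)).trans_isBigO
      ((isBigO_mulVec T fun v => v).norm_left.norm_right.pow (q + 1))
  have h8 := (isBigO_mulVec T _).trans_isLittleO helead
  refine (((((h7.sub h2).add h5).sub h4).sub h6).sub h8).congr_left fun v => ?_
  simp only [delta, ev_sub, ev_act, ev_subst, Matrix.mulVec_sub, Matrix.mulVec_add, discr]
  have hT : A.t k j z = T := rfl
  simp only [hT]
  abel

/-- The given formal maps need not extend the coefficients found so far. As long as the discrepancy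
has order `q < N`, the defect is negligible in degree `q + 1`, so the leading term is closed and
vanishes by `H⁰ = 0`. At `q = N` the defect contributes its own leading term, and the leading term
of the discrepancy becomes a primitive of the obstruction. -/
theorem exists_delta_eq_obstr_of_formal (hunitary : A.IsUnitary) (hH0 : ∀ l, 1 < l → A.H0Vanishes l)
    (hformal : A.FormallyVerticallyLinearizable) (hN : 1 ≤ N)
    (hf : ∀ j q, HolPoly q (Metric.ball 0 A.rOut) (f j q)) (h : A.Solves f N) :
    ∃ u : ι → (Fin n → ℂ) → Poly d, IsCochain₀ (N + 1) A.rOut u ∧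
      ∀ k j, ∀ z ∈ A.dom A.rOut k j, A.delta u k j z = A.obstr f N k j z := by
  obtain ⟨φ, g, hφ, hg, hφg⟩ := hformal
  have hid : Tendsto (fun v : Fin d → ℂ => v) (𝓝 0) (𝓝 0) := tendsto_id
  -- Truncation at degree `N + 1` suffices, everything being computed modulo `o(‖v‖^(N+1))`, and it
  -- makes the maps genuinely holomorphic.
  let F : ι → Model n d → Model n d := fun j x => x + truncSeries (φ j) (N + 1) x
  have hO : ∀ j, ∀ z ∈ Metric.ball (0 : Fin n → ℂ) A.rOut,
      (fun v => truncSeries (φ j) (N + 1) (z, v)) =O[𝓝 0] fun v : Fin d → ℂ => ‖v‖ ^ 2 :=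
    fun j z hz => isBigO_truncSeries Metric.isOpen_ball (hφ j) hz tendsto_const_nhds hid
  have hF : ∀ j, ∀ z ∈ Metric.ball (0 : Fin n → ℂ) A.rOut, AnalyticAt ℂ (F j) (z, 0) := fun j z hz =>
    analyticAt_id.fun_add (analyticAt_truncSeries Metric.isOpen_ball (hφ j) (x := (z, 0)) hz)
  have hF0 : ∀ j, ∀ z ∈ Metric.ball (0 : Fin n → ℂ) A.rOut, F j (z, 0) = (z, 0) := fun j z hz => by
    have : truncSeries (φ j) (N + 1) (z, 0) = 0 := by
      obtain ⟨c, hc⟩ := (hO j z hz).bound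
      simpa using hc.self_of_nhds
    simp [F, this]
  have ha' : ∀ k j, ∀ z ∈ A.dom A.rOut k j, Tendsto (fun v : Fin d → ℂ =>
      A.transC k j z + truncSeries (g k j) (N + 1) (z, v)) (𝓝 0) (𝓝 (A.transC k j z)) := by
    intro k j z hz
    have := (isBigO_truncSeries (N := N + 1) (A.isOpen_dom le_rfl k j) (hg k j) hz
      (tendsto_const_nhds (f := 𝓝 (0 : Fin d → ℂ))) hid).trans_tendsto (by simpa using hid.norm.pow 2)
    simpa using tendsto_const_nhds.add this
  have hconj : ∀ q ≤ N, ∀ k j, ∀ z ∈ A.dom A.rOut k j,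
      (fun v => F k (A.transC k j z + truncSeries (g k j) (N + 1) (z, v), (A.t k j z).mulVec v) -
        A.Trans k j (F j (z, v))) =o[𝓝 0] fun v => ‖v‖ ^ (q + 1) := fun q hq k j z hz =>
    (hφg k j z hz (N + 1)).trans_isLittleO (isLittleO_pow_norm hid (by omega))
  have hhol : ∀ q j, HolPoly q (Metric.ball 0 A.rOut) (vTay q (discr (f j) N (F j))) := fun q j =>
    holPoly_vTay q fun z hz => analyticAt_discr (hf j) hz (hF j z hz) (hF0 j z hz)
  have he : ∀ q, 1 ≤ q → q ≤ N → ∀ j, ∀ z ∈ Metric.ball (0 : Fin n → ℂ) A.rOut,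
      (fun v => discr (f j) N (F j) (z, v)) =o[𝓝 0] fun v => ‖v‖ ^ q := by
    intro q hq
    induction q, hq using Nat.le_induction with
    | base =>
      intro _ j z hz
      have hA : Tendsto (fun v => (F j (z, v)).1) (𝓝 0) (𝓝 z) := by
        have := (hF j z hz).continuousAt.tendsto.comp (tendsto_mk z)
        rw [hF0 j z hz] at this
        exact (continuous_fst.tendsto ((z, 0) : Model n d)).comp this
      have h1 := isBigO_vmap_sub (N := N) (fun q _ => hf j q) hz hA hid
      have h2 := isBigO_snd_prod'.trans (hO j z hz)
      refine ((h2.sub h1).trans_isLittleO (isLittleO_pow_norm hid one_lt_two)).congr_left fun v => ?_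
      simp only [discr, F, Prod.snd_add]
      abel
    | succ q hq ih =>
      intro hqN
      have he := ih (by omega)
      have hδ : ∀ k j, ∀ z ∈ A.dom A.rOut k j,
          A.delta (fun j => vTay (q + 1) (discr (f j) N (F j))) k j z = 0 := by
        intro k j z hz
        obtain ⟨a, w, ha, hw, hwv, hcmp⟩ := A.isLittleO_discr_compare hunitary hf hF hF0 hq he hz
          (ha' k j z hz) (hconj q (by omega) k j z hz)
        have hwO : w =O[𝓝 0] fun v => ‖v‖ :=
          (hwv.isBigO.add (isBigO_refl (fun v : Fin d → ℂ => v) _).norm_right).congr_left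
            fun v => sub_add_cancel _ _
        have h1 : (fun v => A.rem f N k j (a v, w v)) =o[𝓝 0] fun v => ‖v‖ ^ N :=
          ((h k j z hz).comp_tendsto (ha.prodMk_nhds hw)).trans_isBigO (hwO.norm_left.pow N)
        refine ev_eq_zero_of_isLittleO (m := q + 1) (fun l => ?_)
          ((hcmp.sub (h1.trans_isBigO (isBigO_pow_norm hid hqN))).congr_left
            fun v => add_sub_cancel_right _ _)
        exact (isHomogeneous_act (fun l => vTay_isHomogeneous _ _ _ l) _ l).sub
          (subst_isHomogeneous (vTay_isHomogeneous _ _ _ l) _)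
      have h0 := hH0 (q + 1) (by omega) _ (hhol (q + 1)) hδ
      intro j z hz
      have h2 := (isLittleO_sub_ev_vTay Metric.isOpen_ball
        (fun z hz => analyticAt_discr (hf j) hz (hF j z hz) (hF0 j z hz)) (he j) hz).comp_tendsto
          (tendsto_mk z)
      refine h2.congr_left fun v => ?_
      simp only [Function.comp_apply]
      rw [h0 j z hz, ev_zero, sub_zero]
  refine ⟨fun j => vTay (N + 1) (discr (f j) N (F j)), hhol (N + 1), fun k j z hz => ?_⟩
  obtain ⟨a, w, ha, hw, hwv, hcmp⟩ := A.isLittleO_discr_compare hunitary hf hF hF0 hN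
    (he N hN le_rfl) hz (ha' k j z hz) (hconj N le_rfl k j z hz)
  have hidO := (isBigO_refl (fun v : Fin d → ℂ => v) (𝓝 0)).norm_right
  have hwO : w =O[𝓝 0] fun v => ‖v‖ := (hwv.isBigO.add hidO).congr_left fun v => sub_add_cancel _ _
  have h1 : (fun v => A.rem f N k j (a v, w v) + ev (A.obstr f N k j z) (w v)) =o[𝓝 0]
      fun v => ‖v‖ ^ (N + 1) :=
    ((A.isLittleO_rem_add_obstr hunitary hf h hz).comp_tendsto (ha.prodMk_nhds hw)).trans_isBigO
      (hwO.norm_left.pow (N + 1))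
  have hr := fun l => (A.holPoly_obstr hunitary hf k j l (N := N)).1 z hz
  have h2 := isLittleO_ev_sub_ev hr hwO hidO hwv
  refine sub_eq_zero.1 (ev_eq_zero_of_isLittleO (m := N + 1) (fun l => ?_)
    ((hcmp.sub h1).add h2 |>.congr_left fun v => ?_))
  · exact ((isHomogeneous_act (fun l => vTay_isHomogeneous _ _ _ l) _ l).sub
      (subst_isHomogeneous (vTay_isHomogeneous _ _ _ l) _)).sub (hr l)
  · rw [ev_sub]
    abel

end AdaptedAtlas

end VertLin

end

/-! ### The mean value inequality on polydiscs. -/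

noncomputable section

namespace VertLin

open MeasureTheory

section MeanValue

variable {n : ℕ} {F : Type*} [NormedAddCommGroup F] [NormedSpace ℂ F] [CompleteSpace F]
  {h : (Fin n → ℂ) → F} {z : Fin n → ℂ} {ρ : ℝ}

theorem measurePreserving_smul {c : ℂ} (hc : ‖c‖ = 1) :
    MeasurePreserving (fun y : Fin n → ℂ => c • y) := by
  have h1 : MeasurePreserving (fun w : ℂ => c * w) :=
    (rotation ⟨c, by simpa [Submonoid.unitSphere] using hc⟩).measurePreserving
  exact volume_preserving_pi (f := fun (_ : Fin n) (w : ℂ) => c * w) fun _ => h1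

theorem enorm_le_lintegral_circle {f : ℂ → F} {U : Set ℂ}
    (hf : DifferentiableOn ℂ f U) (hsub : Metric.closedBall 0 1 ⊆ U) :
    ENNReal.ofReal (2 * Real.pi) * ‖f 0‖ₑ ≤ ∫⁻ θ in Set.Ioc 0 (2 * Real.pi), ‖f (circleMap 0 1 θ)‖ₑ := by
  have h1 : DiffContOnCl ℂ f (Metric.ball 0 |1|) := by
    rw [abs_one]
    exact (hf.mono hsub).diffContOnCl_ball subset_rfl
  have h2 := h1.circleAverage
  rw [Real.circleAverage_def] at h2
  have h3 : (2 * Real.pi) • f 0 = ∫ θ in (0)..(2 * Real.pi), f (circleMap 0 1 θ) := by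
    rw [← h2, smul_smul, mul_inv_cancel₀ Real.two_pi_pos.ne', one_smul]
  rw [intervalIntegral.integral_of_le Real.two_pi_pos.le] at h3
  have h4 := enorm_integral_le_lintegral_enorm (μ := volume.restrict (Set.Ioc 0 (2 * Real.pi)))
    fun θ => f (circleMap 0 1 θ)
  rw [← h3, enorm_smul, Real.enorm_eq_ofReal Real.two_pi_pos.le] at h4
  exact h4

/-- For each `y` the value at the centre is the mean over the circle `z + e^{iθ} y`. Integrating
over `y`, exchanging the integrals and using that multiplication by `e^{iθ}` preserves volume gives
the claim. -/
theorem volume_mul_enorm_le_lintegral (hh : DifferentiableOn ℂ h (Metric.ball z ρ)) :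
    volume (Metric.ball z ρ) * ‖h z‖ₑ ≤ ∫⁻ y in Metric.ball z ρ, ‖h y‖ₑ := by
  let g : (Fin n → ℂ) → ℝ≥0∞ := (Metric.ball z ρ).indicator fun y => ‖h y‖ₑ
  have hg : Measurable g := by
    classical
    have := ContinuousOn.measurable_piecewise (s := Metric.ball z ρ) (f := fun y => ‖h y‖ₑ)
      (g := 0) hh.continuousOn.enorm (continuousOn_const (c := 0)) measurableSet_ball
    rwa [Set.piecewise_eq_indicator] at this
  have hint : ∫⁻ y, g (z + y) = ∫⁻ y in Metric.ball z ρ, ‖h y‖ₑ := by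
    rw [lintegral_add_left_eq_self, lintegral_indicator measurableSet_ball]
  have hvol : volume (Metric.ball (0 : Fin n → ℂ) ρ) = volume (Metric.ball z ρ) := by
    exact (Measure.addHaar_ball_center volume z ρ).symm
  have hcirc : ∀ y ∈ Metric.ball (0 : Fin n → ℂ) ρ, ENNReal.ofReal (2 * Real.pi) * ‖h z‖ₑ ≤
      ∫⁻ θ in Set.Ioc 0 (2 * Real.pi), g (z + circleMap 0 1 θ • y) := by
    intro y hy
    have hsub : Metric.closedBall 0 1 ⊆ (fun c : ℂ => z + c • y) ⁻¹' Metric.ball z ρ := by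
      intro c hc
      simp only [Set.mem_preimage, mem_ball_iff_norm, add_sub_cancel_left, norm_smul]
      rw [mem_closedBall_zero_iff] at hc
      rw [mem_ball_zero_iff] at hy
      exact (mul_le_of_le_one_left (norm_nonneg _) hc).trans_lt hy
    have := enorm_le_lintegral_circle (f := fun c : ℂ => h (z + c • y)) (hh.comp (by fun_prop) fun c hc => hc) hsub
    simp only [zero_smul, add_zero] at this
    refine this.trans (le_of_eq (lintegral_congr fun θ => ?_))
    have hmem : z + circleMap 0 1 θ • y ∈ Metric.ball z ρ := hsub (by simp)
    exact (Set.indicator_of_mem hmem fun y => ‖h y‖ₑ).symm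
  have hmeas : Measurable (Function.uncurry fun (y : Fin n → ℂ) (θ : ℝ) => g (z + circleMap 0 1 θ • y)) := by
    refine hg.comp (Continuous.measurable ?_)
    have := continuous_circleMap 0 1
    fun_prop
  have hpi : ENNReal.ofReal (2 * Real.pi) ≠ 0 := by simpa using Real.pi_pos
  refine (ENNReal.mul_le_mul_iff_right hpi ENNReal.ofReal_ne_top).1 ?_
  calc ENNReal.ofReal (2 * Real.pi) * (volume (Metric.ball z ρ) * ‖h z‖ₑ)
      = ∫⁻ _ in Metric.ball (0 : Fin n → ℂ) ρ, ENNReal.ofReal (2 * Real.pi) * ‖h z‖ₑ := by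
        rw [setLIntegral_const, hvol]; ring
    _ ≤ ∫⁻ y in Metric.ball (0 : Fin n → ℂ) ρ,
        ∫⁻ θ in Set.Ioc 0 (2 * Real.pi), g (z + circleMap 0 1 θ • y) :=
        setLIntegral_mono' measurableSet_ball hcirc
    _ ≤ ∫⁻ y, ∫⁻ θ in Set.Ioc 0 (2 * Real.pi), g (z + circleMap 0 1 θ • y) := setLIntegral_le_lintegral _ _
    _ = ∫⁻ θ in Set.Ioc 0 (2 * Real.pi), ∫⁻ y, g (z + circleMap 0 1 θ • y) :=
        lintegral_lintegral_swap hmeas.aemeasurable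
    _ = ∫⁻ _ in Set.Ioc 0 (2 * Real.pi), ∫⁻ y in Metric.ball z ρ, ‖h y‖ₑ := by
        refine lintegral_congr fun θ => ?_
        rw [← hint]
        have hg' : Measurable fun y => g (z + y) := hg.comp (measurable_const_add z)
        exact (measurePreserving_smul (n := n) (c := circleMap 0 1 θ) (by simp)).lintegral_comp hg'
    _ = ENNReal.ofReal (2 * Real.pi) * ∫⁻ y in Metric.ball z ρ, ‖h y‖ₑ := by
        rw [setLIntegral_const, Real.volume_Ioc, sub_zero, mul_comm]

theorem volume_mul_enorm_le_lintegral_sq (hh : DifferentiableOn ℂ h (Metric.ball z ρ)) :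
    volume (Metric.ball z ρ) * ‖h z‖ₑ ≤
      (∫⁻ y in Metric.ball z ρ, ENNReal.ofReal (‖h y‖ ^ 2)) ^ (1 / 2 : ℝ) *
        volume (Metric.ball z ρ) ^ (1 / 2 : ℝ) := by
  refine (volume_mul_enorm_le_lintegral hh).trans ?_
  have h1 : AEMeasurable (fun y => ‖h y‖ₑ) (volume.restrict (Metric.ball z ρ)) :=
    hh.continuousOn.enorm.aemeasurable measurableSet_ball
  have h2 := ENNReal.lintegral_mul_le_Lp_mul_Lq (volume.restrict (Metric.ball z ρ))
    Real.HolderConjugate.two_two h1 (aemeasurable_const (b := 1))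
  have h3 : ∀ y, ‖h y‖ₑ ^ (2 : ℝ) = ENNReal.ofReal (‖h y‖ ^ 2) := fun y => by
    rw [ENNReal.ofReal_pow (norm_nonneg _), ofReal_norm]; norm_cast
  simpa [h3] using h2

end MeanValue

end VertLin

end

/-! ### Closed cochains of the inner covering extend to the outer one. -/

noncomputable section

namespace VertLin

open MvPolynomial Finset Filter Asymptotics

section Linear

variable {n d m : ℕ}

theorem ev_ext {P Q : Poly d} (h : ∀ v, ev P v = ev Q v) : P = Q := by
  ext1 l
  exact MvPolynomial.funext fun v => congrFun (h v) l

theorem ev_smul (c : ℂ) (P : Poly d) (v : Fin d → ℂ) : ev (c • P) v = c • ev P v := by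
  ext l
  simp [ev]

/-- `act T` as a linear map. -/
def actL (T : Matrix (Fin d) (Fin d) ℂ) : Poly d →ₗ[ℂ] Poly d where
  toFun := act T
  map_add' P Q := ev_ext fun v => by simp only [ev_act, ev_add, Matrix.mulVec_add]
  map_smul' c P := ev_ext fun v => by
    simp only [ev_act, ev_smul, Matrix.mulVec_smul, RingHom.id_apply]

/-- `subst T` on vector valued polynomials as a linear map. -/
def substL (T : Matrix (Fin d) (Fin d) ℂ) : Poly d →ₗ[ℂ] Poly d where
  toFun P l := subst T (P l)
  map_add' P Q := ev_ext fun v => by simp only [ev_subst, ev_add]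
  map_smul' c P := ev_ext fun v => by simp only [ev_subst, ev_smul, RingHom.id_apply]

/-- The coefficient `Q` of the component `l` as a linear form. -/
def coeffL (l : Fin d) (Q : Fin d →₀ ℕ) : Poly d →ₗ[ℂ] ℂ := (lcoeff ℂ Q).comp (LinearMap.proj l)

variable {Ω : Set (Fin n → ℂ)} {P : (Fin n → ℂ) → Poly d}

theorem HolPoly.differentiableAt_linear (hP : HolPoly m Ω P) (hΩ : IsOpen Ω) (L : Poly d →ₗ[ℂ] ℂ)
    {g : (Fin n → ℂ) → Fin n → ℂ} {z : Fin n → ℂ} (hg : DifferentiableAt ℂ g z) (hz : g z ∈ Ω) :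
    DifferentiableAt ℂ (fun z => L (P (g z))) z := by
  have h1 : DifferentiableAt ℂ (fun z => tensV m (P z)) (g z) :=
    hP.differentiableOn_tensV.differentiableAt (hΩ.mem_nhds hz)
  have h2 : DifferentiableAt ℂ (fun z => LinearMap.toContinuousLinearMap (L.comp (ofTensV m))
      (tensV m (P (g z)))) z :=
    (LinearMap.toContinuousLinearMap (L.comp (ofTensV m))).differentiableAt.fun_comp' z (h1.fun_comp' z hg)
  refine h2.congr_of_eventuallyEq ?_
  filter_upwards [hg.continuousAt.eventually (hΩ.mem_nhds hz)] with z' hz'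
  simp [ofTensV_tensV fun l => (hP l).1 _ hz']

/-- The pullback of a vector valued polynomial by a unitary matrix. -/
def pull (T : Matrix (Fin d) (Fin d) ℂ) (P : Poly d) : Poly d := act (star T) fun l => subst T (P l)

theorem ev_pull (T : Matrix (Fin d) (Fin d) ℂ) (P : Poly d) (v : Fin d → ℂ) :
    ev (pull T P) v = (star T).mulVec (ev P (T.mulVec v)) := by
  rw [pull, ev_act, ev_subst]

end Linear

namespace AdaptedAtlas

variable {n d : ℕ} {M : Type*} [TopologicalSpace M] [ChartedSpace (Model n d) M]
  [IsManifold 𝓘(ℂ, Model n d) ω M] {C : Set M} {ι : Type*} (A : AdaptedAtlas n d M C ι)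

theorem holPoly_delta (hunitary : A.IsUnitary) {m : ℕ} {u : ι → (Fin n → ℂ) → Poly d}
    (hu : IsCochain₀ m A.rOut u) (k j : ι) : HolPoly m (A.dom A.rOut k j) (A.delta u k j) := by
  refine fun l => ⟨fun z hz => ?_, fun Q z hz => ?_⟩
  · exact (isHomogeneous_act (fun l => (hu j l).1 z hz.1) _ l).sub
      (subst_isHomogeneous ((hu k l).1 _ (A.transC_mem_ball le_rfl hz)) _)
  · have h1 := HolPoly.differentiableAt_linear (hu j) Metric.isOpen_ball
      ((coeffL l Q).comp (actL (A.t k j z))) differentiableAt_id hz.1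
    have h2 := HolPoly.differentiableAt_linear (hu k) Metric.isOpen_ball
      ((coeffL l Q).comp (substL (A.t k j z))) (A.analyticAt_transC hz).differentiableAt
      (A.transC_mem_ball le_rfl hz)
    refine ((h1.sub h2).congr_of_eventuallyEq ?_).differentiableWithinAt
    filter_upwards [A.eventually_t_eq hunitary hz] with z' hz'
    simp only [delta, hz', Pi.sub_apply, coeff_sub]
    rfl

open Classical in
/-- The extension of a closed `0`-cochain of the inner covering to the outer one. -/
def extend (w : ι → (Fin n → ℂ) → Poly d) (j : ι) (z : Fin n → ℂ) : Poly d :=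
  if h : ∃ i, A.pt j z ∈ A.U A.rIn i then pull (A.t h.choose j z) (w h.choose (A.transC h.choose j z))
  else 0

variable {w : ι → (Fin n → ℂ) → Poly d} {m : ℕ}

theorem U_mono {r s : ℝ} (h : r ≤ s) (i : ι) : A.U r i ⊆ A.U s i := fun _ hp =>
  ⟨hp.1, hp.2.1, Metric.ball_subset_ball h hp.2.2⟩

theorem mem_dom_of_mem_U {r : ℝ} (hr : r ≤ A.rOut) {i j : ι} {z : Fin n → ℂ}
    (hz : z ∈ Metric.ball (0 : Fin n → ℂ) A.rOut) (hi : A.pt j z ∈ A.U r i) : z ∈ A.dom A.rOut i j :=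
  ⟨hz, A.U_mono hr i hi⟩

/-- Closedness makes the chosen index immaterial: two choices differ by a transition matrix, which
cancels in the pullback because it is unitary. -/
theorem extend_eq (hsplit : A.IsSplit) (hunitary : A.IsUnitary)
    (hw : ∀ k j, ∀ z ∈ A.dom A.rIn k j, A.delta w k j z = 0) {i j : ι} {z : Fin n → ℂ}
    (hz : z ∈ Metric.ball (0 : Fin n → ℂ) A.rOut) (hi : A.pt j z ∈ A.U A.rIn i) :
    A.extend w j z = pull (A.t i j z) (w i (A.transC i j z)) := by
  have h : ∃ i, A.pt j z ∈ A.U A.rIn i := ⟨i, hi⟩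
  rw [extend, dif_pos h]
  have hi' := h.choose_spec
  set i' := h.choose
  have hd := A.mem_dom_of_mem_U A.rIn_lt.le hz hi
  have hd' := A.mem_dom_of_mem_U A.rIn_lt.le hz hi'
  have hy : A.transC i j z ∈ A.dom A.rIn i' i := by
    refine ⟨hi.2.2, ?_⟩
    rwa [A.pt_transC hd]
  have hyO := A.dom_mono A.rIn_lt.le _ _ hy
  have ht := A.t_mul_t hsplit hd' hd
  refine ev_ext fun v => ?_
  have h1 := congrArg (fun P => ev P ((A.t i j z).mulVec v)) (hw i' i _ hy)
  simp only [delta, ev_sub, ev_act, ev_subst, ev_zero, Matrix.mulVec_mulVec, ht,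
    A.transC_transC hd, sub_eq_zero] at h1
  rw [ev_pull, ev_pull, ← h1, ← ht, star_mul, Matrix.mulVec_mulVec, Matrix.mul_assoc,
    Matrix.mem_unitaryGroup_iff'.1 (hunitary i' i _ hyO), Matrix.mul_one]

theorem exists_mem_U (j : ι) {z : Fin n → ℂ} (hz : z ∈ Metric.ball (0 : Fin n → ℂ) A.rOut) :
    ∃ i, A.pt j z ∈ A.U A.rIn i := by
  have hp := A.pt_mem (j := j) (A.ball_subset_closedBall le_rfl hz)
  obtain ⟨i, h1, h2⟩ := A.covers _ hp
  exact ⟨i, h1, hp, h2⟩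

theorem isCochain_extend (hsplit : A.IsSplit) (hunitary : A.IsUnitary) (hc : IsCochain₀ m A.rIn w)
    (hw : ∀ k j, ∀ z ∈ A.dom A.rIn k j, A.delta w k j z = 0) : IsCochain₀ m A.rOut (A.extend w) := by
  refine fun j l => ⟨fun z hz => ?_, fun Q z hz => ?_⟩
  · obtain ⟨i, hi⟩ := A.exists_mem_U j hz
    rw [A.extend_eq hsplit hunitary hw hz hi]
    exact isHomogeneous_act (fun l => subst_isHomogeneous ((hc i l).1 _ hi.2.2) _) _ l
  · obtain ⟨i, hi⟩ := A.exists_mem_U j hz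
    have hd := A.mem_dom_of_mem_U A.rIn_lt.le hz hi
    have ha := A.analyticAt_transC hd
    have h1 := HolPoly.differentiableAt_linear (hc i) Metric.isOpen_ball
      ((coeffL l Q).comp ((actL (star (A.t i j z))).comp (substL (A.t i j z)))) ha.differentiableAt hi.2.2
    refine (h1.congr_of_eventuallyEq ?_).differentiableWithinAt
    filter_upwards [A.eventually_t_eq hunitary hd, (A.isOpen_dom le_rfl i j).mem_nhds hd,
      ha.continuousAt.eventually (Metric.isOpen_ball.mem_nhds hi.2.2)] with z' hz' hd' hb
    rw [A.extend_eq hsplit hunitary hw hd'.1 ⟨hd'.2.1, hd'.2.2.1, hb⟩, hz']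
    rfl

theorem delta_extend (hsplit : A.IsSplit) (hunitary : A.IsUnitary)
    (hw : ∀ k j, ∀ z ∈ A.dom A.rIn k j, A.delta w k j z = 0) (k j : ι) {z : Fin n → ℂ}
    (hz : z ∈ A.dom A.rOut k j) : A.delta (A.extend w) k j z = 0 := by
  obtain ⟨i, hi⟩ := A.exists_mem_U j hz.1
  have hd := A.mem_dom_of_mem_U A.rIn_lt.le hz.1 hi
  have hzk := A.transC_mem_ball le_rfl hz
  have hik : A.pt k (A.transC k j z) ∈ A.U A.rIn i := by rwa [A.pt_transC hz]
  have ht := A.t_mul_t hsplit hd hz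
  refine ev_ext fun v => ?_
  have htv : (A.t i k (A.transC k j z)).mulVec ((A.t k j z).mulVec v) = (A.t i j z).mulVec v := by
    rw [Matrix.mulVec_mulVec, ht]
  rw [delta, A.extend_eq hsplit hunitary hw hz.1 hi, A.extend_eq hsplit hunitary hw hzk hik,
    A.transC_transC hz, ev_sub, ev_act, ev_subst, ev_pull, ev_pull, htv, ev_zero,
    sub_eq_zero, Matrix.mulVec_mulVec, ← ht, star_mul, ← Matrix.mul_assoc,
    Matrix.mem_unitaryGroup_iff.1 (hunitary k j z hz), Matrix.one_mul]

/-- `H0Vanishes` speaks of the outer covering, whereas `K_*` compares cochains on the inner one.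
Since the inner polydiscs already cover `C`, a closed inner cochain is a global section and extends,
so uniqueness passes to the inner covering. -/
theorem eq_zero_of_delta_eq_zero (hsplit : A.IsSplit) (hunitary : A.IsUnitary) (hH0 : A.H0Vanishes m)
    (hc : IsCochain₀ m A.rIn w) (hw : ∀ k j, ∀ z ∈ A.dom A.rIn k j, A.delta w k j z = 0) (j : ι)
    {z : Fin n → ℂ} (hz : z ∈ Metric.ball (0 : Fin n → ℂ) A.rIn) : w j z = 0 := by
  have hz' : z ∈ Metric.ball (0 : Fin n → ℂ) A.rOut := Metric.ball_subset_ball A.rIn_lt.le hz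
  have h0 := hH0 _ (A.isCochain_extend hsplit hunitary hc hw)
    (fun k j z hz => A.delta_extend hsplit hunitary hw k j hz) j z hz'
  rw [A.extend_eq hsplit hunitary hw hz' (A.mem_dom_self A.rIn_lt.le hz).2, A.transC_self hz',
    A.t_self hz'] at h0
  rw [← h0]
  refine ev_ext fun v => ?_
  rw [ev_pull, star_one, Matrix.one_mulVec, Matrix.one_mulVec]

end AdaptedAtlas

end VertLin

end

/-! ### The small divisor estimate in the supremum norm. -/

noncomputable section

namespace VertLin

open MvPolynomial Finset Filter Asymptotics MeasureTheory

section L2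

variable {n d m : ℕ}

/-- The `L²` norm over `s` of a family of vector valued polynomials. -/
def l2norm (s : Set (Fin n → ℂ)) (P : (Fin n → ℂ) → Poly d) : ℝ≥0∞ :=
  (∫⁻ z in s, ENNReal.ofReal (fischerSqVec (P z))) ^ (1 / 2 : ℝ)

theorem vnorm_smul (c : ℂ) (P : Poly d) : vnorm m (c • P) = ‖c‖ * vnorm m P := by
  rw [vnorm, map_smul, norm_smul, vnorm]

theorem isHomogeneous_smul {P : Poly d} (hP : ∀ l, (P l).IsHomogeneous m) (c : ℂ) (l : Fin d) :
    ((c • P) l).IsHomogeneous m := by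
  rw [Pi.smul_apply, smul_eq_C_mul]
  simpa using (isHomogeneous_C (Fin d) c).mul (hP l)

variable {s : Set (Fin n → ℂ)} {P : (Fin n → ℂ) → Poly d}

theorem l2norm_eq (hs : MeasurableSet s) (hP : ∀ z ∈ s, ∀ l, (P z l).IsHomogeneous m) :
    l2norm s P = (∫⁻ z in s, ENNReal.ofReal (vnorm m (P z) ^ 2)) ^ (1 / 2 : ℝ) := by
  rw [l2norm]
  congr 1
  exact setLIntegral_congr_fun hs fun z hz => by rw [fischerSqVec_eq (hP z hz)]

theorem l2norm_congr {P' : (Fin n → ℂ) → Poly d} (hs : MeasurableSet s) (h : ∀ z ∈ s, P z = P' z) :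
    l2norm s P = l2norm s P' := by
  rw [l2norm, l2norm]
  congr 1
  exact setLIntegral_congr_fun hs fun z hz => by rw [h z hz]

theorem l2norm_smul (hs : MeasurableSet s) (hP : ∀ z ∈ s, ∀ l, (P z l).IsHomogeneous m) {c : ℝ} (hc : 0 ≤ c) :
    l2norm s (fun z => (c : ℂ) • P z) = ENNReal.ofReal c * l2norm s P := by
  rw [l2norm_eq hs hP, l2norm_eq hs fun z hz l => isHomogeneous_smul (hP z hz) _ l]
  have h : ∀ z, ENNReal.ofReal (vnorm m ((c : ℂ) • P z) ^ 2) =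
      ENNReal.ofReal c ^ 2 * ENNReal.ofReal (vnorm m (P z) ^ 2) := fun z => by
    rw [vnorm_smul, mul_pow, ENNReal.ofReal_mul (sq_nonneg _), ENNReal.ofReal_pow (norm_nonneg _),
      Complex.norm_real, Real.norm_of_nonneg hc]
  simp only [h]
  rw [lintegral_const_mul' _ _ (by finiteness), ENNReal.mul_rpow_of_nonneg _ _ (by norm_num),
    ← ENNReal.rpow_natCast, ← ENNReal.rpow_mul]
  norm_num

theorem l2norm_le (hs : MeasurableSet s) (hP : ∀ z ∈ s, ∀ l, (P z l).IsHomogeneous m) {D : ℝ}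
    (h : ∀ z ∈ s, vnorm m (P z) ≤ D) : l2norm s P ≤ ENNReal.ofReal D * volume s ^ (1 / 2 : ℝ) := by
  rw [l2norm_eq hs hP]
  calc (∫⁻ z in s, ENNReal.ofReal (vnorm m (P z) ^ 2)) ^ (1 / 2 : ℝ)
      ≤ (∫⁻ _ in s, ENNReal.ofReal D ^ 2) ^ (1 / 2 : ℝ) := by
        refine ENNReal.rpow_le_rpow (setLIntegral_mono' hs fun z hz => ?_) (by norm_num)
        rw [ENNReal.ofReal_pow (vnorm_nonneg _ _)]
        gcongr
        exact h z hz
    _ = ENNReal.ofReal D * volume s ^ (1 / 2 : ℝ) := by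
        rw [setLIntegral_const, ENNReal.mul_rpow_of_nonneg _ _ (by norm_num), ← ENNReal.rpow_natCast,
          ← ENNReal.rpow_mul]
        norm_num

theorem l2norm_mono {s' : Set (Fin n → ℂ)} (h : s ⊆ s') : l2norm s P ≤ l2norm s' P :=
  ENNReal.rpow_le_rpow (lintegral_mono_set h) (by norm_num)

theorem volume_mul_vnorm_le {z : Fin n → ℂ} {ρ : ℝ} (hP : HolPoly m (Metric.ball z ρ) P) :
    volume (Metric.ball z ρ) * ENNReal.ofReal (vnorm m (P z)) ≤
      l2norm (Metric.ball z ρ) P * volume (Metric.ball z ρ) ^ (1 / 2 : ℝ) := by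
  rw [l2norm_eq measurableSet_ball fun z hz l => (hP l).1 z hz, vnorm, ofReal_norm]
  exact volume_mul_enorm_le_lintegral_sq hP.differentiableOn_tensV

theorem HolPoly.eq_zero_of_l2norm_eq_zero (hs : IsOpen s) (hP : HolPoly m s P) (h : l2norm s P = 0)
    {z : Fin n → ℂ} (hz : z ∈ s) : P z = 0 := by
  obtain ⟨ρ, hρ, hsub⟩ := Metric.isOpen_iff.1 hs z hz
  have h1 := volume_mul_vnorm_le (hP.mono hsub)
  have h2 : l2norm (Metric.ball z ρ) P = 0 := le_antisymm (h ▸ l2norm_mono hsub) zero_le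
  rw [h2, zero_mul, nonpos_iff_eq_zero, mul_eq_zero, ENNReal.ofReal_eq_zero] at h1
  have h3 : tensV m (P z) = 0 :=
    norm_le_zero_iff.1 (h1.resolve_left (Metric.measure_ball_pos _ _ hρ).ne')
  rw [← ofTensV_tensV fun l => (hP l).1 z hz, h3, map_zero]

end L2

namespace AdaptedAtlas

variable {n d : ℕ} {M : Type*} [TopologicalSpace M] [ChartedSpace (Model n d) M]
  [IsManifold 𝓘(ℂ, Model n d) ω M] {C : Set M} {ι : Type*} (A : AdaptedAtlas n d M C ι)
  {m : ℕ} {u : ι → (Fin n → ℂ) → Poly d}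

theorem norm₀_eq (r : ℝ) (u : ι → (Fin n → ℂ) → Poly d) :
    norm₀ r u = ⨆ j, l2norm (Metric.ball 0 r) (u j) := rfl

theorem norm₁_eq (r : ℝ) (f : ι → ι → (Fin n → ℂ) → Poly d) :
    A.norm₁ r f = ⨆ (k) (j), l2norm (A.dom r k j) (f k j) := rfl

theorem delta_smul (c : ℂ) (u : ι → (Fin n → ℂ) → Poly d) (k j : ι) (z : Fin n → ℂ) :
    A.delta (fun j z => c • u j z) k j z = c • A.delta u k j z := by
  refine ev_ext fun v => ?_
  simp only [delta, ev_sub, ev_act, ev_subst, ev_smul, Matrix.mulVec_smul, smul_sub]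

theorem delta_sub (u u' : ι → (Fin n → ℂ) → Poly d) (k j : ι) (z : Fin n → ℂ) :
    A.delta (fun j z => u j z - u' j z) k j z = A.delta u k j z - A.delta u' k j z := by
  refine ev_ext fun v => ?_
  simp only [delta, ev_sub, ev_act, ev_subst, Matrix.mulVec_sub]
  abel

theorem IsCochain₀.smul' {r : ℝ} (hu : IsCochain₀ m r u) (c : ℂ) :
    IsCochain₀ m r fun j z => c • u j z := by
  refine fun j l => ⟨fun z hz => isHomogeneous_smul (fun l => (hu j l).1 z hz) c l, fun Q => ?_⟩
  simpa [coeff_smul] using ((hu j l).2 Q).const_mul c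

theorem IsCochain₀.sub' {r : ℝ} {u' : ι → (Fin n → ℂ) → Poly d} (hu : IsCochain₀ m r u)
    (hu' : IsCochain₀ m r u') : IsCochain₀ m r fun j z => u j z - u' j z := by
  refine fun j l => ⟨fun z hz => ((hu j l).1 z hz).sub ((hu' j l).1 z hz), fun Q => ?_⟩
  simp only [Pi.sub_apply, coeff_sub]
  exact ((hu j l).2 Q).sub ((hu' j l).2 Q)

theorem IsCochain₀.mono {r s : ℝ} (hu : IsCochain₀ m s u) (h : r ≤ s) : IsCochain₀ m r u := fun j =>
  HolPoly.mono (P := u j) (hu j) (Metric.ball_subset_ball h)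

/-- `K_*` only guarantees some good primitive of `δu`; the vanishing of `H⁰` makes `u` itself the
only one. As `K_*` tests coboundaries of norm one, the case `δu = 0` is separate and gives `u = 0`.
-/
theorem norm₀_le_KStar (hsplit : A.IsSplit) (hunitary : A.IsUnitary) (hH0 : A.H0Vanishes m)
    (hu : IsCochain₀ m A.rOut u) (hfin : A.norm₁ A.rOut (A.delta u) ≠ ⊤) :
    norm₀ A.rIn u ≤ A.KStar m * A.norm₁ A.rOut (A.delta u) := by
  have hδ := A.holPoly_delta hunitary hu
  have hdom := fun k j => (A.isOpen_dom le_rfl k j).measurableSet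
  by_cases h0 : A.norm₁ A.rOut (A.delta u) = 0
  · have hz : ∀ k j, ∀ z ∈ A.dom A.rOut k j, A.delta u k j z = 0 := fun k j z hz => by
      refine (hδ k j).eq_zero_of_l2norm_eq_zero (A.isOpen_dom le_rfl k j) ?_ hz
      rw [norm₁_eq] at h0
      simp only [ENNReal.iSup_eq_zero] at h0
      exact h0 k j
    have hu0 := hH0 u hu hz
    rw [norm₀_eq]
    refine iSup_le fun j => ?_
    rw [l2norm_congr (P' := fun _ => 0) measurableSet_ball
      fun z hz => hu0 j z (Metric.ball_subset_ball A.rIn_lt.le hz)]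
    refine (l2norm_le (m := m) (D := 0) measurableSet_ball (fun _ _ _ => isHomogeneous_zero _ _ _)
      fun z _ => ?_).trans ?_
    · exact (norm_le_zero_iff.2 (map_zero (tensV m)))
    · simp
  · set a := A.norm₁ A.rOut (A.delta u)
    set c : ℝ := a.toReal⁻¹
    have hc0 : 0 ≤ c := by positivity
    have hca : ENNReal.ofReal c * a = 1 := by
      rw [ENNReal.ofReal_inv_of_pos (ENNReal.toReal_pos h0 hfin), ENNReal.ofReal_toReal hfin,
        ENNReal.inv_mul_cancel h0 hfin]
    set u₁ : ι → (Fin n → ℂ) → Poly d := fun j z => (c : ℂ) • u j z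
    have hu₁ : IsCochain₀ m A.rOut u₁ := IsCochain₀.smul' hu _
    have hn : A.norm₁ A.rOut (A.delta u₁) = 1 := by
      rw [← hca, show a = _ from A.norm₁_eq _ _, norm₁_eq, ENNReal.mul_iSup]
      refine iSup_congr fun k => ?_
      rw [ENNReal.mul_iSup]
      refine iSup_congr fun j => ?_
      rw [l2norm_congr (hdom k j) fun z _ => A.delta_smul (c : ℂ) u k j z]
      exact l2norm_smul (m := m) (hdom k j) (fun z hz l => (hδ k j l).1 z hz) hc0
    have hle : ENNReal.ofReal c * norm₀ A.rIn u ≤ A.KStar m := by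
      refine le_trans ?_ (le_iSup_of_le u₁ (le_iSup_of_le hu₁ (le_iSup_of_le hn le_rfl)))
      -- Any competitor differs from the restriction of `u₁` by a closed inner cochain, hence agrees
      -- with it: the infimum is over a single cochain.
      refine le_iInf fun u₀ => le_iInf fun hu₀ => le_iInf fun heq => le_of_eq ?_
      rw [norm₀_eq, norm₀_eq, ENNReal.mul_iSup]
      refine iSup_congr fun j => ?_
      rw [← l2norm_smul (m := m) measurableSet_ball
        (fun z hz l => (hu j l).1 z (Metric.ball_subset_ball A.rIn_lt.le hz)) hc0]
      refine l2norm_congr measurableSet_ball fun z hz => ?_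
      have := A.eq_zero_of_delta_eq_zero hsplit hunitary hH0 (IsCochain₀.sub' hu₀ (hu₁.mono A.rIn_lt.le))
        (fun k j z hz => by rw [A.delta_sub, heq k j z hz, sub_self]) j hz
      exact (sub_eq_zero.1 this).symm
    calc norm₀ A.rIn u = a * (ENNReal.ofReal c * norm₀ A.rIn u) := by
          rw [← mul_assoc, mul_comm a, hca, one_mul]
      _ ≤ a * A.KStar m := by gcongr
      _ = A.KStar m * a := mul_comm _ _

theorem subst_one (P : MvPolynomial (Fin d) ℂ) : subst 1 P = P :=
  MvPolynomial.funext fun v => by rw [eval_subst, Matrix.one_mulVec]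

theorem one_le_normT [Nonempty (Fin d)] (j : ι) : 1 ≤ A.normT := by
  have h0 : (0 : Fin n → ℂ) ∈ Metric.ball (0 : Fin n → ℂ) A.rOut :=
    Metric.mem_ball_self (A.rIn_pos.trans A.rIn_lt)
  refine le_iSup_of_le j (le_iSup_of_le j (le_iSup_of_le 0 (le_iSup_of_le (A.mem_dom_self le_rfl h0) ?_)))
  rw [A.t_self h0, map_one, enorm_one]

theorem one_le_normSymT [Nonempty (Fin d)] (j : ι) : 1 ≤ A.normSymT m := by
  have h0 : (0 : Fin n → ℂ) ∈ Metric.ball (0 : Fin n → ℂ) A.rOut :=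
    Metric.mem_ball_self (A.rIn_pos.trans A.rIn_lt)
  obtain ⟨b⟩ := ‹Nonempty (Fin d)›
  let P : MvPolynomial (Fin d) ℂ := monomial (Finsupp.single b m) 1
  have hP : P.IsHomogeneous m := isHomogeneous_monomial _ (by simp)
  have hP1 : fischerSq P = 1 := by
    classical
    have hsupp : P.support = {Finsupp.single b m} := by simp [P, support_monomial]
    have h1 : ∏ i, (Finsupp.single b m i).factorial = m.factorial := by
      rw [Finset.prod_eq_single b]
      · simp
      · intro i _ hi
        simp [hi.symm]
      · simp
    have h2 : ∑ i, Finsupp.single b m i = m := by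
      rw [Finset.sum_eq_single b]
      · simp
      · intro i _ hi
        simp [hi.symm]
      · simp
    rw [fischerSq, hsupp, sum_singleton, h1, h2, div_self (by positivity)]
    simp [P]
  refine le_iSup_of_le j (le_iSup_of_le j (le_iSup_of_le 0 (le_iSup_of_le (A.mem_dom_self le_rfl h0)
    (le_iSup_of_le P (le_iSup_of_le hP (le_iSup_of_le hP1.le ?_))))))
  rw [A.t_self h0, subst_one, hP1]
  simp

theorem one_le_K [Nonempty (Fin d)] (j : ι) : 1 ≤ A.K m :=
  (A.one_le_normT j).trans le_self_add

theorem KStar_le_K [Nonempty (Fin d)] (j : ι) : A.KStar m ≤ A.K m := by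
  refine le_trans ?_ le_add_self
  calc A.KStar m = A.KStar m * 1 * 1 := by rw [mul_one, mul_one]
    _ ≤ A.KStar m * A.normT * A.normSymT m := by
        gcongr
        · exact A.one_le_normT j
        · exact A.one_le_normSymT j

/-- The cocycle relation for `δu` expresses the pair `(k, j)` through `(i, j)` and `(i, k)`, with
`i` such that the point lies in the small polydisc of index `i`. Unitary transition maps do not
increase the norms, so the bound passes from there to the full overlaps. -/
theorem vnorm_delta_le_two_mul (hsplit : A.IsSplit) (hunitary : A.IsUnitary) (hu : IsCochain₀ m A.rOut u)
    {r : ℝ} (hr : r ≤ A.rOut) (hcov : ∀ p ∈ C, ∃ i, p ∈ A.U r i) {D : ℝ}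
    (hD : ∀ i j, ∀ z ∈ Metric.ball (0 : Fin n → ℂ) A.rOut, A.pt j z ∈ A.U r i → vnorm m (A.delta u i j z) ≤ D)
    {k j : ι} {z : Fin n → ℂ} (hz : z ∈ A.dom A.rOut k j) : vnorm m (A.delta u k j z) ≤ 2 * D := by
  obtain ⟨i, hi⟩ := hcov _ (A.pt_mem (j := j) (A.ball_subset_closedBall le_rfl hz.1))
  have hij := A.mem_dom_of_mem_U hr hz.1 hi
  have hzk := A.transC_mem_ball le_rfl hz
  have hi' : A.pt k (A.transC k j z) ∈ A.U r i := by rwa [A.pt_transC hz]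
  have hik := A.transC_mem_dom le_rfl hij hz
  have ht := A.t_mul_t hsplit hij hz
  have key : act (A.t i k (A.transC k j z)) (A.delta u k j z) = A.delta u i j z -
      fun l => subst (A.t k j z) (A.delta u i k (A.transC k j z) l) := by
    refine ev_ext fun v => ?_
    have htv : ∀ v, (A.t i k (A.transC k j z)).mulVec ((A.t k j z).mulVec v) = (A.t i j z).mulVec v :=
      fun v => by rw [Matrix.mulVec_mulVec, ht]
    rw [ev_act, ev_sub, ev_subst]
    simp only [delta, ev_sub, ev_act, ev_subst, Matrix.mulVec_sub, htv, A.transC_transC hz]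
    abel
  rw [← vnorm_act _ (hunitary i k _ hik), key]
  have h1 := vnorm_subst_le (fun l => (A.holPoly_delta hunitary hu i k l).1 _ hik) (hunitary k j z hz)
  linarith [vnorm_sub_le m (A.delta u i j z) fun l => subst (A.t k j z) (A.delta u i k (A.transC k j z) l),
    hD i j z hz.1 hi, hD i k _ hzk hi']

theorem exists_small_divisor_bound (hsplit : A.IsSplit) (hunitary : A.IsUnitary) [Nonempty (Fin d)]
    {r : ℝ} (hr : r < A.rIn) (hcov : ∀ p ∈ C, ∃ i, p ∈ A.U r i) :
    ∃ c : ℝ, 0 ≤ c ∧ ∀ m, A.H0Vanishes m → A.K m ≠ ⊤ → ∀ u, IsCochain₀ m A.rOut u → ∀ D : ℝ, 0 ≤ D →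
      (∀ i j, ∀ z ∈ Metric.ball (0 : Fin n → ℂ) A.rOut, A.pt j z ∈ A.U r i →
        vnorm m (A.delta u i j z) ≤ D) →
      ∀ j, ∀ z ∈ Metric.ball (0 : Fin n → ℂ) A.rOut, vnorm m (u j z) ≤ c * (A.K m).toReal * D := by
  set V := volume (Metric.ball (0 : Fin n → ℂ) (A.rIn - r))
  set W := volume (Metric.ball (0 : Fin n → ℂ) A.rOut)
  have hV0 : V ≠ 0 := (Metric.measure_ball_pos _ _ (sub_pos.2 hr)).ne'
  have hV : V ≠ ⊤ := measure_ball_lt_top.ne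
  have hW : W ≠ ⊤ := measure_ball_lt_top.ne
  set c : ℝ≥0∞ := V⁻¹ * V ^ (1 / 2 : ℝ) * W ^ (1 / 2 : ℝ)
  have hc : c ≠ ⊤ := by
    refine ENNReal.mul_ne_top (ENNReal.mul_ne_top (ENNReal.inv_ne_top.2 hV0) ?_) ?_
    · exact ENNReal.rpow_ne_top_of_nonneg (by norm_num) hV
    · exact ENNReal.rpow_ne_top_of_nonneg (by norm_num) hW
  -- The 2 comes from `vnorm_delta_le_two_mul`. The 1 pays for `δu` itself when `u_j` is recovered
  -- on the full polydisc from `u_i` on the polydisc of radius `r`; it fits into the bound because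
  -- `1 ≤ K`.
  refine ⟨1 + c.toReal * 2, by positivity, fun m hH0 hK u hu D hD0 hD j z hz => ?_⟩
  have hrO : r ≤ A.rOut := hr.le.trans A.rIn_lt.le
  have hn : A.norm₁ A.rOut (A.delta u) ≤ ENNReal.ofReal (2 * D) * W ^ (1 / 2 : ℝ) := by
    rw [norm₁_eq]
    refine iSup_le fun k => iSup_le fun j => ?_
    refine (l2norm_le (m := m) (A.isOpen_dom le_rfl k j).measurableSet
      (fun z hz l => (A.holPoly_delta hunitary hu k j l).1 z hz) 
      fun z hz => A.vnorm_delta_le_two_mul hsplit hunitary hu hrO hcov hD hz).trans ?_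
    gcongr
    exact measure_mono (A.dom_subset_ball _ _ _)
  have hfin : A.norm₁ A.rOut (A.delta u) ≠ ⊤ := ne_top_of_le_ne_top
    (ENNReal.mul_ne_top ENNReal.ofReal_ne_top (ENNReal.rpow_ne_top_of_nonneg (by norm_num) hW)) hn
  have hK1 : 1 ≤ (A.K m).toReal := by
    rw [← ENNReal.toReal_one]
    exact ENNReal.toReal_mono hK (A.one_le_K j)
  have hinner : ∀ i, ∀ y ∈ Metric.ball (0 : Fin n → ℂ) r,
      vnorm m (u i y) ≤ c.toReal * 2 * (A.K m).toReal * D := by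
    intro i y hy
    have hsub : Metric.ball y (A.rIn - r) ⊆ Metric.ball 0 A.rIn := by
      refine Metric.ball_subset_ball' ?_
      rw [Metric.mem_ball] at hy
      linarith
    have h1 := volume_mul_vnorm_le ((show HolPoly m (Metric.ball 0 A.rIn) (u i) from
      hu.mono A.rIn_lt.le i).mono hsub)
    have hVy : volume (Metric.ball y (A.rIn - r)) = V := Measure.addHaar_ball_center volume y _
    rw [hVy] at h1
    have h2 : l2norm (Metric.ball y (A.rIn - r)) (u i) ≤
        A.K m * (ENNReal.ofReal (2 * D) * W ^ (1 / 2 : ℝ)) := by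
      refine (l2norm_mono hsub).trans ?_
      refine le_trans (le_iSup (fun j => l2norm (Metric.ball 0 A.rIn) (u j)) i) ?_
      refine (A.norm₀_le_KStar hsplit hunitary hH0 hu hfin).trans ?_
      gcongr
      exact A.KStar_le_K j
    have h3 : ENNReal.ofReal (vnorm m (u i y)) ≤ c * A.K m * ENNReal.ofReal (2 * D) := by
      calc ENNReal.ofReal (vnorm m (u i y)) = V⁻¹ * (V * ENNReal.ofReal (vnorm m (u i y))) := by
            rw [← mul_assoc, ENNReal.inv_mul_cancel hV0 hV, one_mul]
        _ ≤ V⁻¹ * (A.K m * (ENNReal.ofReal (2 * D) * W ^ (1 / 2 : ℝ)) * V ^ (1 / 2 : ℝ)) := by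
            exact mul_le_mul_right (h1.trans (mul_le_mul_left h2 _)) _
        _ = c * A.K m * ENNReal.ofReal (2 * D) := by simp only [c]; ring
    have h4 := ENNReal.toReal_mono (ENNReal.mul_ne_top (ENNReal.mul_ne_top hc hK) ENNReal.ofReal_ne_top) h3
    rw [ENNReal.toReal_ofReal (vnorm_nonneg _ _), ENNReal.toReal_mul, ENNReal.toReal_mul,
      ENNReal.toReal_ofReal (by positivity)] at h4
    linarith
  obtain ⟨i, hi⟩ := hcov _ (A.pt_mem (j := j) (A.ball_subset_closedBall le_rfl hz))
  have hij := A.mem_dom_of_mem_U hrO hz hi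
  have key : act (A.t i j z) (u j z) = A.delta u i j z + fun l => subst (A.t i j z) (u i (A.transC i j z) l) := by
    rw [delta, sub_add_cancel]
  have h1 := vnorm_subst_le (fun l => (hu i l).1 _ (A.transC_mem_ball le_rfl hij)) (hunitary i j z hij)
  have h2 := hinner i _ hi.2.2
  have h3 := hD i j z hz hi
  rw [← vnorm_act _ (hunitary i j z hij), key]
  have h4 := vnorm_add_le m (A.delta u i j z) fun l => subst (A.t i j z) (u i (A.transC i j z) l)
  have h5 : vnorm m (u i (A.transC i j z)) ≤ c.toReal * 2 * (A.K m).toReal * D := h2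
  have h6 : D ≤ (A.K m).toReal * D := le_mul_of_one_le_left hD0 hK1
  linarith

end AdaptedAtlas

end VertLin

end

/-! ### Convolution weights and the majorant sequence. -/

noncomputable section

namespace VertLin

open MvPolynomial Finset Filter Asymptotics

section Weights

variable {d m : ℕ} {w : ℕ → ℝ}

/-- The components of `P` of degree at most `m` are bounded by a multiple of the weights `w`. -/
def Bd (w : ℕ → ℝ) (m : ℕ) (γ : ℝ) (P : MvPolynomial (Fin d) ℂ) : Prop := ∀ i ≤ m, fnorm i P ≤ γ * w i

theorem fnorm_C_mul (i : ℕ) (c : ℂ) (P : MvPolynomial (Fin d) ℂ) : fnorm i (C c * P) = ‖c‖ * fnorm i P := by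
  rw [C_mul', fnorm, map_smul, norm_smul, fnorm]

theorem Bd.mono (hw : ∀ i, 0 ≤ w i) {γ γ' : ℝ} {P : MvPolynomial (Fin d) ℂ} (h : Bd w m γ P) (hγ : γ ≤ γ') :
    Bd w m γ' P := fun i hi => (h i hi).trans (mul_le_mul_of_nonneg_right hγ (hw i))

theorem Bd.sum {κ : Type*} (s : Finset κ) {γ : κ → ℝ} {P : κ → MvPolynomial (Fin d) ℂ}
    (h : ∀ k ∈ s, Bd w m (γ k) (P k)) : Bd w m (∑ k ∈ s, γ k) (∑ k ∈ s, P k) := fun i hi => by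
  refine (fnorm_sum_le _ _ _).trans ?_
  rw [sum_mul]
  exact sum_le_sum fun k hk => h k hk i hi

theorem Bd.C_mul {γ : ℝ} {P : MvPolynomial (Fin d) ℂ} (h : Bd w m γ P) (c : ℂ) :
    Bd w m (‖c‖ * γ) (C c * P) := fun i hi => by
  rw [fnorm_C_mul, mul_assoc]
  exact mul_le_mul_of_nonneg_left (h i hi) (norm_nonneg _)

variable (hw0 : ∀ i, 0 ≤ w i)
  (hw : ∀ i ≤ m, ∑ a ∈ HasAntidiagonal.antidiagonal i, w a.1 * w a.2 ≤ w i)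

include hw0 hw in
-- The Cauchy product of the two bounds is controlled by `w * w ≤ w`, so products of polynomials
-- keep the same weights and only the constants multiply.
theorem Bd.mul {γ γ' : ℝ} {P Q : MvPolynomial (Fin d) ℂ} (hP : Bd w m γ P) (hQ : Bd w m γ' Q)
    (hγ : 0 ≤ γ) (hγ' : 0 ≤ γ') : Bd w m (γ * γ') (P * Q) := fun i hi => by
  refine (fnorm_mul_le _ _ _).trans ?_
  calc ∑ a ∈ HasAntidiagonal.antidiagonal i, fnorm a.1 P * fnorm a.2 Q
      ≤ ∑ a ∈ HasAntidiagonal.antidiagonal i, (γ * w a.1) * (γ' * w a.2) := by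
        refine sum_le_sum fun a ha => ?_
        have := HasAntidiagonal.mem_antidiagonal.1 ha
        exact mul_le_mul (hP _ (by omega)) (hQ _ (by omega)) (fnorm_nonneg _ _) (mul_nonneg hγ (hw0 _))
    _ = γ * γ' * ∑ a ∈ HasAntidiagonal.antidiagonal i, w a.1 * w a.2 := by
        rw [mul_sum]; exact sum_congr rfl fun _ _ => by ring
    _ ≤ γ * γ' * w i := mul_le_mul_of_nonneg_left (hw i hi) (mul_nonneg hγ hγ')

include hw0 hw in
-- Empty products are excluded: they would need `1 ≤ w 0`, while the weights used later have `w 0 =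
-- 1 / 8`.
theorem Bd.prod {a : ℕ} {γ : ℝ} (hγ : 0 ≤ γ) {Y : Fin a → MvPolynomial (Fin d) ℂ}
    (hY : ∀ b, Bd w m γ (Y b)) {k : ℕ} (hk : 1 ≤ k) (s : Fin k → Fin a) :
    Bd w m (γ ^ k) (∏ l, Y (s l)) := by
  induction k, hk using Nat.le_induction with
  | base => simpa using hY (s 0)
  | succ k hk ih =>
    rw [Fin.prod_univ_succ, pow_succ']
    exact Bd.mul hw0 hw (hY _) (ih fun l => s l.succ) hγ (pow_nonneg hγ k)

include hw0 hw in
theorem Bd.mlPoly {a : ℕ} {γ : ℝ} (hγ : 0 ≤ γ) {Y : Fin a → MvPolynomial (Fin d) ℂ}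
    (hY : ∀ b, Bd w m γ (Y b)) {k : ℕ} (hk : 1 ≤ k) {p : (Fin k → Fin a) → ℂ} {B : ℝ}
    (hp : ∀ s, ‖p s‖ ≤ B) : Bd w m (B * (a * γ) ^ k) (mlPoly p Y) := by
  have h := Bd.sum univ fun s _ => (Bd.prod hw0 hw hγ hY hk s).C_mul (p s)
  refine h.mono hw0 ?_
  calc ∑ s, ‖p s‖ * γ ^ k ≤ ∑ _s : Fin k → Fin a, B * γ ^ k :=
        sum_le_sum fun s _ => mul_le_mul_of_nonneg_right (hp s) (pow_nonneg hγ k)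
    _ = B * (a * γ) ^ k := by
        rw [sum_const, card_univ, Fintype.card_fun, Fintype.card_fin, Fintype.card_fin, nsmul_eq_mul,
          mul_pow]
        push_cast; ring

theorem sum_Icc_pow_le {x : ℝ} (h0 : 0 ≤ x) (h1 : x ≤ 1 / 2) (k N : ℕ) :
    ∑ κ ∈ Icc k N, x ^ κ ≤ 2 * x ^ k := by
  have hx1 : x < 1 := by linarith
  calc ∑ κ ∈ Icc k N, x ^ κ ≤ ∑ κ ∈ Ico k (N + 1), x ^ κ := by
        rw [show Icc k N = Ico k (N + 1) from by ext; simp]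
    _ ≤ x ^ k / (1 - x) := geom_sum_Ico_le_of_lt_one h0 hx1
    _ ≤ 2 * x ^ k := by
        rw [div_le_iff₀ (by linarith)]
        nlinarith [pow_nonneg h0 k]

theorem sum_inv_sq_le (N : ℕ) : ∑ k ∈ range (N + 1), 1 / ((k : ℝ) + 1) ^ 2 ≤ 2 - 1 / ((N : ℝ) + 1) := by
  induction N with
  | zero => norm_num
  | succ N ih =>
    rw [sum_range_succ]
    push_cast
    have h : 1 / ((N : ℝ) + 1 + 1) ^ 2 ≤ 1 / ((N : ℝ) + 1) - 1 / ((N : ℝ) + 1 + 1) := by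
      rw [div_sub_div _ _ (by positivity) (by positivity), div_le_div_iff₀ (by positivity) (by positivity)]
      nlinarith [(Nat.cast_nonneg N : (0 : ℝ) ≤ N)]
    linarith

/-- A sequence of weights that is essentially submultiplicative for the convolution product. -/
def convWeight (R : ℝ) (i : ℕ) : ℝ := R ^ i / (8 * ((i : ℝ) + 1) ^ 2)

theorem convWeight_nonneg {R : ℝ} (hR : 0 ≤ R) (i : ℕ) : 0 ≤ convWeight R i := by
  rw [convWeight]; positivity

/-- With `x = a + 1` and `y = b + 1`, `1 / (xy)² = (1/x + 1/y)² / (x + y)² ≤ 2 (1/x² + 1/y²) / (x +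
y)²`, and each sum of inverse squares is at most 2. The factor 8 in `convWeight` makes the final
constant equal to one. -/
theorem sum_convWeight_le {R : ℝ} (hR : 0 ≤ R) (i : ℕ) :
    ∑ a ∈ HasAntidiagonal.antidiagonal i, convWeight R a.1 * convWeight R a.2 ≤ convWeight R i := by
  have h1 : ∀ a ∈ HasAntidiagonal.antidiagonal i, convWeight R a.1 * convWeight R a.2 ≤
      R ^ i / (32 * ((i : ℝ) + 2) ^ 2) * (1 / ((a.1 : ℝ) + 1) ^ 2 + 1 / ((a.2 : ℝ) + 1) ^ 2) := by
    rintro ⟨a, b⟩ hab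
    obtain rfl := HasAntidiagonal.mem_antidiagonal.1 hab
    simp only [convWeight]
    push_cast
    have hx : (0 : ℝ) < a + 1 := by positivity
    have hy : (0 : ℝ) < b + 1 := by positivity
    have e1 : R ^ a / (8 * ((a : ℝ) + 1) ^ 2) * (R ^ b / (8 * ((b : ℝ) + 1) ^ 2)) =
        R ^ (a + b) * (1 / (64 * ((a + 1) * (b + 1)) ^ 2)) := by
      rw [pow_add]; field_simp; ring
    have e2 : R ^ (a + b) / (32 * ((a : ℝ) + b + 2) ^ 2) * (1 / ((a : ℝ) + 1) ^ 2 + 1 / ((b : ℝ) + 1) ^ 2) =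
        R ^ (a + b) * (((a + 1) ^ 2 + (b + 1) ^ 2) / (32 * ((a + b + 2) * ((a + 1) * (b + 1))) ^ 2)) := by
      field_simp
      ring
    rw [e1, e2]
    refine mul_le_mul_of_nonneg_left ?_ (pow_nonneg hR _)
    rw [div_le_div_iff₀ (by positivity) (by positivity)]
    have : (((a : ℝ) + b + 2)) ^ 2 ≤ 2 * ((a + 1) ^ 2 + (b + 1) ^ 2) := by
      nlinarith [sq_nonneg ((a : ℝ) - b)]
    nlinarith [mul_le_mul_of_nonneg_right this (sq_nonneg (((a : ℝ) + 1) * (b + 1)))]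
  have h2 : ∑ a ∈ HasAntidiagonal.antidiagonal i, 1 / ((a.1 : ℝ) + 1) ^ 2 ≤ 2 := by
    rw [Nat.sum_antidiagonal_eq_sum_range_succ (fun a _ => 1 / ((a : ℝ) + 1) ^ 2)]
    refine (sum_inv_sq_le i).trans ?_
    have : 0 ≤ 1 / ((i : ℝ) + 1) := by positivity
    linarith
  have h3 : ∑ a ∈ HasAntidiagonal.antidiagonal i, 1 / ((a.2 : ℝ) + 1) ^ 2 ≤ 2 := by
    rwa [← Nat.sum_antidiagonal_swap (f := fun a => 1 / ((a.2 : ℝ) + 1) ^ 2)]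
  refine (sum_le_sum h1).trans ?_
  rw [← mul_sum, sum_add_distrib]
  calc R ^ i / (32 * ((i : ℝ) + 2) ^ 2) * (_ + _) ≤ R ^ i / (32 * ((i : ℝ) + 2) ^ 2) * (2 + 2) := by gcongr
    _ = R ^ i / (8 * ((i : ℝ) + 2) ^ 2) := by field_simp; ring
    _ ≤ convWeight R i := by
        rw [convWeight]
        gcongr
        norm_num

end Weights

section Theta

/-- The supremum in the definition of `eta`, for parts smaller than `m` and total weight `i`. -/
def theta (K : ℕ → ℝ≥0∞) (m i : ℕ) : ℝ≥0∞ :=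
  ⨆ (p : ℕ) (s : ℕ) (c : Fin p → {i : ℕ // 1 ≤ i ∧ i < m}) (_ : (∑ i, (c i : ℕ)) + s = i), ∏ i, eta K (c i)

variable {K : ℕ → ℝ≥0∞} {m : ℕ}

theorem eta_eq (hm : 1 < m) : eta K m = K m * theta K m m := by
  rw [eta, if_neg (by omega), theta]

theorem prod_le_theta {p s i : ℕ} (c : Fin p → {i : ℕ // 1 ≤ i ∧ i < m}) (h : (∑ i, (c i : ℕ)) + s = i) :
    ∏ i, eta K (c i) ≤ theta K m i :=
  le_iSup_of_le p (le_iSup_of_le s (le_iSup_of_le c (le_iSup_of_le h le_rfl)))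

theorem one_le_theta (i : ℕ) : 1 ≤ theta K m i := by
  simpa using prod_le_theta (K := K) (m := m) (p := 0) (s := i) (i := i) (fun x => x.elim0) (by simp)

theorem eta_le_theta {i : ℕ} (h1 : 1 ≤ i) (h2 : i < m) : eta K i ≤ theta K m i := by
  simpa using prod_le_theta (K := K) (m := m) (p := 1) (s := 0) (i := i) (fun _ => ⟨i, h1, h2⟩) (by simp)

/-- Two admissible families are concatenated and their slacks added. -/
theorem theta_mul_le (i j : ℕ) : theta K m i * theta K m j ≤ theta K m (i + j) := by
  simp only [theta, ENNReal.iSup_mul, ENNReal.mul_iSup]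
  refine iSup_le fun p => iSup_le fun s => iSup_le fun c => iSup_le fun h => ?_
  refine iSup_le fun p' => iSup_le fun s' => iSup_le fun c' => iSup_le fun h' => ?_
  have := prod_le_theta (K := K) (s := s + s') (i := i + j) (Fin.append c c') (by
    rw [Fin.sum_univ_add]
    simp only [Fin.append_left, Fin.append_right]
    omega)
  rw [Fin.prod_univ_add] at this
  simp only [Fin.append_left, Fin.append_right] at this
  rw [mul_comm]
  exact this

/-- The slack `s` allows the empty family, so every `theta` is at least one; submultiplicativity
then gives monotonicity. -/
theorem theta_mono {i j : ℕ} (h : i ≤ j) : theta K m i ≤ theta K m j := by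
  obtain ⟨k, rfl⟩ := Nat.exists_eq_add_of_le h
  exact (le_mul_of_one_le_right' (one_le_theta k)).trans (theta_mul_le i k)

theorem theta_le_eta (hm : 1 < m) (hK : 1 ≤ K m) : theta K m m ≤ eta K m := by
  rw [eta_eq hm]
  exact le_mul_of_one_le_left' hK

theorem le_eta (hm : 1 < m) : K m ≤ eta K m := by
  rw [eta_eq hm]
  exact le_mul_of_one_le_right' (one_le_theta m)

end Theta

end VertLin

end

/-! ### The recursion for the coefficients. -/

noncomputable section

namespace VertLin

open MvPolynomial Finset Filter Asymptotics

section Expansion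

variable {n d : ℕ}

/-- The polynomial `v + ∑_{2 ≤ q ≤ N} f_q(z, v)`. -/
def yPoly (f : ℕ → (Fin n → ℂ) → Poly d) (N : ℕ) (z : Fin n → ℂ) : Poly d :=
  fun b => X b + ∑ q ∈ Icc 2 N, f q z b

/-- The vertical components of the terms of degree `2, …, N + 1` of the Taylor expansion of `g` at
`c`, evaluated at `y`. -/
def vertTerms (g : Model n d → Model n d) (c : Model n d) (N : ℕ) (y : Poly d) : Poly d :=
  fun l => ∑ κ ∈ Icc 2 (N + 1), mlPoly (fun s => (taylor g c κ fun a => vert n (s a)).2 l) y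

/-- The horizontal components of the terms of degree `2, …, N + 1` of the Taylor expansion of `g` at
`c`, evaluated at `y`. -/
def horTerms (g : Model n d → Model n d) (c : Model n d) (N : ℕ) (y : Poly d) :
    Fin n → MvPolynomial (Fin d) ℂ :=
  fun b => ∑ κ ∈ Icc 2 (N + 1), mlPoly (fun s => (taylor g c κ fun a => vert n (s a)).1 b) y

/-- The coefficients of the Taylor expansion at `φ` of `∑_{2 ≤ q ≤ N} f_q(·, T v)`. -/
def coeffPoly (f : ℕ → (Fin n → ℂ) → Poly d) (N : ℕ) (φ : Fin n → ℂ) (T : Matrix (Fin d) (Fin d) ℂ)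
    (κ : ℕ) (s : Fin κ → Fin n) : Poly d :=
  fun l => ∑ q ∈ Icc 2 N,
    subst T (ofTensV q (taylor (fun z => tensV q (f q z)) φ κ fun a => Pi.single (s a) 1) l)

/-- The terms of degree `1, …, N + 1` in `Z` of the Taylor expansion of `∑_{2 ≤ q ≤ N} f_q(φ + Z, T v)`. -/
def compTerms (f : ℕ → (Fin n → ℂ) → Poly d) (N : ℕ) (φ : Fin n → ℂ) (T : Matrix (Fin d) (Fin d) ℂ)
    (Z : Fin n → MvPolynomial (Fin d) ℂ) : Poly d :=
  fun l => ∑ κ ∈ Icc 1 (N + 1), ∑ s : Fin κ → Fin n, coeffPoly f N φ T κ s l * ∏ a, Z (s a)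

theorem taylor_vert_eq (g : Model n d → Model n d) (c : Model n d) (κ : ℕ) (w : Fin d → ℂ) :
    taylor g c κ (fun _ => (0, w)) =
      ∑ s : Fin κ → Fin d, (∏ a, w (s a)) • taylor g c κ fun a => vert n (s a) := by
  rw [← sum_smul_vert (n := n) w]
  exact multilinear_diag_eq _ _ _

theorem eval_mlPoly {a k : ℕ} (p : (Fin k → Fin a) → ℂ) (Y : Fin a → MvPolynomial (Fin d) ℂ) (v : Fin d → ℂ) :
    eval v (mlPoly p Y) = ∑ s, p s * ∏ l, eval v (Y (s l)) := by
  simp [mlPoly, map_sum, map_prod]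

theorem sum_taylor_vert_eq (g : Model n d → Model n d) (c : Model n d) (N : ℕ) (y : Poly d) (v : Fin d → ℂ) :
    ∑ κ ∈ Icc 2 (N + 1), taylor g c κ (fun _ => (0, ev y v)) =
      ((fun b => eval v (horTerms g c N y b)), ev (vertTerms g c N y) v) := by
  simp only [taylor_vert_eq]
  refine Prod.ext ?_ ?_
  · ext b
    simp only [Prod.fst_sum, Prod.smul_fst, Finset.sum_apply, Pi.smul_apply, smul_eq_mul, horTerms,
      map_sum, eval_mlPoly, ev]
    exact sum_congr rfl fun κ _ => sum_congr rfl fun s _ => mul_comm _ _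
  · ext b
    simp only [Prod.snd_sum, Prod.smul_snd, Finset.sum_apply, Pi.smul_apply, smul_eq_mul, vertTerms,
      map_sum, eval_mlPoly, ev]
    exact sum_congr rfl fun κ _ => sum_congr rfl fun s _ => mul_comm _ _

theorem ev_compTerms (f : ℕ → (Fin n → ℂ) → Poly d) (N : ℕ) (φ : Fin n → ℂ) (T : Matrix (Fin d) (Fin d) ℂ)
    (Z : Fin n → MvPolynomial (Fin d) ℂ) (v : Fin d → ℂ) :
    ev (compTerms f N φ T Z) v = ∑ q ∈ Icc 2 N, ∑ κ ∈ Icc 1 (N + 1),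
      ev (ofTensV q (taylor (fun z => tensV q (f q z)) φ κ fun _ b => eval v (Z b))) (T.mulVec v) := by
  have h : ∀ q κ, ev (ofTensV q (taylor (fun z => tensV q (f q z)) φ κ fun _ b => eval v (Z b))) (T.mulVec v) =
      ∑ s : Fin κ → Fin n, (∏ a, eval v (Z (s a))) •
        ev (ofTensV q (taylor (fun z => tensV q (f q z)) φ κ fun a => Pi.single (s a) 1)) (T.mulVec v) := by
    intro q κ
    have e : (fun b => eval v (Z b)) = ∑ b, eval v (Z b) • (Pi.single b 1 : Fin n → ℂ) := by
      ext b; simp [Finset.sum_apply, Pi.single_apply]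
    rw [e, multilinear_diag_eq, map_sum, ev_sum]
    exact sum_congr rfl fun s _ => by rw [map_smul, ev_smul]
  simp only [h]
  ext l
  simp only [ev, compTerms, coeffPoly, map_sum, map_mul, map_prod, Finset.sum_apply, Pi.smul_apply,
    smul_eq_mul, eval_subst, Finset.sum_mul]
  symm
  exact sum_comm.trans (sum_congr rfl fun κ _ => sum_comm.trans
    (sum_congr rfl fun s _ => sum_congr rfl fun q _ => mul_comm _ _))

end Expansion

namespace AdaptedAtlas

variable {n d : ℕ} {M : Type*} [TopologicalSpace M] [ChartedSpace (Model n d) M]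
  [IsManifold 𝓘(ℂ, Model n d) ω M] {C : Set M} {ι : Type*} (A : AdaptedAtlas n d M C ι)
  {f : ι → ℕ → (Fin n → ℂ) → Poly d} {N : ℕ} {i j : ι} {z : Fin n → ℂ}

variable (f N i j z) in
/-- The horizontal terms of degree at least two of the transition function at `z`. -/
def horPoly : Fin n → MvPolynomial (Fin d) ℂ := horTerms (A.Trans i j) (z, 0) N (yPoly (f j) N z)

variable (f N i j z) in
/-- The vertical terms of degree at least two of the transition function at `z`. -/
def vertPoly : Poly d := vertTerms (A.Trans i j) (z, 0) N (yPoly (f j) N z)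

variable (f N i j z) in
/-- The terms of `∑_{2 ≤ q ≤ N} f_q` at the horizontal component of the transition function that come from
the horizontal terms of degree at least two. -/
def compPoly : Poly d := compTerms (f i) N (A.transC i j z) (A.t i j z) (A.horPoly f N i j z)

theorem ev_yPoly (f : ℕ → (Fin n → ℂ) → Poly d) (N : ℕ) (z : Fin n → ℂ) (v : Fin d → ℂ) :
    ev (yPoly f N z) v = vmap f N (z, v) := by
  ext b
  simp [ev, yPoly, vmap, Finset.sum_apply]

theorem isBigO_vmap (hf : ∀ j q, HolPoly q (Metric.ball 0 A.rOut) (f j q)) {z : Fin n → ℂ}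
    (hz : z ∈ Metric.ball (0 : Fin n → ℂ) A.rOut) :
    (fun v => vmap (f j) N (z, v)) =O[𝓝 0] fun v : Fin d → ℂ => ‖v‖ := by
  have hid : Tendsto (fun v : Fin d → ℂ => v) (𝓝 0) (𝓝 0) := tendsto_id
  have h1 := (isBigO_vmap_sub (N := N) (fun q _ => hf j q) hz tendsto_const_nhds hid).trans
    (isBigO_pow_norm hid one_le_two)
  simp only [pow_one] at h1
  exact (h1.add (isBigO_refl (fun v : Fin d → ℂ => v) _).norm_right).congr_left fun v => sub_add_cancel _ _

/-- Taylor's formula at `(z, 0)` in vertical directions. By the splitting the linear term is purely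
vertical, so the horizontal correction starts in degree two. -/
theorem isBigO_trans_sub (hsplit : A.IsSplit) (hf : ∀ j q, HolPoly q (Metric.ball 0 A.rOut) (f j q))
    (hz : z ∈ A.dom A.rOut i j) :
    (fun v => A.Trans i j (z, vmap (f j) N (z, v)) -
      (A.transC i j z + fun b => eval v (A.horPoly f N i j z b),
        (A.t i j z).mulVec (vmap (f j) N (z, v)) + ev (A.vertPoly f N i j z) v)) =O[𝓝 0]
      fun v => ‖v‖ ^ (N + 2) := by
  have hid : Tendsto (fun v : Fin d → ℂ => v) (𝓝 0) (𝓝 0) := tendsto_id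
  have hy := tendsto_vmap (N := N) (fun q _ => hf j q) hz.1 (tendsto_const_nhds (f := 𝓝 (0 : Fin d → ℂ))) hid
  have h1 := isBigO_sub_sum_taylor (A.analyticAt_trans_mk hz) (N + 1) ((tendsto_mk 0).comp hy)
  have h2 : (fun v => ‖((0, vmap (f j) N (z, v)) : Model n d)‖ ^ (N + 1 + 1)) =O[𝓝 0]
      fun v => ‖v‖ ^ (N + 2) := by
    refine IsBigO.pow ?_ (N + 2)
    refine (IsBigO.norm_left ?_)
    refine IsBigO.trans (IsBigO.of_bound 1 (Eventually.of_forall fun v => ?_)) (A.isBigO_vmap hf hz.1 (j := j) (N := N))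
    simp [Prod.norm_def]
  refine (h1.trans h2).congr_left fun v => ?_
  have h3 : range (N + 1 + 1) = insert 0 (insert 1 (Icc 2 (N + 1))) := by
    ext q; simp only [mem_range, mem_insert, mem_Icc]; omega
  simp only [Function.comp_apply]
  rw [h3, sum_insert (by simp), sum_insert (by simp), ← ev_yPoly, sum_taylor_vert_eq]
  have h4 : taylor (A.Trans i j) (z, 0) 0 (fun _ => (0, ev (yPoly (f j) N z) v)) = (A.transC i j z, 0) := by
    simp [taylor, A.trans_zero hz]
  have h5 : taylor (A.Trans i j) (z, 0) 1 (fun _ => (0, ev (yPoly (f j) N z) v)) =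
      (0, (A.t i j z).mulVec (ev (yPoly (f j) N z) v)) := by
    simp [taylor, A.fderiv_trans_apply hsplit hz]
  rw [h4, h5]
  simp only [horPoly, vertPoly, Prod.mk_add_mk, add_zero, zero_add]

/-- Each `f_{i,q}` is expanded in its base point around `φ = transC i j z`. The constant terms
combine with `t f_{j,q}` into the coboundaries, and the terms that involve the horizontal
displacement `Z` make up `compPoly`. -/
theorem isBigO_rem_sub (hsplit : A.IsSplit) (hf : ∀ j q, HolPoly q (Metric.ball 0 A.rOut) (f j q))
    (hz : z ∈ A.dom A.rOut i j) :
    (fun v => A.rem f N i j (z, v) - ev (∑ q ∈ Icc 2 N, A.delta (fun j => f j q) i j z +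
      A.vertPoly f N i j z - A.compPoly f N i j z) v) =O[𝓝 0] fun v => ‖v‖ ^ (N + 2) := by
  have hid : Tendsto (fun v : Fin d → ℂ => v) (𝓝 0) (𝓝 0) := tendsto_id
  have hconst := tendsto_const_nhds (x := z) (f := 𝓝 (0 : Fin d → ℂ))
  have hy := tendsto_vmap (N := N) (fun q _ => hf j q) hz.1 hconst hid
  have hφ := A.transC_mem_ball le_rfl hz
  set φ := A.transC i j z
  set T := A.t i j z
  set Z : (Fin d → ℂ) → Fin n → ℂ := fun v b => eval v (A.horPoly f N i j z b)
  have hexp := A.isBigO_trans_sub (N := N) hsplit hf hz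
  have h1 : (fun v => (A.Trans i j (z, vmap (f j) N (z, v))).1 - (φ + Z v)) =O[𝓝 0] fun v => ‖v‖ ^ (N + 2) :=
    (isBigO_fst_prod'.trans hexp).congr_left fun v => by simp only [Prod.fst_sub]; rfl
  have h2 : (fun v => (A.Trans i j (z, vmap (f j) N (z, v))).2 -
      (T.mulVec (vmap (f j) N (z, v)) + ev (A.vertPoly f N i j z) v)) =O[𝓝 0] fun v => ‖v‖ ^ (N + 2) :=
    (isBigO_snd_prod'.trans hexp).congr_left fun v => by simp only [Prod.snd_sub]; rfl
  have ha : Tendsto (fun v => (A.Trans i j (z, vmap (f j) N (z, v))).1) (𝓝 0) (𝓝 φ) :=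
    A.tendsto_trans_fst hz hconst hy
  have hpow : (fun v : Fin d → ℂ => ‖v‖ ^ (N + 2)) =O[𝓝 0] fun v => ‖v‖ := by
    simpa only [pow_one] using isBigO_pow_norm hid (by omega : 1 ≤ N + 2)
  have haO : (fun v => (A.Trans i j (z, vmap (f j) N (z, v))).1 - φ) =O[𝓝 0] fun v => ‖v‖ := by
    have h := isBigO_sub_of_analyticAt (A.analyticAt_trans_mk hz) (hconst.prodMk_nhds hy)
      (tendsto_const_nhds (x := ((z, 0) : Model n d)))
    have h' := (isBigO_fst_prod'.trans h).trans (IsBigO.trans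
      (IsBigO.of_bound 1 (Eventually.of_forall fun v => ?_)) (A.isBigO_vmap hf hz.1 (j := j) (N := N)))
    · refine h'.congr_left fun v => ?_
      simp only [Prod.fst_sub]
      rfl
    · simp [Prod.norm_def]
  have hZO : Z =O[𝓝 0] fun v => ‖v‖ :=
    (haO.sub (h1.trans hpow)).congr_left fun v => by abel
  have hZ : Tendsto Z (𝓝 0) (𝓝 0) := hZO.trans_tendsto (by simpa using hid.norm)
  have hφZ : Tendsto (fun v => φ + Z v) (𝓝 0) (𝓝 φ) := by simpa using hZ.const_add φ
  have hq : ∀ q ∈ Icc 2 N, (fun v => ev (f i q (A.Trans i j (z, vmap (f j) N (z, v))).1) (T.mulVec v) -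
      (ev (f i q φ) (T.mulVec v) + ∑ κ ∈ Icc 1 (N + 1),
        ev (ofTensV q (taylor (fun z => tensV q (f i q z)) φ κ fun _ => Z v)) (T.mulVec v))) =O[𝓝 0]
      fun v => ‖v‖ ^ (N + 2) := by
    intro q _
    have hanal : AnalyticAt ℂ (fun z => tensV q (f i q z)) φ :=
      analyticOnNhd_of_differentiableOn Metric.isOpen_ball (hf i q).differentiableOn_tensV φ hφ
    have h3 := (isBigO_sub_of_analyticAt hanal ha hφZ).trans h1
    have h4 := (isBigO_sub_sum_taylor hanal (N + 1) hZ).trans (hZO.norm_left.pow (N + 1 + 1))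
    have h5 := h3.add h4
    have h6 : (fun v => ((d : ℝ) * ‖T.mulVec v‖) ^ q) =O[𝓝 0] fun _ => (1 : ℝ) :=
      (((tendsto_mulVec T hid).norm.const_mul (d : ℝ)).pow q).isBigO_one ℝ
    have h7 := h5.norm_left.mul h6
    simp only [mul_one] at h7
    refine (IsBigO.of_bound 1 (Eventually.of_forall fun v => ?_) |>.trans h7).congr'
      (f₁ := fun v => ev (ofTensV q (tensV q (f i q (A.Trans i j (z, vmap (f j) N (z, v))).1) -
        tensV q (f i q (φ + Z v)) + (tensV q (f i q (φ + Z v)) -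
          ∑ κ ∈ range (N + 1 + 1), taylor (fun z => tensV q (f i q z)) φ κ fun _ => Z v))) (T.mulVec v))
      ?_ EventuallyEq.rfl
    · rw [one_mul, norm_mul, norm_norm, Real.norm_of_nonneg (by positivity)]
      exact norm_ev_ofTensV_le _ _
    · filter_upwards [ha.eventually (Metric.isOpen_ball.mem_nhds hφ)] with v hv
      have h8 : range (N + 1 + 1) = insert 0 (Icc 1 (N + 1)) := by
        ext q; simp only [mem_range, mem_insert, mem_Icc]; omega
      have h9 : taylor (fun z => tensV q (f i q z)) φ 0 (fun _ => Z v) = tensV q (f i q φ) := by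
        simp [taylor]
      rw [sub_add_sub_cancel, h8, sum_insert (by simp), h9, map_sub, map_add, map_sum, ev_sub, ev_add, ev_sum,
        ofTensV_tensV fun l => (hf i q l).1 _ hv, ofTensV_tensV fun l => (hf i q l).1 _ hφ]
  refine (h2.sub (IsBigO.fun_sum hq)).congr_left fun v => ?_
  have e1 : A.rem f N i j (z, v) = (A.Trans i j (z, vmap (f j) N (z, v))).2 - (T.mulVec v +
    ∑ q ∈ Icc 2 N, ev (f i q (A.Trans i j (z, vmap (f j) N (z, v))).1) (T.mulVec v)) := rfl
  have e2 : vmap (f j) N (z, v) = v + ∑ q ∈ Icc 2 N, ev (f j q z) v := rfl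
  have e3 : ev (A.compPoly f N i j z) v = ∑ q ∈ Icc 2 N, ∑ κ ∈ Icc 1 (N + 1),
      ev (ofTensV q (taylor (fun z => tensV q (f i q z)) φ κ fun _ => Z v)) (T.mulVec v) :=
    ev_compTerms _ _ _ _ _ _
  have e4 : T.mulVec (vmap (f j) N (z, v)) = T.mulVec v + ∑ q ∈ Icc 2 N, T.mulVec (ev (f j q z) v) := by
    rw [e2, Matrix.mulVec_add, Matrix.mulVec_sum]
  rw [e1, e4, sum_sub_distrib, sum_add_distrib, ← e3, ev_sub, ev_add, ev_sum]
  have e5 : ∀ q, ev (A.delta (fun j => f j q) i j z) v = T.mulVec (ev (f j q z) v) - ev (f i q φ) (T.mulVec v) :=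
    fun q => by rw [delta, ev_sub, ev_act, ev_subst]
  simp only [e5, sum_sub_distrib]
  abel

/-- The component of degree `N + 1` of the expanded defect must vanish. The coboundaries of the
lower terms have degree at most `N` and drop out. -/
theorem fnorm_delta_le (hsplit : A.IsSplit) (hunitary : A.IsUnitary)
    (hf : ∀ j q, HolPoly q (Metric.ball 0 A.rOut) (f j q)) (hN : 1 ≤ N) (hs : A.Solves f (N + 1))
    (hz : z ∈ A.dom A.rOut i j) (l : Fin d) :
    fnorm (N + 1) (A.delta (fun j => f j (N + 1)) i j z l) ≤
      fnorm (N + 1) (A.compPoly f N i j z l) + fnorm (N + 1) (A.vertPoly f N i j z l) := by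
  have hid : Tendsto (fun v : Fin d → ℂ => v) (𝓝 0) (𝓝 0) := tendsto_id
  have h1 := (A.isBigO_rem_sub (N := N) hsplit hf hz).trans_isLittleO
    (isLittleO_pow_norm hid (by omega : N + 1 < N + 2))
  have h2 := (A.isLittleO_rem_succ hsplit hunitary hN (fun j q _ => hf j q) hz).comp_tendsto (tendsto_mk z)
  have h3 : (fun v => A.rem f (N + 1) i j (z, v)) =o[𝓝 0] fun v : Fin d → ℂ => ‖v‖ ^ (N + 1) :=
    hs.isLittleO_fibre A hz
  have h4 : (fun v => ev (∑ q ∈ Icc 2 N, A.delta (fun j => f j q) i j z + A.vertPoly f N i j z -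
      A.compPoly f N i j z + A.delta (fun j => f j (N + 1)) i j z) v) =o[𝓝 0]
      fun v => ‖v‖ ^ (N + 1) := by
    refine ((h3.sub h2).sub h1).congr_left fun v => ?_
    simp only [Function.comp_apply, ev_add]
    abel
  have h5 := homogeneousComponent_eq_zero_of_isLittleO (isLittleO_pi.1 h4 l)
  have h6 := congrArg (tens (N + 1)) h5
  rw [tens_homogeneousComponent, map_zero] at h6
  simp only [Pi.add_apply, Pi.sub_apply, Finset.sum_apply, map_add, map_sub, map_sum] at h6
  have h7 : ∀ q ∈ Icc 2 N, tens (N + 1) (A.delta (fun j => f j q) i j z l) = 0 := fun q hq =>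
    tens_eq_zero ((A.holPoly_delta hunitary (fun j => hf j q) i j l).1 z hz)
      (by rw [mem_Icc] at hq; omega)
  rw [sum_eq_zero h7, zero_add] at h6
  have h8 : tens (N + 1) (A.delta (fun j => f j (N + 1)) i j z l) =
      tens (N + 1) (A.compPoly f N i j z l) - tens (N + 1) (A.vertPoly f N i j z l) := by
    rw [eq_sub_iff_add_eq, ← sub_eq_zero, ← h6]
    abel
  rw [fnorm, h8]
  exact norm_sub_le _ _

end AdaptedAtlas

end VertLin

end

/-! ### Majorants and the geometric bound. -/

noncomputable section

namespace VertLin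

open MvPolynomial Finset Filter Asymptotics

section

variable {n d m N : ℕ} {w : ℕ → ℝ}

theorem Bd.sum_of_isHomogeneous (hw0 : ∀ i, 0 ≤ w i) {lam : ℝ} (hlam : 0 ≤ lam)
    {h : ℕ → MvPolynomial (Fin d) ℂ} (hh : ∀ q ∈ Icc 2 N, (h q).IsHomogeneous q)
    (hb : ∀ q ∈ Icc 2 N, fnorm q (h q) ≤ lam * w q) : Bd w m lam (∑ q ∈ Icc 2 N, h q) := by
  intro i _
  refine (fnorm_sum_le _ _ _).trans ?_
  by_cases hi : i ∈ Icc 2 N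
  · rw [sum_eq_single_of_mem i hi fun q hq hqi => fnorm_eq_zero_of_isHomogeneous (hh q hq) hqi]
    exact hb i hi
  · rw [sum_eq_zero fun q hq => fnorm_eq_zero_of_isHomogeneous (m := i) (hh q hq) fun h => hi (h ▸ hq)]
    exact mul_nonneg hlam (hw0 i)

theorem Bd.X (hw0 : ∀ i, 0 ≤ w i) {ε : ℝ} (hε : 0 ≤ ε) (hw1 : 1 ≤ ε * w 1) (b : Fin d) :
    Bd w m ε (X b) := by
  intro i _
  by_cases hi : 1 = i
  · subst hi
    exact (fnorm_X b).trans hw1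
  · rw [fnorm_eq_zero_of_isHomogeneous (isHomogeneous_X ℂ b) hi]
    exact mul_nonneg hε (hw0 i)

theorem Bd.add {γ γ' : ℝ} {P Q : MvPolynomial (Fin d) ℂ} (hP : Bd w m γ P) (hQ : Bd w m γ' Q) :
    Bd w m (γ + γ') (P + Q) := fun i hi => by
  rw [add_mul]
  exact (fnorm_add_le _ _ _).trans (add_le_add (hP i hi) (hQ i hi))

variable (hw0 : ∀ i, 0 ≤ w i)
  (hw : ∀ i ≤ m, ∑ a ∈ HasAntidiagonal.antidiagonal i, w a.1 * w a.2 ≤ w i)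

include hw0 hw in
-- The series starts at `κ = 2`, so the geometric sum leaves a factor `γ²`. This square is the gain
-- that closes the induction.
theorem Bd.sum_mlPoly {γ A₀ a : ℝ} (hγ : 0 ≤ γ) (hA₀ : 0 ≤ A₀) (ha : 0 ≤ a) (hsmall : a * d * γ ≤ 1 / 2)
    {y : Poly d} (hy : ∀ b, Bd w m γ (y b)) {p : ∀ κ, (Fin κ → Fin d) → ℂ}
    (hp : ∀ κ s, ‖p κ s‖ ≤ A₀ * a ^ κ) :
    Bd w m (2 * A₀ * (a * d) ^ 2 * γ ^ 2) (∑ κ ∈ Icc 2 (N + 1), VertLin.mlPoly (p κ) y) := by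
  have h := Bd.sum (Icc 2 (N + 1)) fun κ hκ => Bd.mlPoly hw0 hw hγ hy (k := κ)
    (by rw [mem_Icc] at hκ; omega) (hp κ)
  refine h.mono hw0 ?_
  calc ∑ κ ∈ Icc 2 (N + 1), A₀ * a ^ κ * (d * γ) ^ κ = A₀ * ∑ κ ∈ Icc 2 (N + 1), (a * d * γ) ^ κ := by
        rw [mul_sum]
        exact sum_congr rfl fun κ _ => by rw [mul_assoc, ← mul_pow, mul_assoc a]
    _ ≤ A₀ * (2 * (a * d * γ) ^ 2) := by
        gcongr
        exact sum_Icc_pow_le (by positivity) hsmall _ _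
    _ = 2 * A₀ * (a * d) ^ 2 * γ ^ 2 := by ring

theorem norm_apply_vert_le {κ : ℕ} (g : Model n d → Model n d) (c : Model n d) (s : Fin κ → Fin d) :
    ‖taylor g c κ fun a => vert n (s a)‖ ≤ ‖taylor g c κ‖ := by
  refine ((taylor g c κ).le_opNorm _).trans (mul_le_of_le_one_right (norm_nonneg _) ?_)
  exact prod_le_one (fun _ _ => norm_nonneg _) fun a _ => norm_vert_le _

include hw0 hw in
theorem Bd.vertTerms {γ A₀ a : ℝ} (hγ : 0 ≤ γ) (hA₀ : 0 ≤ A₀) (ha : 0 ≤ a) (hsmall : a * d * γ ≤ 1 / 2)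
    {y : Poly d} (hy : ∀ b, Bd w m γ (y b)) {g : Model n d → Model n d} {c : Model n d}
    (hg : ∀ κ, ‖taylor g c κ‖ ≤ A₀ * a ^ κ) (l : Fin d) :
    Bd w m (2 * A₀ * (a * d) ^ 2 * γ ^ 2) (VertLin.vertTerms g c N y l) :=
  Bd.sum_mlPoly hw0 hw hγ hA₀ ha hsmall hy fun κ s =>
    (norm_le_pi_norm _ l).trans ((norm_snd_le _).trans ((norm_apply_vert_le g c s).trans (hg κ)))

include hw0 hw in
theorem Bd.horTerms {γ A₀ a : ℝ} (hγ : 0 ≤ γ) (hA₀ : 0 ≤ A₀) (ha : 0 ≤ a) (hsmall : a * d * γ ≤ 1 / 2)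
    {y : Poly d} (hy : ∀ b, Bd w m γ (y b)) {g : Model n d → Model n d} {c : Model n d}
    (hg : ∀ κ, ‖taylor g c κ‖ ≤ A₀ * a ^ κ) (l : Fin n) :
    Bd w m (2 * A₀ * (a * d) ^ 2 * γ ^ 2) (VertLin.horTerms g c N y l) :=
  Bd.sum_mlPoly hw0 hw hγ hA₀ ha hsmall hy fun κ s =>
    (norm_le_pi_norm _ l).trans ((norm_fst_le _).trans ((norm_apply_vert_le g c s).trans (hg κ)))

theorem norm_single_one_le (b : Fin n) : ‖(Pi.single b 1 : Fin n → ℂ)‖ ≤ 1 := by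
  refine (pi_norm_le_iff_of_nonneg zero_le_one).2 fun i => ?_
  by_cases h : i = b
  · subst h; simp
  · simp [h]

/-- Cauchy estimates in the base point for the coefficient tensors. The summands have distinct
degrees, so nothing accumulates in the sum over `q`. -/
theorem Bd.coeffPoly {ρ lam : ℝ} (hw0 : ∀ i, 0 ≤ w i) (hlam : 0 ≤ lam) (hρ : 0 < ρ)
    {f : ℕ → (Fin n → ℂ) → Poly d} {φ : Fin n → ℂ} (hf : ∀ q, HolPoly q (Metric.ball φ ρ) (f q))
    (hS : ∀ q ∈ Icc 2 N, ∀ z ∈ Metric.ball φ ρ, vnorm q (f q z) ≤ lam * w q)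
    {T : Matrix (Fin d) (Fin d) ℂ} (hT : T ∈ Matrix.unitaryGroup (Fin d) ℂ) (κ : ℕ) (s : Fin κ → Fin n)
    (l : Fin d) : Bd w m (3 * lam * (12 / ρ) ^ κ) (coeffPoly f N φ T κ s l) := by
  refine Bd.sum_of_isHomogeneous hw0 (by positivity)
    (fun q _ => subst_isHomogeneous (isHomogeneous_ofTensV _ _ _) _) fun q hq => ?_
  refine (fnorm_subst_le (isHomogeneous_ofTensV _ _ _) hT).trans ((fnorm_ofTensV_le _ _ _).trans ?_)
  refine ((taylor (fun z => tensV q (f q z)) φ κ).le_opNorm _).trans ?_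
  refine (mul_le_of_le_one_right (norm_nonneg _)
    (prod_le_one (fun _ _ => norm_nonneg _) fun a _ => norm_single_one_le _)).trans ?_
  refine (norm_taylor_le hρ (hf q).differentiableOn_tensV (hS q hq) κ).trans (le_of_eq ?_)
  ring

include hw0 hw in
theorem Bd.compTerms {ρ lam β : ℝ} (hlam : 0 ≤ lam) (hρ : 0 < ρ) (hβ : 0 ≤ β)
    (hsmall : 12 / ρ * n * β ≤ 1 / 2)
    {f : ℕ → (Fin n → ℂ) → Poly d} {φ : Fin n → ℂ} (hf : ∀ q, HolPoly q (Metric.ball φ ρ) (f q))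
    (hS : ∀ q ∈ Icc 2 N, ∀ z ∈ Metric.ball φ ρ, vnorm q (f q z) ≤ lam * w q)
    {T : Matrix (Fin d) (Fin d) ℂ} (hT : T ∈ Matrix.unitaryGroup (Fin d) ℂ)
    {Z : Fin n → MvPolynomial (Fin d) ℂ} (hZ : ∀ b, Bd w m β (Z b)) (l : Fin d) :
    Bd w m (6 * lam * (12 / ρ * n) * β) (VertLin.compTerms f N φ T Z l) := by
  have h := Bd.sum (Icc 1 (N + 1)) fun κ hκ => Bd.sum univ fun s _ =>
    Bd.mul hw0 hw (Bd.coeffPoly hw0 hlam hρ hf hS hT κ s l)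
      (Bd.prod hw0 hw hβ hZ (k := κ) (mem_Icc.1 hκ).1 s) (by positivity) (by positivity)
  refine h.mono hw0 ?_
  calc ∑ κ ∈ Icc 1 (N + 1), ∑ _s : Fin κ → Fin n, 3 * lam * (12 / ρ) ^ κ * β ^ κ
      = 3 * lam * ∑ κ ∈ Icc 1 (N + 1), (12 / ρ * n * β) ^ κ := by
        rw [mul_sum]
        refine sum_congr rfl fun κ _ => ?_
        rw [sum_const, card_univ, Fintype.card_fun, Fintype.card_fin, Fintype.card_fin, nsmul_eq_mul,
          mul_pow, mul_pow]
        push_cast; ring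
    _ ≤ 3 * lam * (2 * (12 / ρ * n * β) ^ 1) := by
        gcongr
        exact sum_Icc_pow_le (by positivity) hsmall _ _
    _ = 6 * lam * (12 / ρ * n) * β := by ring

end

namespace AdaptedAtlas

variable {n d : ℕ} {M : Type*} [TopologicalSpace M] [ChartedSpace (Model n d) M]
  [IsManifold 𝓘(ℂ, Model n d) ω M] {C : Set M} {ι : Type*} (A : AdaptedAtlas n d M C ι)
  {f : ι → ℕ → (Fin n → ℂ) → Poly d} {N : ℕ} {i j : ι} {z : Fin n → ℂ}

theorem exists_taylor_bound [T2Space M] [Finite ι] : ∃ A₀ a : ℝ, 0 ≤ A₀ ∧ 0 ≤ a ∧ ∀ k j, ∀ z ∈ A.dom A.rOut k j,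
    ∀ κ, ‖taylor (A.Trans k j) (z, 0) κ‖ ≤ A₀ * a ^ κ := by
  choose δ hδ B hB using fun p : ι × ι => A.exists_trans_bound p.1 p.2
  obtain ⟨A₀, hA₀⟩ := Finite.bddAbove_range fun p => 3 * |B p|
  obtain ⟨a, ha⟩ := Finite.bddAbove_range fun p => 12 / δ p
  refine ⟨max A₀ 0, max a 0, le_max_right _ _, le_max_right _ _, fun k j z hz κ => ?_⟩
  obtain ⟨h1, h2⟩ := hB (k, j) z hz
  have h3 := norm_taylor_le (hδ (k, j)) h1 (fun x hx => (h2 x hx).trans (le_abs_self _)) κ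
  refine h3.trans ?_
  have := hδ (k, j)
  gcongr
  · exact (hA₀ ⟨(k, j), rfl⟩).trans (le_max_left _ _)
  · exact (ha ⟨(k, j), rfl⟩).trans (le_max_left _ _)

theorem vnorm_delta_le (hsplit : A.IsSplit) (hunitary : A.IsUnitary)
    (hf : ∀ j q, HolPoly q (Metric.ball 0 A.rOut) (f j q)) (hN : 1 ≤ N) (hs : A.Solves f (N + 1))
    {w : ℕ → ℝ} (hw0 : ∀ i, 0 ≤ w i)
    (hw : ∀ i ≤ N + 1, ∑ a ∈ HasAntidiagonal.antidiagonal i, w a.1 * w a.2 ≤ w i)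
    {ε lam A₀ a r : ℝ} (hε : 0 ≤ ε) (hw1 : 1 ≤ ε * w 1) (hlam : 0 ≤ lam) (hlam1 : lam ≤ 1)
    (hA₀ : 0 ≤ A₀) (ha : 0 ≤ a) (hr : r < A.rOut)
    (hS : ∀ q ∈ Icc 2 N, ∀ j, ∀ z ∈ Metric.ball (0 : Fin n → ℂ) A.rOut, vnorm q (f j q z) ≤ lam * w q)
    (hsmall : a * d * (ε + lam) ≤ 1 / 2)
    (hsmall' : 12 / (A.rOut - r) * n * (2 * A₀ * (a * d) ^ 2 * (ε + lam) ^ 2) ≤ 1 / 2)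
    (hz : z ∈ Metric.ball (0 : Fin n → ℂ) A.rOut) (hi : A.pt j z ∈ A.U r i)
    (hT : ∀ κ, ‖taylor (A.Trans i j) (z, 0) κ‖ ≤ A₀ * a ^ κ) :
    vnorm (N + 1) (A.delta (fun j => f j (N + 1)) i j z) ≤
      d * ((6 * (12 / (A.rOut - r) * n) + 1) * (2 * A₀ * (a * d) ^ 2)) * (ε + lam) ^ 2 * w (N + 1) := by
  have hd := A.mem_dom_of_mem_U hr.le hz hi
  have hρ : 0 < A.rOut - r := sub_pos.2 hr
  have hφ : A.transC i j z ∈ Metric.ball (0 : Fin n → ℂ) r := hi.2.2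
  -- The image point lies in the polydisc of radius `r`, so the Cauchy estimates for `f_i` always
  -- have radius `rOut - r`: the domain does not shrink from one degree to the next.
  have hsub : Metric.ball (A.transC i j z) (A.rOut - r) ⊆ Metric.ball 0 A.rOut := by
    refine Metric.ball_subset_ball' ?_
    rw [Metric.mem_ball] at hφ
    linarith
  set γ := ε + lam
  have hγ : 0 ≤ γ := add_nonneg hε hlam
  have hy : ∀ b, Bd w (N + 1) γ (yPoly (f j) N z b) := fun b =>
    (Bd.X hw0 hε hw1 b).add (Bd.sum_of_isHomogeneous hw0 hlam (fun q _ => (hf j q b).1 z hz)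
      fun q hq => (fnorm_le_vnorm q _ b).trans (hS q hq j z hz))
  set β := 2 * A₀ * (a * d) ^ 2 * γ ^ 2
  have hβ : 0 ≤ β := by positivity
  have hv := fun l => Bd.vertTerms hw0 hw (N := N) hγ hA₀ ha hsmall hy hT l
  have hh := fun l => Bd.horTerms hw0 hw (N := N) hγ hA₀ ha hsmall hy hT l
  have hc := fun l => Bd.compTerms hw0 hw (N := N) hlam hρ hβ hsmall' (fun q => (hf i q).mono hsub)
    (fun q hq z hz => hS q hq i z (hsub hz)) (hunitary i j z hd) hh l
  refine (vnorm_le_sum _ _).trans ?_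
  calc ∑ l, fnorm (N + 1) (A.delta (fun j => f j (N + 1)) i j z l)
      ≤ ∑ _l : Fin d, (6 * 1 * (12 / (A.rOut - r) * n) * β + β) * w (N + 1) := by
        refine sum_le_sum fun l _ => (A.fnorm_delta_le hsplit hunitary hf hN hs hd l).trans ?_
        rw [add_mul]
        refine add_le_add ((hc l _ le_rfl).trans ?_) (hv l _ le_rfl)
        have := hw0 (N + 1)
        gcongr
    _ = _ := by
        rw [sum_const, card_univ, Fintype.card_fin, nsmul_eq_mul]
        ring

theorem exists_geometric_bound [T2Space M] [Finite ι] [Nonempty (Fin d)] (hC : IsCompact C)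
    (hsplit : A.IsSplit) (hunitary : A.IsUnitary) {L₀ L : ℝ} (hL₀ : 0 < L₀) (hL : 0 < L)
    (heta : ∀ m : ℕ, 1 ≤ m → eta A.K m ≤ ENNReal.ofReal (L₀ * L ^ m))
    (hH0 : ∀ l : ℕ, 1 < l → A.H0Vanishes l)
    (hf : ∀ j q, HolPoly q (Metric.ball 0 A.rOut) (f j q)) (hs : ∀ N ≥ 1, A.Solves f N) :
    ∃ R : ℝ, 0 < R ∧ ∀ m, 2 ≤ m → ∀ j, ∀ z ∈ Metric.ball (0 : Fin n → ℂ) A.rOut,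
      vnorm m (f j m z) ≤ L₀ * R ^ m := by
  obtain ⟨r, hr0, hr, hcov⟩ := A.exists_rad hC
  obtain ⟨c, hc0, hc⟩ := A.exists_small_divisor_bound hsplit hunitary hr hcov
  obtain ⟨A₀, a, hA₀, ha, hT⟩ := A.exists_taylor_bound
  have hrO : r < A.rOut := hr.trans A.rIn_lt
  have hρ : 0 < A.rOut - r := sub_pos.2 hrO
  set A₁ := 2 * A₀ * (a * d) ^ 2
  set A₂ := d * ((6 * (12 / (A.rOut - r) * n) + 1) * A₁)
  have hA₁ : 0 ≤ A₁ := by positivity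
  have hA₂ : 0 ≤ A₂ := by positivity
  have hK' : 0 ≤ 12 / (A.rOut - r) * n * A₁ := by positivity
  -- Each summand serves one inequality: `R ≥ 1`, the two smallness conditions `hsm1` and `hsm2`,
  -- and the closing estimate `h1`. The number 33 is `32 + 1`, from `ε + lam = 32 / R + 1 / R`.
  set R := 1 + 66 * (a * d) + 2 * 33 ^ 2 * (12 / (A.rOut - r) * n * A₁) + c * A₂ * 33 ^ 2
  have had : 0 ≤ a * d := by positivity
  have hcA : 0 ≤ c * A₂ := by positivity
  have hR1 : 1 ≤ R := by simp only [R]; linarith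
  have hR : 0 < R := by linarith
  have hγ : 32 / R + R⁻¹ = 33 / R := by field_simp; norm_num
  have hηtop : ∀ m, 1 ≤ m → eta A.K m ≠ ⊤ := fun m hm => ne_top_of_le_ne_top ENNReal.ofReal_ne_top (heta m hm)
  -- The factor `R⁻¹` is the `lam` of `vnorm_delta_le`; it makes the nonlinear terms small along
  -- with the linear one.
  have key : ∀ m, 2 ≤ m → ∀ j, ∀ z ∈ Metric.ball (0 : Fin n → ℂ) A.rOut,
      vnorm m (f j m z) ≤ R⁻¹ * ((eta A.K m).toReal * convWeight R m) := by
    intro m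
    induction m using Nat.strong_induction_on with
    | _ m ih =>
      intro hm j z hz
      obtain ⟨N, rfl⟩ : ∃ N, m = N + 1 := ⟨m - 1, by omega⟩
      have hηm := hηtop (N + 1) (by omega)
      have hKtop : A.K (N + 1) ≠ ⊤ := ne_top_of_le_ne_top hηm (le_eta hm)
      have hθtop : ∀ i ≤ N + 1, theta A.K (N + 1) i ≠ ⊤ := fun i hi =>
        ne_top_of_le_ne_top hηm ((theta_mono hi).trans (theta_le_eta hm (A.one_le_K j)))
      set θ : ℕ → ℝ := fun i => (theta A.K (N + 1) i).toReal
      have hθ0 : ∀ i, 0 ≤ θ i := fun i => ENNReal.toReal_nonneg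
      -- `θ` is submultiplicative and `convWeight` is stable under convolution, so the product is
      -- again admissible. In degrees up to `N` it dominates the `η_q` of the induction hypothesis,
      -- and in degree `N + 1` it yields `K θ = η`.
      set w : ℕ → ℝ := fun i => θ i * convWeight R i
      have hb0 := fun i => convWeight_nonneg hR.le i
      have hw0 : ∀ i, 0 ≤ w i := fun i => mul_nonneg (hθ0 i) (hb0 i)
      have hw : ∀ i ≤ N + 1, ∑ a ∈ HasAntidiagonal.antidiagonal i, w a.1 * w a.2 ≤ w i := by
        intro i hi
        calc ∑ a ∈ HasAntidiagonal.antidiagonal i, w a.1 * w a.2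
            ≤ ∑ a ∈ HasAntidiagonal.antidiagonal i, θ i * (convWeight R a.1 * convWeight R a.2) := by
              refine sum_le_sum fun p hp => ?_
              have hp := HasAntidiagonal.mem_antidiagonal.1 hp
              have h1 : θ p.1 * θ p.2 ≤ θ i := by
                have h2 := theta_mul_le (K := A.K) (m := N + 1) p.1 p.2
                rw [hp] at h2
                have h3 := ENNReal.toReal_mono (hθtop i hi) h2
                rwa [ENNReal.toReal_mul] at h3
              calc w p.1 * w p.2 = θ p.1 * θ p.2 * (convWeight R p.1 * convWeight R p.2) := by
                    simp only [w]; ring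
                _ ≤ _ := mul_le_mul_of_nonneg_right h1 (mul_nonneg (hb0 _) (hb0 _))
          _ ≤ w i := by
              rw [← mul_sum]
              exact mul_le_mul_of_nonneg_left (sum_convWeight_le hR.le i) (hθ0 i)
      -- `convWeight R 1 = R / 32`, so `ε = 32 / R` is what bounds the coordinates `X b`.
      have hw1 : 1 ≤ 32 / R * w 1 := by
        have h1 : 1 ≤ θ 1 := by
          have := ENNReal.toReal_mono (hθtop 1 (by omega)) (one_le_theta (K := A.K) (m := N + 1) 1)
          simpa using this
        have h2 : 32 / R * w 1 = θ 1 := by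
          simp only [w, convWeight]
          field_simp
          norm_num
        rw [h2]; exact h1
      have hS : ∀ q ∈ Icc 2 N, ∀ j, ∀ z ∈ Metric.ball (0 : Fin n → ℂ) A.rOut,
          vnorm q (f j q z) ≤ R⁻¹ * w q := by
        intro q hq j z hz
        rw [mem_Icc] at hq
        refine (ih q (by omega) hq.1 j z hz).trans ?_
        have h1 := ENNReal.toReal_mono (hθtop q (by omega))
          (eta_le_theta (K := A.K) (m := N + 1) (i := q) (by omega) (by omega))
        have := hb0 q
        simp only [w]
        gcongr
      have hsm1 : a * d * (32 / R + R⁻¹) ≤ 1 / 2 := by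
        rw [hγ, mul_div_assoc', div_le_iff₀ hR]
        simp only [R]; linarith
      have hsm2 : 12 / (A.rOut - r) * n * (A₁ * (32 / R + R⁻¹) ^ 2) ≤ 1 / 2 := by
        rw [hγ, div_pow, ← mul_assoc, mul_div_assoc', div_le_iff₀ (by positivity)]
        have : R ≤ R ^ 2 := by nlinarith
        have h2 : 2 * 33 ^ 2 * (12 / (A.rOut - r) * n * A₁) ≤ R := by simp only [R]; linarith
        linarith
      have hδ : ∀ i j, ∀ z ∈ Metric.ball (0 : Fin n → ℂ) A.rOut, A.pt j z ∈ A.U r i →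
          vnorm (N + 1) (A.delta (fun j => f j (N + 1)) i j z) ≤ A₂ * (32 / R + R⁻¹) ^ 2 * w (N + 1) :=
        fun i j z hz hi => A.vnorm_delta_le hsplit hunitary hf (by omega) (hs _ (by omega)) hw0 hw (by positivity)
          hw1 (by positivity) (inv_le_one_of_one_le₀ hR1) hA₀ ha hrO hS hsm1 hsm2 hz hi
          (hT i j z (A.mem_dom_of_mem_U hrO.le hz hi))
      have hfin := hc (N + 1) (hH0 _ (by omega)) hKtop _ (fun j => hf j (N + 1)) _
        (mul_nonneg (by positivity) (hw0 _)) hδ j z hz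
      refine hfin.trans ?_
      have hη : (eta A.K (N + 1)).toReal = (A.K (N + 1)).toReal * θ (N + 1) := by
        rw [eta_eq (by omega), ENNReal.toReal_mul]
      -- The quadratic gain `(33 / R)²` beats the required `R⁻¹`, the constant `c * A₂` being
      -- independent of `R`.
      have h1 : c * A₂ * (32 / R + R⁻¹) ^ 2 ≤ R⁻¹ := by
        rw [hγ, div_pow, mul_div_assoc', div_le_iff₀ (by positivity)]
        have h2 : c * A₂ * 33 ^ 2 ≤ R := by simp only [R]; linarith
        have h3 : R⁻¹ * R ^ 2 = R := by field_simp
        linarith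
      calc c * (A.K (N + 1)).toReal * (A₂ * (32 / R + R⁻¹) ^ 2 * w (N + 1))
          = c * A₂ * (32 / R + R⁻¹) ^ 2 * ((eta A.K (N + 1)).toReal * convWeight R (N + 1)) := by
            rw [hη]; simp only [w]; ring
        _ ≤ _ := mul_le_mul_of_nonneg_right h1 (mul_nonneg ENNReal.toReal_nonneg (hb0 _))
  refine ⟨L * R, by positivity, fun m hm j z hz => (key m hm j z hz).trans ?_⟩
  have h1 : (eta A.K m).toReal ≤ L₀ * L ^ m := by
    have := ENNReal.toReal_mono ENNReal.ofReal_ne_top (heta m (by omega))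
    rwa [ENNReal.toReal_ofReal (by positivity)] at this
  have h2 : convWeight R m ≤ R ^ m := by
    rw [convWeight]
    refine div_le_self (by positivity) ?_
    nlinarith [(Nat.cast_nonneg m : (0 : ℝ) ≤ m)]
  calc R⁻¹ * ((eta A.K m).toReal * convWeight R m) ≤ 1 * (L₀ * L ^ m * R ^ m) := by
        have := convWeight_nonneg hR.le m
        gcongr
        exact inv_le_one_of_one_le₀ hR1
    _ = L₀ * (L * R) ^ m := by rw [mul_pow]; ring

end AdaptedAtlas

end VertLin

end

/-! ### Convergence and disappearance of the defect. -/

noncomputable section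

namespace VertLin

open MvPolynomial Finset Filter Asymptotics

namespace AdaptedAtlas

variable {n d : ℕ} {M : Type*} [TopologicalSpace M] [ChartedSpace (Model n d) M]
  [IsManifold 𝓘(ℂ, Model n d) ω M] {C : Set M} {ι : Type*} (A : AdaptedAtlas n d M C ι)

/-- The sum `v + ∑_{q ≥ 2} f_q(z, v)` of a vertical change of coordinates. -/
def vlim (f : ℕ → (Fin n → ℂ) → Poly d) (x : Model n d) : Fin d → ℂ :=
  x.2 + ∑' m, ev (f (m + 2) x.1) x.2

section

variable {r L₀ R σ : ℝ} {f : ℕ → (Fin n → ℂ) → Poly d}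

/-- A geometric tail beginning in degree `K + 2`; the choice of `σ` keeps its ratio at most `1 / 2`,
whence the factor 2. -/
theorem norm_vlim_sub_vmap_le (hL₀ : 0 ≤ L₀) (hR : 0 ≤ R) (hσ : R * (d * σ) ≤ 1 / 2)
    (hf : ∀ q, HolPoly q (Metric.ball 0 r) (f q))
    (hb : ∀ q, 2 ≤ q → ∀ z ∈ Metric.ball (0 : Fin n → ℂ) r, vnorm q (f q z) ≤ L₀ * R ^ q)
    {x : Model n d} (hx : x.1 ∈ Metric.ball (0 : Fin n → ℂ) r) (hx2 : ‖x.2‖ ≤ σ) (K : ℕ) :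
    ‖vlim f x - vmap f (K + 1) x‖ ≤ 2 * L₀ * (R * (d * ‖x.2‖)) ^ (K + 2) := by
  set θ := R * (d * ‖x.2‖)
  have hθ0 : 0 ≤ θ := by positivity
  have hθ : θ ≤ 1 / 2 := le_trans (by simp only [θ]; gcongr) hσ
  have ha : ∀ m, ‖ev (f (m + 2) x.1) x.2‖ ≤ L₀ * θ ^ 2 * θ ^ m := fun m => by
    refine (norm_ev_le (fun l => (hf (m + 2) l).1 _ hx) _).trans ?_
    calc _ ≤ L₀ * R ^ (m + 2) * (d * ‖x.2‖) ^ (m + 2) := by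
          gcongr; exact hb _ (by omega) _ hx
      _ = _ := by simp only [θ, mul_pow]; ring
  have hg : Summable fun m => L₀ * θ ^ 2 * θ ^ m :=
    (summable_geometric_of_lt_one hθ0 (by linarith)).mul_left _
  have hs : Summable fun m => ev (f (m + 2) x.1) x.2 := Summable.of_norm_bounded hg ha
  have hv : vmap f (K + 1) x = x.2 + ∑ m ∈ range K, ev (f (m + 2) x.1) x.2 := by
    rw [vmap, range_eq_Ico, Finset.sum_Ico_add' (fun q => ev (f q x.1) x.2)]
    rfl
  have hd : vlim f x - vmap f (K + 1) x = ∑' m, ev (f (m + K + 2) x.1) x.2 := by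
    rw [hv, vlim, ← hs.sum_add_tsum_nat_add K, add_sub_add_left_eq_sub, add_sub_cancel_left]
  rw [hd]
  have hgK : HasSum (fun m => L₀ * θ ^ (K + 2) * θ ^ m) (L₀ * θ ^ (K + 2) * (1 - θ)⁻¹) :=
    (hasSum_geometric_of_lt_one hθ0 (by linarith)).mul_left _
  refine (tsum_of_norm_bounded hgK fun m => (ha (m + K)).trans (le_of_eq (by ring))).trans ?_
  have h2 : (1 - θ)⁻¹ ≤ 2 := by
    rw [inv_le_comm₀ (by linarith) two_pos]; linarith
  calc _ ≤ L₀ * θ ^ (K + 2) * 2 := by gcongr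
    _ = _ := by ring

theorem analyticAt_vlim (hL₀ : 0 ≤ L₀) (hR : 0 ≤ R) (hσ : R * (d * σ) ≤ 1 / 2)
    (hf : ∀ q, HolPoly q (Metric.ball 0 r) (f q))
    (hb : ∀ q, 2 ≤ q → ∀ z ∈ Metric.ball (0 : Fin n → ℂ) r, vnorm q (f q z) ≤ L₀ * R ^ q)
    {x : Model n d} (hx : x.1 ∈ Metric.ball (0 : Fin n → ℂ) r) (hx2 : ‖x.2‖ < σ) :
    AnalyticAt ℂ (vlim f) x := by
  have hU : IsOpen (Metric.ball (0 : Fin n → ℂ) r ×ˢ Metric.ball (0 : Fin d → ℂ) σ) :=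
    Metric.isOpen_ball.prod Metric.isOpen_ball
  refine analyticOnNhd_of_differentiableOn hU (fun y hy => ?_) x ⟨hx, by simpa using hx2⟩
  obtain ⟨ε, hε, hsub⟩ := Metric.isOpen_iff.1 hU y hy
  refine (differentiableAt_of_tendstoUniformlyOn (f := fun K => vmap f (K + 1)) hε (fun K w hw =>
    (analyticAt_vmap (fun q _ => hf q) (hsub hw).1).differentiableAt.differentiableWithinAt)
    ?_).differentiableWithinAt
  rw [Metric.tendstoUniformlyOn_iff]
  intro e he
  have ht : Tendsto (fun K : ℕ => 2 * L₀ * (1 / 2 : ℝ) ^ (K + 2)) atTop (𝓝 0) := by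
    have := ((tendsto_pow_atTop_nhds_zero_of_lt_one (by norm_num : (0 : ℝ) ≤ 1 / 2)
      (by norm_num)).comp (tendsto_add_atTop_nat 2)).const_mul (2 * L₀)
    simpa using this
  filter_upwards [ht.eventually (gt_mem_nhds he)] with K hK w hw
  have hw2 : ‖w.2‖ ≤ σ := (mem_ball_zero_iff.1 (hsub hw).2).le
  rw [dist_eq_norm]
  refine ((norm_vlim_sub_vmap_le hL₀ hR hσ hf hb (hsub hw).1 hw2 K).trans ?_).trans_lt hK
  gcongr
  exact le_trans (by gcongr) hσ

theorem isBigO_vlim_sub_vmap (hL₀ : 0 ≤ L₀) (hR : 0 ≤ R) (hσ0 : 0 < σ) (hσ : R * (d * σ) ≤ 1 / 2)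
    (hf : ∀ q, HolPoly q (Metric.ball 0 r) (f q))
    (hb : ∀ q, 2 ≤ q → ∀ z ∈ Metric.ball (0 : Fin n → ℂ) r, vnorm q (f q z) ≤ L₀ * R ^ q)
    {z : Fin n → ℂ} (hz : z ∈ Metric.ball (0 : Fin n → ℂ) r) {X : Type*} {l : Filter X}
    {a : X → Fin n → ℂ} {w : X → Fin d → ℂ} (ha : Tendsto a l (𝓝 z)) (hw : Tendsto w l (𝓝 0))
    (K : ℕ) : (fun s => vlim f (a s, w s) - vmap f (K + 1) (a s, w s)) =O[l]
      fun s => ‖w s‖ ^ (K + 2) := by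
  refine IsBigO.of_bound (2 * L₀ * (R * d) ^ (K + 2)) ?_
  filter_upwards [ha.eventually (Metric.isOpen_ball.mem_nhds hz),
    hw.eventually (Metric.ball_mem_nhds 0 hσ0)] with s h1 h2
  refine (norm_vlim_sub_vmap_le hL₀ hR hσ hf hb (x := (a s, w s)) h1
    (mem_ball_zero_iff.1 h2).le K).trans (le_of_eq ?_)
  rw [norm_pow, norm_norm, ← mul_assoc R, mul_pow (R * d)]
  ring

theorem vlim_zero (hf : ∀ q, HolPoly q (Metric.ball 0 r) (f q)) {z : Fin n → ℂ}
    (hz : z ∈ Metric.ball (0 : Fin n → ℂ) r) : vlim f (z, 0) = 0 := by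
  have h : ∀ m, ev (f (m + 2) z) 0 = 0 := fun m => by
    have := norm_ev_le (fun l => (hf (m + 2) l).1 z hz) 0
    rw [norm_zero, mul_zero, zero_pow (by omega), mul_zero] at this
    exact norm_le_zero_iff.1 this
  simp [vlim, h]

theorem hasFDerivAt_mk_vlim (hL₀ : 0 ≤ L₀) (hR : 0 ≤ R) (hσ0 : 0 < σ) (hσ : R * (d * σ) ≤ 1 / 2)
    (hf : ∀ q, HolPoly q (Metric.ball 0 r) (f q))
    (hb : ∀ q, 2 ≤ q → ∀ z ∈ Metric.ball (0 : Fin n → ℂ) r, vnorm q (f q z) ≤ L₀ * R ^ q)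
    {z : Fin n → ℂ} (hz : z ∈ Metric.ball (0 : Fin n → ℂ) r) :
    HasFDerivAt (fun x : Model n d => ((x.1, vlim f x) : Model n d))
      (ContinuousLinearMap.id ℂ (Model n d)) (z, 0) := by
  have hfst : Tendsto (fun x : Model n d => x.1) (𝓝 (z, 0)) (𝓝 z) := continuous_fst.tendsto' _ _ rfl
  have hsnd : Tendsto (fun x : Model n d => x.2) (𝓝 (z, 0)) (𝓝 0) := continuous_snd.tendsto' _ _ rfl
  have h0 : ∀ x : Model n d, vmap f (0 + 1) x = x.2 := fun x => by simp [vmap]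
  have h1 := isBigO_vlim_sub_vmap hL₀ hR hσ0 hσ hf hb hz hfst hsnd 0
  have h2 := h1.trans_isLittleO (isLittleO_pow_norm hsnd (by norm_num : 1 < 0 + 2))
  simp only [pow_one, h0] at h2
  have h3 : HasFDerivAt (vlim f) (ContinuousLinearMap.snd ℂ (Fin n → ℂ) (Fin d → ℂ)) (z, 0) := by
    refine HasFDerivAt.of_isLittleO ?_
    have h3 : (fun x : Model n d => x.2) =O[𝓝 (z, 0)] fun x => x - (z, 0) :=
      IsBigO.of_bound 1 (Eventually.of_forall fun x => by
        rw [one_mul]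
        have := norm_snd_le (x - ((z, 0) : Model n d))
        simpa only [Prod.snd_sub, sub_zero] using this)
    refine (h2.norm_right.congr_left fun x => ?_).trans_isBigO (h3.norm_left.norm_left)
    rw [vlim_zero hf hz]
    simp
  exact hasFDerivAt_fst.prodMk h3

end

variable {f : ι → ℕ → (Fin n → ℂ) → Poly d} {L₀ R σ : ℝ}

/-- The limit differs from its truncation at degree `N + 1` by terms of order `N + 2`, so
linearization up to order `N + 1` survives in the limit, for every `N`. -/
theorem isLittleO_trans_sub_vlim (hunitary : A.IsUnitary) (hL₀ : 0 ≤ L₀) (hR : 0 ≤ R) (hσ0 : 0 < σ)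
    (hσ : R * (d * σ) ≤ 1 / 2) (hf : ∀ j q, HolPoly q (Metric.ball 0 A.rOut) (f j q))
    (hb : ∀ j q, 2 ≤ q → ∀ z ∈ Metric.ball (0 : Fin n → ℂ) A.rOut, vnorm q (f j q z) ≤ L₀ * R ^ q)
    (hs : ∀ N ≥ 1, A.Solves f N) {k j : ι} {z : Fin n → ℂ} (hz : z ∈ A.dom A.rOut k j) (N : ℕ) :
    (fun v => (A.Trans k j (z, vlim (f j) (z, v))).2 -
      vlim (f k) ((A.Trans k j (z, vlim (f j) (z, v))).1, (A.t k j z).mulVec v)) =o[𝓝 0]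
      fun v : Fin d → ℂ => ‖v‖ ^ N := by
  have hid : Tendsto (fun v : Fin d → ℂ => v) (𝓝 0) (𝓝 0) := tendsto_id
  have ha : Tendsto (fun _ : Fin d → ℂ => z) (𝓝 0) (𝓝 z) := tendsto_const_nhds
  have hN : (fun v : Fin d → ℂ => ‖v‖ ^ (N + 2)) =o[𝓝 0] fun v => ‖v‖ ^ (N + 1) :=
    isLittleO_pow_norm hid (by omega)
  have hY : Tendsto (fun v => vlim (f j) (z, v)) (𝓝 0) (𝓝 0) := by
    have h := (analyticAt_vlim hL₀ hR hσ (hf j) (hb j) (x := (z, 0)) hz.1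
      (by simpa using hσ0)).continuousAt.tendsto.comp (tendsto_mk z)
    rwa [vlim_zero (hf j) hz.1] at h
  have h1 := (isBigO_vlim_sub_vmap hL₀ hR hσ0 hσ (hf j) (hb j) hz.1 ha hid N).trans_isLittleO hN
  have h2 := A.isLittleO_trans_sub hunitary (N := N + 1) (fun j q _ => hf j q) hz ha hY hid
    (h1.neg_left.congr_left fun v => neg_sub _ _)
  have h3 := (hs (N + 1) (by omega)).isLittleO_fibre A hz
  have h4 := (isBigO_vlim_sub_vmap hL₀ hR hσ0 hσ (hf k) (hb k) (A.transC_mem_ball le_rfl hz)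
    (A.tendsto_trans_fst hz ha hY) (tendsto_mulVec (A.t k j z) hid) N).trans
      (((isBigO_mulVec (A.t k j z) fun v => v).norm_left.norm_right).pow (N + 2))
  have h5 := h4.trans_isLittleO hN
  have h6 : (fun v : Fin d → ℂ => ‖v‖ ^ (N + 1)) =o[𝓝 0] fun v => ‖v‖ ^ N :=
    isLittleO_pow_norm hid (by omega)
  refine ((((h2.add h3).sub h5)).trans h6).congr_left fun v => ?_
  abel

/-- The horizontal component of `Φ_{kj} F_j` is taken as `H`, which makes that half of the equation
trivial; its vertical derivative vanishes along `C` by the splitting. The normal half holds because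
its defect is holomorphic and flat to infinite order. -/
theorem holomorphicallyVerticallyLinearizable_of_bound (hsplit : A.IsSplit) (hunitary : A.IsUnitary)
    (hL₀ : 0 ≤ L₀) (hR : 0 ≤ R) (hf : ∀ j q, HolPoly q (Metric.ball 0 A.rOut) (f j q))
    (hb : ∀ j q, 2 ≤ q → ∀ z ∈ Metric.ball (0 : Fin n → ℂ) A.rOut, vnorm q (f j q z) ≤ L₀ * R ^ q)
    (hs : ∀ N ≥ 1, A.Solves f N) : A.HolomorphicallyVerticallyLinearizable := by
  obtain ⟨σ, hσ0, hσ⟩ : ∃ σ : ℝ, 0 < σ ∧ R * (d * σ) ≤ 1 / 2 := by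
    refine ⟨1 / (2 * (R * d + 1)), by positivity, ?_⟩
    rw [mul_one_div, mul_div_assoc', div_le_iff₀ (by positivity)]
    linarith
  have hF : ∀ j, ∀ z ∈ Metric.ball (0 : Fin n → ℂ) A.rOut,
      AnalyticAt ℂ (fun x : Model n d => ((x.1, vlim (f j) x) : Model n d)) (z, 0) := fun j z hz =>
    analyticAt_fst.prod (analyticAt_vlim hL₀ hR hσ (hf j) (hb j) (x := (z, 0)) hz
      (by simpa using hσ0))
  have hF0 : ∀ j, ∀ z ∈ Metric.ball (0 : Fin n → ℂ) A.rOut,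
      (((z, 0) : Model n d).1, vlim (f j) (z, 0)) = ((z, 0) : Model n d) := fun j z hz => by
    rw [vlim_zero (hf j) hz]
  have hT : ∀ k j, ∀ z ∈ A.dom A.rOut k j, AnalyticAt ℂ
      (fun x : Model n d => A.Trans k j (x.1, vlim (f j) x)) (z, 0) := fun k j z hz => by
    refine AnalyticAt.fun_comp (g := A.Trans k j) ?_ (hF j z hz.1)
    rw [hF0 j z hz.1]
    exact A.analyticAt_trans_mk hz
  have hT0 : ∀ k j, ∀ z ∈ A.dom A.rOut k j,
      A.Trans k j (z, vlim (f j) (z, 0)) = (A.transC k j z, 0) := fun k j z hz => by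
    rw [vlim_zero (hf j) hz.1, A.trans_zero hz]
  refine ⟨fun j x => (x.1, vlim (f j) x), fun k j x => (A.Trans k j (x.1, vlim (f j) x)).1,
    ?_, fun j z hz => ⟨hF0 j z hz, ?_⟩, ?_, fun k j z hz => ⟨?_, ?_⟩, fun k j => ?_⟩
  · rintro j ⟨z, v⟩ ⟨hz, rfl⟩
    exact hF j z hz
  · exact (hasFDerivAt_mk_vlim hL₀ hR hσ0 hσ (hf j) (hb j) hz).fderiv
  · rintro k j ⟨z, v⟩ ⟨hz, rfl⟩
    exact analyticAt_fst.fun_comp (hT k j z hz)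
  · exact congrArg (fun x => (A.Trans k j x).1) (hF0 j z hz.1)
  · have h1 : HasFDerivAt (A.Trans k j) (fderiv ℂ (A.Trans k j) (z, 0))
        (((z, 0) : Model n d).1, vlim (f j) (z, 0)) := by
      rw [hF0 j z hz.1]
      exact (A.analyticAt_trans_mk hz).differentiableAt.hasFDerivAt
    have h2 := HasFDerivAt.comp (f := fun x : Model n d => ((x.1, vlim (f j) x) : Model n d)) (z, 0) h1
      (hasFDerivAt_mk_vlim hL₀ hR hσ0 hσ (hf j) (hb j) hz.1)
    have h3 := (HasFDerivAt.comp (f := fun v : Fin d → ℂ => ((z, v) : Model n d)) 0 h2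
      (hasFDerivAt_prodMk_right z 0)).fst
    refine h3.fderiv.trans (ContinuousLinearMap.ext fun w => ?_)
    exact congrArg Prod.fst (A.fderiv_trans_apply hsplit hz w)
  · rw [eventually_nhdsSet_iff_forall]
    rintro ⟨z, v⟩ ⟨hz, rfl⟩
    have hfst : Tendsto (fun x : Model n d => x.1) (𝓝 (z, 0)) (𝓝 z) := continuous_fst.tendsto' _ _ rfl
    have hG : AnalyticAt ℂ (fun x : Model n d => (A.Trans k j (x.1, vlim (f j) x)).2 -
        vlim (f k) ((A.Trans k j (x.1, vlim (f j) x)).1, (A.t k j z).mulVec x.2)) (z, 0) := by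
      have h4 : AnalyticAt ℂ (fun x : Model n d => (((A.Trans k j (x.1, vlim (f j) x)).1,
          (A.t k j z).mulVec x.2) : Model n d)) (z, 0) := by
        refine (analyticAt_fst.fun_comp (hT k j z hz)).prod ?_
        exact ((LinearMap.toContinuousLinearMap (A.t k j z).mulVecLin).comp
          (ContinuousLinearMap.snd ℂ (Fin n → ℂ) (Fin d → ℂ))).analyticAt _
      refine (analyticAt_snd.fun_comp (hT k j z hz)).fun_sub
        (AnalyticAt.fun_comp (g := vlim (f k)) ?_ h4)
      refine analyticAt_vlim hL₀ hR hσ (hf k) (hb k) ?_ ?_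
      · simp only [hT0 k j z hz]
        exact A.transC_mem_ball le_rfl hz
      · simpa using hσ0
    -- In `hG` the matrix is frozen at `z`, which is legitimate on nearby slices because it is
    -- locally constant.
    have hG0 := eventually_eq_zero_of_forall_isLittleO hG (by
      filter_upwards [A.eventually_t_eq hunitary hz,
        (A.isOpen_dom le_rfl k j).mem_nhds hz] with z' ht hz' m
      rw [← ht]
      exact A.isLittleO_trans_sub_vlim hunitary hL₀ hR hσ0 hσ hf hb hs hz' m)
    filter_upwards [hG0, hfst.eventually (A.eventually_t_eq hunitary hz)] with x hx ht
    refine Prod.ext rfl ?_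
    rw [ht]
    exact sub_eq_zero.1 hx

end AdaptedAtlas

end VertLin

end

theorem theorem1p2 {n d : ℕ} {M : Type*} [TopologicalSpace M] [T2Space M]
    [ChartedSpace (VertLin.Model n d) M] [IsManifold 𝓘(ℂ, VertLin.Model n d) ω M]
    {C : Set M} (hC : IsCompact C) {ι : Type*} [Finite ι]
    (A : VertLin.AdaptedAtlas n d M C ι)
    (hsplit : A.IsSplit) (hunitary : A.IsUnitary)
    (L₀ L : ℝ) (hL₀ : 0 < L₀) (hL : 0 < L)
    (heta : ∀ m : ℕ, 1 ≤ m → VertLin.eta A.K m ≤ ENNReal.ofReal (L₀ * L ^ m))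
    (hH0 : ∀ l : ℕ, 1 < l → A.H0Vanishes l)
    (hformal : (∀ l : ℕ, 1 < l → A.H1Vanishes l) ∨ A.FormallyVerticallyLinearizable) :
    A.HolomorphicallyVerticallyLinearizable := by
  have hstep : ∀ N ≥ 1, ∀ f : ι → ℕ → (Fin n → ℂ) → VertLin.Poly d,
      (∀ j q, VertLin.HolPoly q (Metric.ball 0 A.rOut) (f j q)) → A.Solves f N →
      ∃ u : ι → (Fin n → ℂ) → VertLin.Poly d, VertLin.AdaptedAtlas.IsCochain₀ (N + 1) A.rOut u ∧
        ∀ k j, ∀ z ∈ A.dom A.rOut k j, A.delta u k j z = A.obstr f N k j z := by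
    intro N hN f hf h
    rcases hformal with hH1 | hformal
    · exact A.exists_delta_eq_obstr hsplit hunitary hN (hH1 (N + 1) (by omega)) hf h
    · exact A.exists_delta_eq_obstr_of_formal hunitary hH0 hformal hN hf h
  obtain ⟨f, hf, hs⟩ := A.exists_solution hsplit hunitary hstep
  obtain ⟨R, hR, hb⟩ : ∃ R : ℝ, 0 < R ∧ ∀ m, 2 ≤ m → ∀ j,
      ∀ z ∈ Metric.ball (0 : Fin n → ℂ) A.rOut, VertLin.vnorm m (f j m z) ≤ L₀ * R ^ m := by
    -- For `d = 0` the identity matrix has norm zero, so the argument for `1 ≤ K` breaks down; but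
    -- then vector valued polynomials have no components and the bound is trivial.
    rcases isEmpty_or_nonempty (Fin d) with hd | hd
    · refine ⟨1, one_pos, fun m _ j z _ => ?_⟩
      have h := VertLin.vnorm_le_sum m (f j m z)
      rw [Finset.univ_eq_empty, Finset.sum_empty] at h
      exact h.trans (by positivity)
    · exact A.exists_geometric_bound hC hsplit hunitary hL₀ hL heta hH0 hf hs
  exact A.holomorphicallyVerticallyLinearizable_of_bound hsplit hunitary hL₀.le hR.le hf
    (fun j m hm z hz => hb m hm j z hz) hs
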